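/- All Lie algebras are real and finite-dimensional, and a finite-dimensional Lie algebra $\mathfrak g$ carries its unique Hausdorff vector space topology. A \emph{Lie quasi-state} on $\mathfrak g$ is a function $\zeta:\mathfrak g\to\mathbb R$ such that $\zeta(aX+bY)=a\zeta(X)+b\zeta(Y)$ for all $a,b\in\mathbb R$ and all $X,Y\in\mathfrak g$ with $[X,Y]=0$. It is \emph{$\mathrm{Ad}$-invariant} if it is invariant under the adjoint group of $\mathfrak g$, that is, if $\zeta(e^{\mathrm{ad} X}Y)=\zeta(Y)$ for all $X,Y\in\mathfrak g$. Let $\mathcal Q_{\mathrm{Ad}}(\mathfrak g)$ be the space of continuous $\mathrm{Ad}$-invariant Lie quasi-states on $\mathfrak g$. A \emph{homogeneous quasimorphism} on a Lie group $G$ is a continuous function $f:G\to\mathbb R$ such that $\sup_{g,h\in G}|f(gh)-f(g)-f(h)|<\infty$ and $f(g^n)=n f(g)$ for all $g\in G$, $n\in\mathbb Z$. Let $\mathcal Q_{\mathrm{qm}}(\mathfrak g)$ be the space of continuous Lie quasi-states $\zeta$ on $\mathfrak g$ which are directional derivatives of homogeneous quasimorphisms, that is, for which there are a (not necessarily connected)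 Lie group $G$ with Lie algebra $\mathfrak g$ and a homogeneous quasimorphism $f$ on $G$ with $\zeta(X)=f(\exp_G(X))$ for all $X\in\mathfrak g$. The Lie algebra $\mathfrak g$ is \emph{quasi-state rigid} if $\mathcal Q_{\mathrm{qm}}(\mathfrak g)=\mathcal Q_{\mathrm{Ad}}(\mathfrak g)$. \textbf{Theorem.} Let $\mathfrak g$ be a real Lie algebra with $\dim\mathfrak g\le 3$. Then $\mathfrak g$ is quasi-state rigid if and only if it is not isomorphic to the three-dimensional Heisenberg algebra $\mathfrak h_3$, the Lie algebra of strictly upper triangular real $3\times 3$ matrices with the commutator bracket. -/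

import Mathlib

open scoped Manifold ContDiff Nat

noncomputable section

/-! ### Lie quasi-states on a real Lie algebra -/

section QuasiStates

variable {𝔤 : Type*} [LieRing 𝔤] [LieAlgebra ℝ 𝔤]

/-- A Lie quasi-state: a function that is linear on every pair of commuting elements. -/
def IsLieQuasiState (ζ : 𝔤 → ℝ) : Prop :=
  ∀ X Y : 𝔤, ⁅X, Y⁆ = 0 → ∀ a b : ℝ, ζ (a • X + b • Y) = a * ζ X + b * ζ Y

variable [TopologicalSpace 𝔤]

/-- `exp (ad X) Y = ∑ (ad X)^k Y / k!`. -/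
def expAd (X Y : 𝔤) : 𝔤 :=
  ∑' k : ℕ, ((k ! : ℝ)⁻¹) • ((LieAlgebra.ad ℝ 𝔤 X) ^ k) Y

/-- In finite dimension the series defining `expAd` converges. -/
theorem hasSum_expAd [IsTopologicalAddGroup 𝔤] [ContinuousSMul ℝ 𝔤] [T2Space 𝔤]
    [FiniteDimensional ℝ 𝔤] (X Y : 𝔤) :
    HasSum (fun k : ℕ => ((k ! : ℝ)⁻¹) • ((LieAlgebra.ad ℝ 𝔤 X) ^ k) Y) (expAd X Y) := by
  refine Summable.hasSum ?_
  let n := Module.finrank ℝ 𝔤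
  let E := EuclideanSpace ℝ (Fin n)
  have hn : Module.finrank ℝ 𝔤 = Module.finrank ℝ E := by simp [E, n]
  let u : 𝔤 ≃ₗ[ℝ] E := LinearEquiv.ofFinrankEq 𝔤 E hn
  let uc : 𝔤 ≃L[ℝ] E := u.toContinuousLinearEquiv
  let L : E →L[ℝ] E :=
    LinearMap.toContinuousLinearMap (u.conj (LieAlgebra.ad ℝ 𝔤 X))
  have h1 : Summable (fun k : ℕ => ((k ! : ℝ)⁻¹) • L ^ k) :=
    NormedSpace.expSeries_summable' (𝕂 := ℝ) L
  have h2 : Summable (fun k : ℕ => (((k ! : ℝ)⁻¹) • L ^ k) (u Y)) :=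
    h1.mapL (ContinuousLinearMap.apply ℝ E (u Y))
  have h3 := h2.mapL (uc.symm : E →L[ℝ] 𝔤)
  have hk : ∀ k : ℕ, (L ^ k) (u Y) = u (((LieAlgebra.ad ℝ 𝔤 X) ^ k) Y) := by
    intro k
    induction k with
    | zero => simp
    | succ k ih =>
      rw [pow_succ', pow_succ', mul_apply_eq_comp, ih]
      simp [L, LinearEquiv.conj_apply]
  refine h3.congr ?_
  intro k
  have : uc.symm (u (((LieAlgebra.ad ℝ 𝔤 X) ^ k) Y)) = ((LieAlgebra.ad ℝ 𝔤 X) ^ k) Y :=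
    u.symm_apply_apply _
  simp [hk, this]

/-- Invariance under the adjoint group, which is generated by the automorphisms `exp (ad X)`. -/
def IsAdInvariant (ζ : 𝔤 → ℝ) : Prop :=
  ∀ X Y : 𝔤, ζ (expAd X Y) = ζ Y

end QuasiStates

/-! ### Homogeneous quasimorphisms on Lie groups and their directional derivatives -/

/-- A homogeneous (continuous) quasimorphism on a topological group. -/
structure IsHomogeneousQuasimorphism {G : Type*} [Group G] [TopologicalSpace G] (f : G → ℝ) :
    Prop where
  continuous : Continuous f
  bounded_defect : ∃ D : ℝ, ∀ g h : G, |f (g * h) - f g - f h| ≤ D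
  map_zpow : ∀ (g : G) (n : ℤ), f (g ^ n) = n * f g

section Exponential

variable {n : ℕ} {G : Type*} [TopologicalSpace G]
  [ChartedSpace (EuclideanSpace ℝ (Fin n)) G] [Group G]

/-- `e` is the exponential map of the `n`-dimensional Lie group `G`: `e X = γ 1`, where `γ` is the
integral curve, defined on all of `ℝ` and starting at `1`, of the left-invariant vector field
given by `X`. -/
def IsExponentialMap (e : GroupLieAlgebra (𝓡 n) G → G) : Prop :=
  ∀ X : GroupLieAlgebra (𝓡 n) G, ∃ γ : ℝ → G,
    γ 0 = 1 ∧ IsMIntegralCurve (I := 𝓡 n) γ (mulInvariantVectorField X) ∧ γ 1 = e X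

/-- A smooth Lie group is regular enough for Mathlib's bracket on its Lie algebra. -/
instance instLieGroupMinSmoothness [LieGroup (𝓡 n) ∞ G] :
    LieGroup (𝓡 n) (minSmoothness ℝ 3) G :=
  LieGroup.of_le (n := ∞) (by
    rw [minSmoothness_of_isRCLikeNormedField]
    exact WithTop.coe_le_coe.2 le_top)

end Exponential

section Rigidity

variable {𝔤 : Type*} [LieRing 𝔤] [LieAlgebra ℝ 𝔤]

/-- `ζ` is the directional derivative `X ↦ f (exp X)` of a homogeneous quasimorphism `f` on some
Lie group `G` (not necessarily connected) whose Lie algebra is identified with `𝔤`. -/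
def IsDerivOfHomogeneousQuasimorphism (ζ : 𝔤 → ℝ) : Prop :=
  ∃ (n : ℕ) (G : Type) (_ : TopologicalSpace G) (_ : T2Space G) (_ : SecondCountableTopology G)
    (_ : ChartedSpace (EuclideanSpace ℝ (Fin n)) G) (_ : Group G) (_ : LieGroup (𝓡 n) ∞ G)
    (ι : 𝔤 ≃ₗ⁅ℝ⁆ GroupLieAlgebra (𝓡 n) G) (e : GroupLieAlgebra (𝓡 n) G → G) (f : G → ℝ),
    IsExponentialMap e ∧ IsHomogeneousQuasimorphism f ∧ ∀ X : 𝔤, ζ X = f (e (ι X))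

variable (𝔤) [TopologicalSpace 𝔤]

/-- The continuous Ad-invariant Lie quasi-states on `𝔤`. -/
def continuousAdInvariantQuasiStates : Set (𝔤 → ℝ) :=
  {ζ | IsLieQuasiState ζ ∧ Continuous ζ ∧ IsAdInvariant ζ}

/-- The continuous Lie quasi-states on `𝔤` that are directional derivatives of homogeneous
quasimorphisms. -/
def continuousQuasimorphismQuasiStates : Set (𝔤 → ℝ) :=
  {ζ | IsLieQuasiState ζ ∧ Continuous ζ ∧ IsDerivOfHomogeneousQuasimorphism ζ}

/-- Quasi-state rigidity. -/
def IsQuasiStateRigid : Prop :=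
  continuousQuasimorphismQuasiStates 𝔤 = continuousAdInvariantQuasiStates 𝔤

end Rigidity

section Heisenberg

attribute [local instance] LieRing.ofAssociativeRing

/-- The three-dimensional Heisenberg algebra: the strictly upper triangular real
`3 × 3` matrices with the commutator bracket. -/
def heisenbergAlgebra : LieSubalgebra ℝ (Matrix (Fin 3) (Fin 3) ℝ) where
  carrier := {A | ∀ i j : Fin 3, j ≤ i → A i j = 0}
  zero_mem' := by
    intro i j _
    rfl
  add_mem' := by
    intro A B hA hB i j hij
    simp [hA i j hij, hB i j hij]
  smul_mem' := by
    intro c A hA i j hij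
    simp [hA i j hij]
  lie_mem' := by
    intro A B hA hB i j hij
    have key : ∀ C D : Matrix (Fin 3) (Fin 3) ℝ, (∀ i j : Fin 3, j ≤ i → C i j = 0) →
        (∀ i j : Fin 3, j ≤ i → D i j = 0) → (C * D) i j = 0 := by
      intro C D hC hD
      rw [Matrix.mul_apply]
      refine Finset.sum_eq_zero fun k _ => ?_
      rcases le_total k i with h | h
      · rw [hC i k h, zero_mul]
      · rw [hD k j (hij.trans h), mul_zero]
    rw [Ring.lie_def, Matrix.sub_apply, key A B hA hB, key B A hB hA, sub_zero]

end Heisenberg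

end

/-! One inclusion holds for every Lie algebra. A homogeneous quasimorphism is invariant under
conjugation, and `exp (e^{ad X} Y) = g exp(Y) g⁻¹` with `g = exp X`, so its directional derivative
is Ad-invariant (`quasimorphismQuasiStates_subset`). The Lie-theoretic input is `Ad (exp X) = e^{ad
X}`, obtained from a second-order computation in the chart at the unit.

For the Heisenberg algebra the other inclusion fails. Commuting elements have proportional images in
the quotient `ℝ²` by the centre, so every continuous function on `ℝ²` that is homogeneous under all
real scalars pulls back to an Ad-invariant quasi-state, additive or not. The
Baker-Campbell-Hausdorff formula forces a quasi-state that comes from a quasimorphism and vanishes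
on the centre to be additive (`map_add_of_quasimorphism`).

For the remaining algebras there are two main cases. If some nonzero linear form kills all brackets,
then `𝔤` is `ℝ T` acting on an abelian ideal (`exists_abelian_of_not_perfect`). A nilpotent block of
`ad T` would give the Heisenberg algebra; without one, invariance and continuity make every
quasi-state a character (`exists_character_of_adInvariant`), which integrates to a homomorphism on a
semidirect product. If `𝔤` is perfect and nonabelian, it is `𝔰𝔲(2)` or `𝔰𝔩(2, ℝ)`
(`IsPerfectLie.exists_basis`). On `𝔰𝔲(2)` rotations by `π` force the quasi-state to vanish. On
`𝔰𝔩(2, ℝ)` it is determined by its value on a generator of rotations, and the homogenized angle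
coordinate on the universal cover of `SU(1, 1)` is a quasimorphism that is nonzero there. -/

open Filter Topology

noncomputable section

set_option linter.unusedSectionVars false

/-! ### Second-order calculus of local multiplications, and linear differential equations. -/

section Calculus

variable {E : Type*} [NormedAddCommGroup E] [NormedSpace ℝ E]

lemma fderiv_apply_mk_right {F : Type*} [NormedAddCommGroup F] [NormedSpace ℝ F]
    {m : E × E → F} {x a : E} (h : DifferentiableAt ℝ m (x, a)) (Y : E) :
    fderiv ℝ (fun y => m (x, y)) a Y = fderiv ℝ m (x, a) (0, Y) := by
  have h1 : HasFDerivAt (fun y : E => (x, y)) (ContinuousLinearMap.inr ℝ E E) a :=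
    hasFDerivAt_prodMk_right x a
  have := HasFDerivAt.comp a (f := fun y : E => (x, y)) h.hasFDerivAt h1
  rw [show (fun y => m (x, y)) = m ∘ (fun y : E => (x, y)) from rfl, this.fderiv]
  simp

/-- If `m` is a local multiplication with left unit `a` and `c` the corresponding conjugation, the
derivative at the unit of the adjoint action is the antisymmetrised second derivative of `m`. -/
lemma hasFDerivAt_conj_of_mul {m c : E × E → E} {a : E}
    (hm : ContDiffAt ℝ 2 m (a, a)) (hc : ContDiffAt ℝ 2 c (a, a))
    (hunit : ∀ᶠ x in 𝓝 a, m (a, x) = x) (hunit' : ∀ᶠ x in 𝓝 a, m (x, a) = x)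
    (hca : ∀ᶠ x in 𝓝 a, c (x, a) = a)
    (hmc : ∀ᶠ p in 𝓝 (a, a), m (c p, p.1) = m p) (X Y : E) :
    DifferentiableAt ℝ (fun x => fderiv ℝ (fun y => c (x, y)) a Y) a ∧
    fderiv ℝ (fun x => fderiv ℝ (fun y => c (x, y)) a Y) a X =
      fderiv ℝ (fun x => fderiv ℝ (fun y => m (x, y)) a Y) a X -
      fderiv ℝ (fun x => fderiv ℝ (fun y => m (x, y)) a X) a Y := by
  have hcd : ∀ᶠ p in 𝓝 (a, a), DifferentiableAt ℝ c p :=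
    ((hc.of_le (m := 1) (by norm_num)).eventually (by simp)).mono
      fun p hp => hp.differentiableAt (by simp)
  have hmd : ∀ᶠ p in 𝓝 (a, a), DifferentiableAt ℝ m p :=
    ((hm.of_le (m := 1) (by norm_num)).eventually (by simp)).mono
      fun p hp => hp.differentiableAt (by simp)
  have hl : Tendsto (fun x : E => (x, a)) (𝓝 a) (𝓝 (a, a)) :=
    (Continuous.prodMk_left a).tendsto a
  have hr : Tendsto (fun x : E => (a, x)) (𝓝 a) (𝓝 (a, a)) :=
    (Continuous.prodMk_right a).tendsto a
  have hM : DifferentiableAt ℝ (fderiv ℝ m) (a, a) :=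
    (hm.fderiv_right (m := 1) (by norm_num)).differentiableAt (by simp)
  have hC : DifferentiableAt ℝ (fderiv ℝ c) (a, a) :=
    (hc.fderiv_right (m := 1) (by norm_num)).differentiableAt (by simp)
  have hsymm := (hm.isSymmSndFDerivAt (by simp))
  -- rewrite the partial derivatives
  have el : ∀ Y, (fun x => fderiv ℝ (fun y => m (x, y)) a Y) =ᶠ[𝓝 a]
      fun x => fderiv ℝ m (x, a) (0, Y) := fun Y =>
    (hl.eventually hmd).mono fun x hx => fderiv_apply_mk_right hx Y
  have elc : (fun x => fderiv ℝ (fun y => c (x, y)) a Y) =ᶠ[𝓝 a]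
      fun x => fderiv ℝ c (x, a) (0, Y) :=
    (hl.eventually hcd).mono fun x hx => fderiv_apply_mk_right hx Y
  have hinl : HasFDerivAt (fun x : E => (x, a)) (ContinuousLinearMap.inl ℝ E E) a :=
    hasFDerivAt_prodMk_left a a
  have hinr : HasFDerivAt (fun x : E => (a, x)) (ContinuousLinearMap.inr ℝ E E) a :=
    hasFDerivAt_prodMk_right a a
  have dl : ∀ v : E × E, HasFDerivAt (fun x => fderiv ℝ m (x, a) v)
      (((fderiv ℝ (fderiv ℝ m) (a, a)).comp (ContinuousLinearMap.inl ℝ E E)).flip v) a := by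
    intro v
    exact (HasFDerivAt.comp a (f := fun x : E => (x, a)) hM.hasFDerivAt hinl).clm_apply
      (hasFDerivAt_const v a) |>.congr_fderiv (by ext; simp)
  have dlc : HasFDerivAt (fun x => fderiv ℝ c (x, a) (0, Y))
      (((fderiv ℝ (fderiv ℝ c) (a, a)).comp (ContinuousLinearMap.inl ℝ E E)).flip (0, Y)) a :=
    (HasFDerivAt.comp a (f := fun x : E => (x, a)) hC.hasFDerivAt hinl).clm_apply
      (hasFDerivAt_const (0, Y) a) |>.congr_fderiv (by ext; simp)
  have dA : DifferentiableAt ℝ (fun x => fderiv ℝ (fun y => c (x, y)) a Y) a :=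
    (elc.differentiableAt_iff).2 dlc.differentiableAt
  refine ⟨dA, ?_⟩
  -- differentiate `m (c (x, y), x) = m (x, y)` in `y`
  have key : (fun x => fderiv ℝ m (a, x) (fderiv ℝ (fun y => c (x, y)) a Y, 0)) =ᶠ[𝓝 a]
      fun x => fderiv ℝ m (x, a) (0, Y) := by
    have hmc' := hl.eventually hmc.eventually_nhds
    filter_upwards [hmc', hca, hl.eventually hcd, hl.eventually hmd, hr.eventually hmd]
      with x h1 h2 h3 h4 h5
    rw [← fderiv_apply_mk_right h4]
    have hx : Tendsto (fun y : E => (x, y)) (𝓝 a) (𝓝 (x, a)) :=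
      (Continuous.prodMk_right x).tendsto a
    have e1 : (fun y => m (x, y)) =ᶠ[𝓝 a] fun y => m (c (x, y), x) :=
      (hx.eventually h1).mono fun y hy => hy.symm
    rw [e1.fderiv_eq]
    have hcy : HasFDerivAt (fun y => c (x, y)) (fderiv ℝ (fun y => c (x, y)) a) a :=
      DifferentiableAt.hasFDerivAt
        (DifferentiableAt.comp a (f := fun y : E => (x, y)) h3 (hasFDerivAt_prodMk_right x a).differentiableAt)
    have h5' : HasFDerivAt m (fderiv ℝ m (a, x)) (c (x, a), x) := by
      rw [h2]; exact h5.hasFDerivAt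
    have := HasFDerivAt.comp a (f := fun y => (c (x, y), x)) h5' (hcy.prodMk (hasFDerivAt_const x a))
    rw [show (fun y => m (c (x, y), x)) = m ∘ (fun y => (c (x, y), x)) from rfl, this.fderiv]
    simp
  have hMr : HasFDerivAt (fun x => fderiv ℝ m (a, x))
      ((fderiv ℝ (fderiv ℝ m) (a, a)).comp (ContinuousLinearMap.inr ℝ E E)) a :=
    HasFDerivAt.comp a (f := fun x : E => (a, x)) hM.hasFDerivAt hinr
  -- Differentiating `key` at `a` in direction `X`, the product rule yields `D²m((0,X),(Y,0)) +
  -- A'(X)Y = D²m((X,0),(0,Y))`, where `A(x)` is the derivative of `c (x, ·)` at `a`.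
  have dkey := (hMr.clm_apply (dA.hasFDerivAt.prodMk (hasFDerivAt_const (0 : E) a)))
  have eq := (dkey.congr_of_eventuallyEq key.symm).unique (dl (0, Y))
  have eqX := congrArg (fun L : E →L[ℝ] E => L X) eq
  have hA1 : fderiv ℝ (fun y => c (a, y)) a Y = Y := by
    have : (fun y => c (a, y)) =ᶠ[𝓝 a] id := by
      have hcont : Tendsto (fun y => c (a, y)) (𝓝 a) (𝓝 a) := by
        have := (hc.continuousAt.tendsto.comp hr)
        rwa [hca.self_of_nhds] at this
      filter_upwards [hr.eventually hmc, hcont.eventually hunit', hunit] with y h1 h2 h3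
      simpa [h2, h3] using h1
    rw [this.fderiv_eq, fderiv_id]; rfl
  have hm1 : ∀ Z : E, fderiv ℝ m (a, a) (Z, 0) = Z := by
    intro Z
    have h1 := HasFDerivAt.comp a (f := fun x : E => (x, a)) hmd.self_of_nhds.hasFDerivAt hinl
    have h2 : HasFDerivAt (fun x => m (x, a)) (ContinuousLinearMap.id ℝ E) a :=
      (hasFDerivAt_id a).congr_of_eventuallyEq hunit'
    have := congrArg (fun L : E →L[ℝ] E => L Z) (h1.unique h2)
    simpa using this
  simp only [add_apply, ContinuousLinearMap.comp_apply,
    ContinuousLinearMap.flip_apply, ContinuousLinearMap.inl_apply, ContinuousLinearMap.inr_apply,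
    ContinuousLinearMap.prod_apply, zero_apply, hA1, hm1] at eqX
  rw [(el Y).fderiv_eq, (el X).fderiv_eq, (dl _).fderiv, (dl _).fderiv]
  simp only [ContinuousLinearMap.comp_apply, ContinuousLinearMap.flip_apply,
    ContinuousLinearMap.inl_apply]
  -- Symmetry of the second derivative turns `D²m((0,X),(Y,0))` into the second term of the
  -- commutator.
  rw [← eqX, hsymm (0, X) (Y, 0)]
  abel

/-- The curve `s ↦ exp ((t - s) A) (u s)` has zero derivative; compare its values at `s = t` and `s
= 0`. -/
lemma eq_exp_smul_of_hasDerivAt [CompleteSpace E] {A : E →L[ℝ] E} {u : ℝ → E}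
    (hu : ∀ s, HasDerivAt u (A (u s)) s) (t : ℝ) : u t = NormedSpace.exp (t • A) (u 0) := by
  have hv : ∀ s, HasDerivAt (fun s : ℝ => NormedSpace.exp ((t - s) • A) (u s)) 0 s := by
    intro s
    have h1 : HasDerivAt (fun s : ℝ => NormedSpace.exp ((t - s) • A))
        ((-1 : ℝ) • (NormedSpace.exp ((t - s) • A) * A)) s :=
      (hasDerivAt_exp_smul_const (𝕂 := ℝ) A (t - s)).scomp s ((hasDerivAt_id s).const_sub t)
    have h2 := h1.clm_apply (hu s)
    simpa using h2
  have hc := is_const_of_deriv_eq_zero (fun s => (hv s).differentiableAt)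
    (fun s => (hv s).deriv) t 0
  simpa [NormedSpace.exp_zero] using hc

lemma hasSum_exp_apply [CompleteSpace E] (A : E →L[ℝ] E) (y : E) :
    HasSum (fun k : ℕ => ((k ! : ℝ)⁻¹) • (A ^ k) y) (NormedSpace.exp A y) := by
  have h1 := NormedSpace.exp_series_hasSum_exp' (𝕂 := ℝ) A
  simpa using h1.mapL (ContinuousLinearMap.apply ℝ E y)

end Calculus

/-! ### The chain rule along curves. -/

section CurveDerivative

variable {E : Type*} [NormedAddCommGroup E] [NormedSpace ℝ E] {H : Type*} [TopologicalSpace H]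
  {I : ModelWithCorners ℝ E H} {M : Type*} [TopologicalSpace M] [ChartedSpace H M]
  {E' : Type*} [NormedAddCommGroup E'] [NormedSpace ℝ E'] {H' : Type*} [TopologicalSpace H']
  {I' : ModelWithCorners ℝ E' H'} {M' : Type*} [TopologicalSpace M'] [ChartedSpace H' M']

/-- Keeps the derivative of a curve in the `smulRight` form in which integral curves are defined. -/
lemma HasMFDerivAt.comp_curve {f : M → M'} {γ : ℝ → M} {t : ℝ} {s : Set ℝ}
    {L : TangentSpace I (γ t) →L[ℝ] TangentSpace I' (f (γ t))} {v : TangentSpace I (γ t)}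
    (hf : HasMFDerivAt I I' f (γ t) L)
    (hγ : HasMFDerivWithinAt 𝓘(ℝ, ℝ) I γ s t ((1 : ℝ →L[ℝ] ℝ).smulRight v)) :
    HasMFDerivWithinAt 𝓘(ℝ, ℝ) I' (fun s => f (γ s)) s t ((1 : ℝ →L[ℝ] ℝ).smulRight (L v)) := by
  have e : L.comp ((1 : ℝ →L[ℝ] ℝ).smulRight v) = (1 : ℝ →L[ℝ] ℝ).smulRight (L v) := by
    ext; simp
  rw [← e]
  exact HasMFDerivAt.comp_hasMFDerivWithinAt t hf hγ

end CurveDerivative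

/-! ### The Lie bracket and the adjoint action in the chart at the unit. -/

section LieGroupBasics

variable {n : ℕ} {G : Type*} [TopologicalSpace G]
  [ChartedSpace (EuclideanSpace ℝ (Fin n)) G] [Group G]

/-- The extended chart at the identity. -/
abbrev unitChart (n : ℕ) (G : Type*) [TopologicalSpace G]
    [ChartedSpace (EuclideanSpace ℝ (Fin n)) G] [Group G] :
    PartialEquiv G (EuclideanSpace ℝ (Fin n)) :=
  extChartAt (𝓡 n) (1 : G)

/-- The multiplication in the chart at the identity. -/
def chartMul (n : ℕ) (G : Type*) [TopologicalSpace G]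
    [ChartedSpace (EuclideanSpace ℝ (Fin n)) G] [Group G]
    (p : EuclideanSpace ℝ (Fin n) × EuclideanSpace ℝ (Fin n)) : EuclideanSpace ℝ (Fin n) :=
  unitChart n G ((unitChart n G).symm p.1 * (unitChart n G).symm p.2)

/-- The conjugation in the chart at the identity. -/
def chartConj (n : ℕ) (G : Type*) [TopologicalSpace G]
    [ChartedSpace (EuclideanSpace ℝ (Fin n)) G] [Group G]
    (p : EuclideanSpace ℝ (Fin n) × EuclideanSpace ℝ (Fin n)) : EuclideanSpace ℝ (Fin n) :=
  unitChart n G ((unitChart n G).symm p.1 * (unitChart n G).symm p.2 * ((unitChart n G).symm p.1)⁻¹)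

/-- The adjoint action of a Lie group on its Lie algebra. -/
def adjointAction (g : G) : GroupLieAlgebra (𝓡 n) G →L[ℝ] GroupLieAlgebra (𝓡 n) G :=
  fderiv ℝ (fun y => unitChart n G (g * (unitChart n G).symm y * g⁻¹)) (unitChart n G 1)

variable [LieGroup (𝓡 n) ∞ G]

lemma contMDiffAt_unitChart_symm {y : EuclideanSpace ℝ (Fin n)} (hy : y ∈ (unitChart n G).target) :
    ContMDiffAt 𝓘(ℝ, EuclideanSpace ℝ (Fin n)) (𝓡 n) ∞ (unitChart n G).symm y := by
  have := contMDiffWithinAt_extChartAt_symm_range (I := 𝓡 n) (n := ∞) (1 : G) hy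
  simpa [contMDiffWithinAt_univ] using this

lemma unitChart_target_mem : (unitChart n G).target ∈ 𝓝 (unitChart n G 1) :=
  extChartAt_target_mem_nhds (I := 𝓡 n) (1 : G)

lemma unitChart_symm_tendsto :
    Tendsto (unitChart n G).symm (𝓝 (unitChart n G 1)) (𝓝 1) := by
  have := continuousAt_extChartAt_symm (I := 𝓡 n) (1 : G)
  simpa [ContinuousAt] using this

lemma contMDiff_conj (g : G) : ContMDiff (𝓡 n) (𝓡 n) ∞ (fun h : G => g * h * g⁻¹) :=
  (contMDiff_const.mul contMDiff_id).mul contMDiff_const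

lemma contDiffAt_chartMul :
    ContDiffAt ℝ ∞ (chartMul n G) (unitChart n G 1, unitChart n G 1) := by
  rw [← contMDiffAt_iff_contDiffAt]
  have h1 : ContMDiffAt 𝓘(ℝ, EuclideanSpace ℝ (Fin n) × EuclideanSpace ℝ (Fin n)) (𝓡 n) ∞
      (fun p : EuclideanSpace ℝ (Fin n) × EuclideanSpace ℝ (Fin n) =>
        (unitChart n G).symm p.1 * (unitChart n G).symm p.2) (unitChart n G 1, unitChart n G 1) :=
    ((contMDiffAt_unitChart_symm (mem_extChartAt_target 1)).comp
      (unitChart n G 1, unitChart n G 1) contDiff_fst.contMDiff.contMDiffAt).mul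
    ((contMDiffAt_unitChart_symm (mem_extChartAt_target 1)).comp
      (unitChart n G 1, unitChart n G 1) contDiff_snd.contMDiff.contMDiffAt)
  have h2 : ContMDiffAt (𝓡 n) 𝓘(ℝ, EuclideanSpace ℝ (Fin n)) ∞ (unitChart n G)
      ((unitChart n G).symm (unitChart n G 1) * (unitChart n G).symm (unitChart n G 1)) := by
    simpa using contMDiffAt_extChartAt (I := 𝓡 n) (x := (1 : G)) (n := ∞)
  exact h2.comp (unitChart n G 1, unitChart n G 1) h1

lemma contDiffAt_chartConj :
    ContDiffAt ℝ ∞ (chartConj n G) (unitChart n G 1, unitChart n G 1) := by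
  rw [← contMDiffAt_iff_contDiffAt]
  have hf : ContMDiffAt 𝓘(ℝ, EuclideanSpace ℝ (Fin n) × EuclideanSpace ℝ (Fin n)) (𝓡 n) ∞
      (fun p : EuclideanSpace ℝ (Fin n) × EuclideanSpace ℝ (Fin n) =>
        (unitChart n G).symm p.1) (unitChart n G 1, unitChart n G 1) :=
    ((contMDiffAt_unitChart_symm (mem_extChartAt_target 1)).comp
      (unitChart n G 1, unitChart n G 1) contDiff_fst.contMDiff.contMDiffAt)
  have h1 : ContMDiffAt 𝓘(ℝ, EuclideanSpace ℝ (Fin n) × EuclideanSpace ℝ (Fin n)) (𝓡 n) ∞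
      (fun p : EuclideanSpace ℝ (Fin n) × EuclideanSpace ℝ (Fin n) =>
        (unitChart n G).symm p.1 * (unitChart n G).symm p.2 * ((unitChart n G).symm p.1)⁻¹)
        (unitChart n G 1, unitChart n G 1) :=
    (hf.mul ((contMDiffAt_unitChart_symm (mem_extChartAt_target 1)).comp
      (unitChart n G 1, unitChart n G 1) contDiff_snd.contMDiff.contMDiffAt)).mul hf.inv
  have h2 : ContMDiffAt (𝓡 n) 𝓘(ℝ, EuclideanSpace ℝ (Fin n)) ∞ (unitChart n G)
      ((unitChart n G).symm (unitChart n G 1) * (unitChart n G).symm (unitChart n G 1) *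
        ((unitChart n G).symm (unitChart n G 1))⁻¹) := by
    simpa using contMDiffAt_extChartAt (I := 𝓡 n) (x := (1 : G)) (n := ∞)
  exact h2.comp (unitChart n G 1, unitChart n G 1) h1

lemma hasMFDerivAt_conj (g : G) :
    HasMFDerivAt (𝓡 n) (𝓡 n) (fun h : G => g * h * g⁻¹) 1 (adjointAction g) := by
  have hd : MDifferentiableAt (𝓡 n) (𝓡 n) (fun h : G => g * h * g⁻¹) 1 :=
    (contMDiff_conj (n := n) g).mdifferentiableAt (by simp)
  refine ⟨hd.continuousAt, ?_⟩
  have h3 : DifferentiableAt ℝ (fun y => unitChart n G (g * (unitChart n G).symm y * g⁻¹))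
      (unitChart n G 1) := by
    have h1 : ContMDiffAt (𝓡 n) 𝓘(ℝ, EuclideanSpace ℝ (Fin n)) ∞ (unitChart n G)
        (g * (unitChart n G).symm (unitChart n G 1) * g⁻¹) := by
      simpa using contMDiffAt_extChartAt (I := 𝓡 n) (x := (1 : G)) (n := ∞)
    have h4 := h1.comp (unitChart n G 1) ((contMDiff_conj (n := n) g).contMDiffAt.comp
      (unitChart n G 1) (contMDiffAt_unitChart_symm (mem_extChartAt_target 1)))
    exact (contMDiffAt_iff_contDiffAt.1 h4).differentiableAt (by simp)
  have h5 := h3.hasFDerivAt.hasFDerivWithinAt (s := Set.range (𝓡 n))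
  have e : writtenInExtChartAt (𝓡 n) (𝓡 n) 1 (fun h : G => g * h * g⁻¹) =
      fun y => unitChart n G (g * (unitChart n G).symm y * g⁻¹) := by
    simp [writtenInExtChartAt, Function.comp_def]
  rw [e]
  exact h5

/-- The invariant vector field in the chart at the identity. -/
lemma mpullbackWithin_mulInvariantVectorField (X : GroupLieAlgebra (𝓡 n) G) :
    ∀ᶠ x in 𝓝 (unitChart n G 1),
      VectorField.mpullbackWithin 𝓘(ℝ, EuclideanSpace ℝ (Fin n)) (𝓡 n) (unitChart n G).symm
        (mulInvariantVectorField X) (Set.range (𝓡 n)) x =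
      fderiv ℝ (fun y => chartMul n G (x, y)) (unitChart n G 1) X := by
  filter_upwards [unitChart_target_mem (n := n) (G := G)] with x hx
  have hinv : (mfderivWithin 𝓘(ℝ, EuclideanSpace ℝ (Fin n)) (𝓡 n) (unitChart n G).symm (Set.range (𝓡 n)) x).inverse =
      mfderiv (𝓡 n) 𝓘(ℝ, EuclideanSpace ℝ (Fin n)) (unitChart n G) ((unitChart n G).symm x) :=
    ContinuousLinearMap.inverse_eq
      (mfderivWithin_extChartAt_symm_comp_mfderiv_extChartAt hx)
      (mfderiv_extChartAt_comp_mfderivWithin_extChartAt_symm hx)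
  rw [VectorField.mpullbackWithin_apply, hinv]
  have hs : (unitChart n G).symm x ∈ (chartAt (EuclideanSpace ℝ (Fin n)) (1 : G)).source := by
    rw [← extChartAt_source (𝓡 n)]; exact (unitChart n G).map_target hx
  have h1 : HasMFDerivAt 𝓘(ℝ, EuclideanSpace ℝ (Fin n)) (𝓡 n) (unitChart n G).symm
      (unitChart n G 1) (ContinuousLinearMap.id ℝ (EuclideanSpace ℝ (Fin n))) := by
    have hd : MDifferentiableAt 𝓘(ℝ, EuclideanSpace ℝ (Fin n)) (𝓡 n) (unitChart n G).symm
        (unitChart n G 1) :=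
      (contMDiffAt_unitChart_symm (mem_extChartAt_target 1)).mdifferentiableAt (by simp)
    have e := mfderivWithin_range_extChartAt_symm (I := 𝓡 n) (x := (1 : G))
    have h := hd.hasMFDerivAt
    simp only [modelWithCornersSelf_coe, Set.range_id, mfderivWithin_univ] at e
    rw [e] at h
    exact h
  have h2 : HasMFDerivAt (𝓡 n) (𝓡 n) (fun y : G => (unitChart n G).symm x * y)
      ((unitChart n G).symm (unitChart n G 1))
      (mfderiv (𝓡 n) (𝓡 n) (fun y : G => (unitChart n G).symm x * y) 1) := by
    rw [show (unitChart n G).symm (unitChart n G 1) = 1 by simp]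
    exact ((contMDiff_mul_left (I := 𝓡 n) (n := ∞)).mdifferentiableAt (by simp)).hasMFDerivAt
  have h3 : HasMFDerivAt (𝓡 n) 𝓘(ℝ, EuclideanSpace ℝ (Fin n)) (unitChart n G)
      ((unitChart n G).symm x * (unitChart n G).symm (unitChart n G 1))
      (mfderiv (𝓡 n) 𝓘(ℝ, EuclideanSpace ℝ (Fin n)) (unitChart n G) ((unitChart n G).symm x)) := by
    rw [show (unitChart n G).symm (unitChart n G 1) = 1 by simp, mul_one]
    exact (mdifferentiableAt_extChartAt hs).hasMFDerivAt
  have h4 := (HasMFDerivAt.comp (unitChart n G 1) h3 (HasMFDerivAt.comp (unitChart n G 1) h2 h1)).hasFDerivAt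
  let L : EuclideanSpace ℝ (Fin n) →L[ℝ] EuclideanSpace ℝ (Fin n) :=
    (mfderiv (𝓡 n) 𝓘(ℝ, EuclideanSpace ℝ (Fin n)) (unitChart n G) ((unitChart n G).symm x)).comp
      (mfderiv (𝓡 n) (𝓡 n) (fun y : G => (unitChart n G).symm x * y) 1)
  have h5 : HasFDerivAt (fun y => chartMul n G (x, y)) L (unitChart n G 1) := h4
  rw [h5.fderiv]
  rfl

/-- In the chart, the left-invariant field of `X` is `x ↦ ∂_y m(x, y) X` at the unit, with value `X`
at the unit. The vector field bracket `DV_Y(V_X) - DV_X(V_Y)` is then the antisymmetrised mixed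
derivative. -/
lemma bracket_eq_chartMul (X Y : GroupLieAlgebra (𝓡 n) G) :
    (⁅X, Y⁆ : GroupLieAlgebra (𝓡 n) G) =
      (fderiv ℝ (fun x => fderiv ℝ (fun y => chartMul n G (x, y)) (unitChart n G 1) Y)
        (unitChart n G 1) X -
      fderiv ℝ (fun x => fderiv ℝ (fun y => chartMul n G (x, y)) (unitChart n G 1) X)
        (unitChart n G 1) Y : EuclideanSpace ℝ (Fin n)) := by
  have hX := mpullbackWithin_mulInvariantVectorField (n := n) (G := G) X
  have hY := mpullbackWithin_mulInvariantVectorField (n := n) (G := G) Y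
  have := Filter.EventuallyEq.lieBracket_vectorField_eq (𝕜 := ℝ) hX hY
  have h0 : (⁅X, Y⁆ : GroupLieAlgebra (𝓡 n) G) = VectorField.lieBracketWithin ℝ
      (VectorField.mpullbackWithin 𝓘(ℝ, EuclideanSpace ℝ (Fin n)) (𝓡 n) (unitChart n G).symm
        (mulInvariantVectorField X) (Set.range (𝓡 n)))
      (VectorField.mpullbackWithin 𝓘(ℝ, EuclideanSpace ℝ (Fin n)) (𝓡 n) (unitChart n G).symm
        (mulInvariantVectorField Y) (Set.range (𝓡 n))) ((unitChart n G).symm ⁻¹' Set.univ ∩ Set.range (𝓡 n)) (unitChart n G 1) := by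
    rw [GroupLieAlgebra.bracket_def, ← VectorField.mlieBracketWithin_univ,
      VectorField.mlieBracketWithin_apply, mfderiv_extChartAt_self]
    erw [ContinuousLinearMap.inverse_id]
    rfl
  rw [h0]
  rw [show (unitChart n G).symm ⁻¹' Set.univ ∩ Set.range (𝓡 n) = Set.univ by simp]
  refine (congrFun (VectorField.lieBracketWithin_univ (𝕜 := ℝ)
    (E := EuclideanSpace ℝ (Fin n))) _).trans (this.trans ?_)
  rw [VectorField.lieBracket]
  have hunit : ∀ Z : GroupLieAlgebra (𝓡 n) G,
      fderiv ℝ (fun y => chartMul n G (unitChart n G 1, y)) (unitChart n G 1) Z = Z := by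
    intro Z
    have h2 : HasFDerivAt (fun x => chartMul n G (unitChart n G 1, x))
      (ContinuousLinearMap.id ℝ (EuclideanSpace ℝ (Fin n))) (unitChart n G 1) := by
      refine (hasFDerivAt_id _).congr_of_eventuallyEq ?_
      filter_upwards [unitChart_target_mem (n := n) (G := G)] with x hx
      simpa [chartMul] using (unitChart n G).right_inv hx
    rw [h2.fderiv]; rfl
  rw [hunit, hunit]

/-- The derivative at the identity of the adjoint action is the Lie bracket. -/
lemma hasDerivAt_adjointAction {γ : ℝ → G} {X : GroupLieAlgebra (𝓡 n) G} (h0 : γ 0 = 1)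
    (hγ : HasMFDerivAt 𝓘(ℝ, ℝ) (𝓡 n) γ 0 ((1 : ℝ →L[ℝ] ℝ).smulRight X))
    (Y : GroupLieAlgebra (𝓡 n) G) :
    HasDerivAt (F := EuclideanSpace ℝ (Fin n)) (fun t => adjointAction (γ t) Y)
      (⁅X, Y⁆ : GroupLieAlgebra (𝓡 n) G) 0 := by
  have ht := unitChart_target_mem (n := n) (G := G)
  have hs := unitChart_symm_tendsto (n := n) (G := G)
  have hsrc : ∀ᶠ g in 𝓝 (1 : G), g ∈ (unitChart n G).source := extChartAt_source_mem_nhds _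
  have htt : Tendsto (fun p : EuclideanSpace ℝ (Fin n) × EuclideanSpace ℝ (Fin n) =>
      (unitChart n G).symm p.1 * (unitChart n G).symm p.2 * ((unitChart n G).symm p.1)⁻¹)
      (𝓝 (unitChart n G 1, unitChart n G 1)) (𝓝 1) := by
    have : IsTopologicalGroup G := topologicalGroup_of_lieGroup (𝓡 n) ∞
    have h1 := hs.comp (continuous_fst.tendsto (unitChart n G 1, unitChart n G 1))
    have h2 := hs.comp (continuous_snd.tendsto (unitChart n G 1, unitChart n G 1))
    simpa using (h1.mul h2).mul h1.inv
  have main := hasFDerivAt_conj_of_mul (m := chartMul n G) (c := chartConj n G)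
    (a := unitChart n G 1) (contDiffAt_chartMul.of_le (WithTop.coe_le_coe.2 le_top))
    (contDiffAt_chartConj.of_le (WithTop.coe_le_coe.2 le_top))
    (by filter_upwards [ht] with x hx; simpa [chartMul] using (unitChart n G).right_inv hx)
    (by filter_upwards [ht] with x hx; simpa [chartMul] using (unitChart n G).right_inv hx)
    (by filter_upwards with x; simp [chartConj])
    -- This is `(g h g⁻¹) g = g h`; in coordinates it holds only where `g h g⁻¹` stays in the chart
    -- domain.
    (by
      filter_upwards [htt.eventually hsrc] with p hp
      simp only [chartMul, chartConj]
      rw [(unitChart n G).left_inv hp, inv_mul_cancel_right]) X Y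
  obtain ⟨hd, he⟩ := main
  rw [bracket_eq_chartMul, ← he]
  have hγ' : HasMFDerivAt 𝓘(ℝ, ℝ) 𝓘(ℝ, EuclideanSpace ℝ (Fin n)) (fun t => unitChart n G (γ t)) 0
      ((1 : ℝ →L[ℝ] ℝ).smulRight X) := by
    have h1 : HasMFDerivAt (𝓡 n) 𝓘(ℝ, EuclideanSpace ℝ (Fin n)) (unitChart n G) (γ 0)
        (ContinuousLinearMap.id ℝ (EuclideanSpace ℝ (Fin n))) := by
      rw [h0]
      have := (mdifferentiableAt_extChartAt (I := 𝓡 n) (mem_chart_source (EuclideanSpace ℝ (Fin n)) (1 : G))).hasMFDerivAt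
      rw [mfderiv_extChartAt_self] at this
      exact this
    have := h1.comp 0 hγ
    exact this
  have hγd : HasDerivAt (fun t => unitChart n G (γ t)) X 0 := by
    let X' : EuclideanSpace ℝ (Fin n) := X
    have h : HasFDerivAt (fun t => unitChart n G (γ t)) ((1 : ℝ →L[ℝ] ℝ).smulRight X') 0 :=
      hγ'.hasFDerivAt
    have := h.hasDerivAt
    rwa [ContinuousLinearMap.smulRight_apply, one_apply_eq_self, one_smul] at this
  have hd' : HasFDerivAt (fun x => fderiv ℝ (fun y => chartConj n G (x, y)) (unitChart n G 1) Y)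
      (fderiv ℝ (fun x => fderiv ℝ (fun y => chartConj n G (x, y)) (unitChart n G 1) Y)
        (unitChart n G 1)) (unitChart n G (γ 0)) := by rw [h0]; exact hd.hasFDerivAt
  have h3 := hd'.comp_hasDerivAt 0 hγd
  refine h3.congr_of_eventuallyEq ?_
  have hc : Tendsto γ (𝓝 0) (𝓝 1) := by have := hγ.1.tendsto; rwa [h0] at this
  filter_upwards [hc.eventually hsrc] with t hts
  simp only [Function.comp_apply, adjointAction, chartConj]
  rw [(unitChart n G).left_inv hts]
  rfl

end LieGroupBasics

/-! ### One-parameter subgroups and `Ad (exp X) = e^{ad X}`. -/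

section OneParameter

variable {n : ℕ} {G : Type*} [TopologicalSpace G]
  [ChartedSpace (EuclideanSpace ℝ (Fin n)) G] [Group G] [LieGroup (𝓡 n) ∞ G]

lemma contMDiff_one_mulInvariantVectorField (X : GroupLieAlgebra (𝓡 n) G) :
    ContMDiff (𝓡 n) (𝓡 n).tangent 1
      (fun g : G => (⟨g, mulInvariantVectorField X g⟩ : TangentBundle (𝓡 n) G)) := by
  have := contMDiff_mulInvariantVectorField (I := 𝓡 n) X
  exact this.of_le (one_le_two.trans le_minSmoothness)

lemma hasMFDerivAt_mul_left (g : G) :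
    HasMFDerivAt (𝓡 n) (𝓡 n) (g * ·) 1 (mfderiv (𝓡 n) (𝓡 n) (g * ·) 1) :=
  ((contMDiff_mul_left (I := 𝓡 n) (n := ∞) (a := g)).mdifferentiableAt (by simp)).hasMFDerivAt

/-- Differentiate `F (g x) = F g * F x` at `x = 1`. -/
lemma mfderiv_hom_mulInvariantVectorField {m : ℕ} {H : Type*} [TopologicalSpace H]
    [ChartedSpace (EuclideanSpace ℝ (Fin m)) H] [Group H] [LieGroup (𝓡 m) ∞ H]
    {F : G → H} (hmul : ∀ g h, F (g * h) = F g * F h)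
    (hF : ContMDiff (𝓡 n) (𝓡 m) ∞ F) (hone : F 1 = 1)
    (L : GroupLieAlgebra (𝓡 n) G →L[ℝ] GroupLieAlgebra (𝓡 m) H)
    (hL : HasMFDerivAt (𝓡 n) (𝓡 m) F 1 L)
    (g : G) (X : GroupLieAlgebra (𝓡 n) G) :
    mfderiv (𝓡 n) (𝓡 m) F g (mulInvariantVectorField X g) = mulInvariantVectorField (L X) (F g) := by
  have h1 : HasMFDerivAt (𝓡 n) (𝓡 m) F (g * 1) (mfderiv (𝓡 n) (𝓡 m) F g) := by
    rw [mul_one]; exact (hF.mdifferentiableAt (by simp)).hasMFDerivAt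
  have h2 := HasMFDerivAt.comp (1 : G) h1 (hasMFDerivAt_mul_left g)
  have h3 : HasMFDerivAt (𝓡 m) (𝓡 m) (F g * ·) (F 1) (mfderiv (𝓡 m) (𝓡 m) (F g * ·) 1) := by
    rw [hone]; exact hasMFDerivAt_mul_left (F g)
  have h4 := HasMFDerivAt.comp (1 : G) h3 hL
  have h5 : F ∘ (g * ·) = (F g * ·) ∘ F := by
    ext x; exact hmul g x
  rw [h5] at h2
  exact congrArg (fun (T : EuclideanSpace ℝ (Fin n) →L[ℝ] EuclideanSpace ℝ (Fin m)) => T X)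
    (hasMFDerivAt_unique h2 h4)

lemma mfderiv_mul_left_mulInvariantVectorField (g h : G) (X : GroupLieAlgebra (𝓡 n) G) :
    mfderiv (𝓡 n) (𝓡 n) (g * ·) h (mulInvariantVectorField X h) =
      mulInvariantVectorField X (g * h) := by
  have h1 : HasMFDerivAt (𝓡 n) (𝓡 n) (g * ·) (h * 1) (mfderiv (𝓡 n) (𝓡 n) (g * ·) h) := by
    rw [mul_one]
    exact ((contMDiff_mul_left (I := 𝓡 n) (n := ∞) (a := g)).mdifferentiableAt (by simp)).hasMFDerivAt
  have h2 := HasMFDerivAt.comp (1 : G) h1 (hasMFDerivAt_mul_left h)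
  have h3 := hasMFDerivAt_mul_left (n := n) (g * h)
  have h5 : (g * ·) ∘ (h * ·) = (g * h * ·) := by
    ext x; exact (mul_assoc g h x).symm
  rw [h5] at h2
  exact congrArg (fun (T : EuclideanSpace ℝ (Fin n) →L[ℝ] EuclideanSpace ℝ (Fin n)) => T X)
    (hasMFDerivAt_unique h2 h3)

lemma mulInvariantVectorField_one (X : GroupLieAlgebra (𝓡 n) G) :
    mulInvariantVectorField X (1 : G) = X := by
  have h1 := hasMFDerivAt_mul_left (n := n) (1 : G)
  have h2 : HasMFDerivAt (𝓡 n) (𝓡 n) ((1 : G) * ·) 1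
      (ContinuousLinearMap.id ℝ (TangentSpace (𝓡 n) (1 : G))) := by
    rw [show ((1 : G) * ·) = id by ext; simp]
    exact hasMFDerivAt_id 1
  exact congrArg (fun (T : EuclideanSpace ℝ (Fin n) →L[ℝ] EuclideanSpace ℝ (Fin n)) => T X)
    (hasMFDerivAt_unique h1 h2)

lemma isMIntegralCurveOn_mul_left {γ : ℝ → G} {X : GroupLieAlgebra (𝓡 n) G} {s : Set ℝ}
    (hγ : IsMIntegralCurveOn (I := 𝓡 n) γ (mulInvariantVectorField X) s) (g : G) :
    IsMIntegralCurveOn (I := 𝓡 n) (fun t => g * γ t) (mulInvariantVectorField X) s := by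
  intro t ht
  have h1 : HasMFDerivAt (𝓡 n) (𝓡 n) (g * ·) (γ t) (mfderiv (𝓡 n) (𝓡 n) (g * ·) (γ t)) :=
    ((contMDiff_mul_left (I := 𝓡 n) (n := ∞) (a := g)).mdifferentiableAt (by simp)).hasMFDerivAt
  have h2 := h1.comp_curve (hγ t ht)
  rwa [mfderiv_mul_left_mulInvariantVectorField] at h2

variable [T2Space G]

/-- Left-invariant fields are complete: an integral curve through `1` of length `ε` translates to
every point with the same `ε`, and a uniform existence time gives global curves. -/
lemma exists_oneParameter (X : GroupLieAlgebra (𝓡 n) G) :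
    ∃ γ : ℝ → G, γ 0 = 1 ∧ IsMIntegralCurve (I := 𝓡 n) γ (mulInvariantVectorField X) := by
  have hv := contMDiff_one_mulInvariantVectorField X
  obtain ⟨γ, h0, hγ⟩ := exists_isMIntegralCurveAt_of_contMDiffAt_boundaryless (I := 𝓡 n)
    (t₀ := 0) (hv.contMDiffAt (x := (1 : G)))
  obtain ⟨ε, hε, hγε⟩ := isMIntegralCurveAt_iff'.1 hγ
  refine exists_isMIntegralCurve_of_isMIntegralCurveOn hv hε (fun x => ?_) 1
  refine ⟨fun t => x * γ t, by simp [h0], ?_⟩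
  have := isMIntegralCurveOn_mul_left hγε x
  rwa [Real.ball_eq_Ioo, zero_sub, zero_add] at this

/-- The one-parameter subgroup `t ↦ exp (t X)`. -/
def oneParameter (X : GroupLieAlgebra (𝓡 n) G) : ℝ → G := (exists_oneParameter X).choose

@[simp]
lemma oneParameter_zero (X : GroupLieAlgebra (𝓡 n) G) : oneParameter X 0 = 1 :=
  (exists_oneParameter X).choose_spec.1

lemma isMIntegralCurve_oneParameter (X : GroupLieAlgebra (𝓡 n) G) :
    IsMIntegralCurve (I := 𝓡 n) (oneParameter X) (mulInvariantVectorField X) :=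
  (exists_oneParameter X).choose_spec.2

lemma continuous_oneParameter (X : GroupLieAlgebra (𝓡 n) G) : Continuous (oneParameter X) :=
  (isMIntegralCurve_oneParameter X).continuous

/-- Uniqueness of integral curves: both sides start at `γ 0` and left translates of integral curves
are integral curves. -/
lemma eq_mul_oneParameter {γ : ℝ → G} {X : GroupLieAlgebra (𝓡 n) G}
    (hγ : IsMIntegralCurve (I := 𝓡 n) γ (mulInvariantVectorField X)) (t : ℝ) :
    γ t = γ 0 * oneParameter X t := by
  have h1 : IsMIntegralCurve (I := 𝓡 n) (fun t => γ 0 * oneParameter X t)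
      (mulInvariantVectorField X) := by
    rw [isMIntegralCurve_iff_isMIntegralCurveOn]
    exact isMIntegralCurveOn_mul_left ((isMIntegralCurve_oneParameter X).isMIntegralCurveOn _) _
  exact congrFun (isMIntegralCurve_Ioo_eq_of_contMDiff_boundaryless (I := 𝓡 n) (t₀ := 0)
    (contMDiff_one_mulInvariantVectorField X) hγ h1 (by simp)) t

lemma eq_oneParameter {γ : ℝ → G} {X : GroupLieAlgebra (𝓡 n) G} (h0 : γ 0 = 1)
    (hγ : IsMIntegralCurve (I := 𝓡 n) γ (mulInvariantVectorField X)) : γ = oneParameter X := by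
  ext t
  rw [eq_mul_oneParameter hγ, h0, one_mul]

/-- Shows that the exponential map in the definition of rigidity is unique. -/
lemma IsExponentialMap.eq_oneParameter {e : GroupLieAlgebra (𝓡 n) G → G}
    (he : IsExponentialMap e) (X : GroupLieAlgebra (𝓡 n) G) : e X = oneParameter X 1 := by
  obtain ⟨γ, h0, hγ, h1⟩ := he X
  rw [← h1, _root_.eq_oneParameter h0 hγ]

lemma isExponentialMap_oneParameter :
    IsExponentialMap (fun X : GroupLieAlgebra (𝓡 n) G => oneParameter X 1) :=
  fun X => ⟨oneParameter X, oneParameter_zero X, isMIntegralCurve_oneParameter X, rfl⟩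

lemma oneParameter_add (X : GroupLieAlgebra (𝓡 n) G) (s t : ℝ) :
    oneParameter X (s + t) = oneParameter X s * oneParameter X t := by
  have := eq_mul_oneParameter ((isMIntegralCurve_oneParameter X).comp_add s) t
  simpa [add_comm] using this

lemma oneParameter_neg (X : GroupLieAlgebra (𝓡 n) G) (t : ℝ) :
    oneParameter X (-t) = (oneParameter X t)⁻¹ := by
  rw [eq_inv_iff_mul_eq_one, ← oneParameter_add, neg_add_cancel, oneParameter_zero]

lemma oneParameter_smul (c : ℝ) (X : GroupLieAlgebra (𝓡 n) G) (t : ℝ) :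
    oneParameter (c • X) t = oneParameter X (t * c) := by
  have h := (isMIntegralCurve_oneParameter X).comp_mul c
  rw [← mulInvariantVectorField_smul] at h
  exact (congrFun (eq_oneParameter (by simp) h) t).symm

lemma map_oneParameter {m : ℕ} {H : Type*} [TopologicalSpace H]
    [ChartedSpace (EuclideanSpace ℝ (Fin m)) H] [Group H] [LieGroup (𝓡 m) ∞ H] [T2Space H]
    {F : G → H} (hmul : ∀ g h, F (g * h) = F g * F h)
    (hF : ContMDiff (𝓡 n) (𝓡 m) ∞ F) (hone : F 1 = 1)
    (L : GroupLieAlgebra (𝓡 n) G →L[ℝ] GroupLieAlgebra (𝓡 m) H)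
    (hL : HasMFDerivAt (𝓡 n) (𝓡 m) F 1 L)
    (X : GroupLieAlgebra (𝓡 n) G) (t : ℝ) :
    F (oneParameter X t) = oneParameter (L X) t := by
  refine congrFun (eq_oneParameter (γ := fun t => F (oneParameter X t)) (by simp [hone]) ?_) t
  intro s
  have h1 : HasMFDerivAt (𝓡 n) (𝓡 m) F (oneParameter X s) _ :=
    (hF.mdifferentiableAt (by simp)).hasMFDerivAt
  have h2 := h1.comp_curve (isMIntegralCurve_oneParameter X s).hasMFDerivWithinAt (s := Set.univ)
  rw [mfderiv_hom_mulInvariantVectorField hmul hF hone L hL] at h2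
  exact hasMFDerivWithinAt_univ.1 h2

lemma conj_oneParameter (g : G) (Y : GroupLieAlgebra (𝓡 n) G) (t : ℝ) :
    g * oneParameter Y t * g⁻¹ = oneParameter (adjointAction g Y) t :=
  map_oneParameter (F := fun h => g * h * g⁻¹) (by intro a b; group) (contMDiff_conj g) (by simp)
    (adjointAction g) (hasMFDerivAt_conj g) Y t

omit [T2Space G] in
lemma adjointAction_mul (g h : G) (Y : GroupLieAlgebra (𝓡 n) G) :
    adjointAction (g * h) Y = adjointAction g (adjointAction h Y) := by
  have h1 : HasMFDerivAt (𝓡 n) (𝓡 n) (fun x : G => g * x * g⁻¹) (h * 1 * h⁻¹) (adjointAction g) := by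
    have := hasMFDerivAt_conj (n := n) g
    rwa [show (1 : G) = h * 1 * h⁻¹ by simp] at this
  have h2 := HasMFDerivAt.comp (1 : G) h1 (hasMFDerivAt_conj h)
  have h3 := hasMFDerivAt_conj (n := n) (g * h)
  rw [show (fun x : G => g * x * g⁻¹) ∘ (fun x : G => h * x * h⁻¹) =
    fun x => g * h * x * (g * h)⁻¹ by ext x; simp [mul_assoc]] at h2
  exact congrArg (fun (T : EuclideanSpace ℝ (Fin n) →L[ℝ] EuclideanSpace ℝ (Fin n)) => T Y)
    (hasMFDerivAt_unique h3 h2)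

omit [T2Space G] in
lemma adjointAction_one (Y : GroupLieAlgebra (𝓡 n) G) : adjointAction (1 : G) Y = Y := by
  have h3 := hasMFDerivAt_conj (n := n) (1 : G)
  have h2 : HasMFDerivAt (𝓡 n) (𝓡 n) (fun x : G => 1 * x * 1⁻¹) 1
      (ContinuousLinearMap.id ℝ (TangentSpace (𝓡 n) (1 : G))) := by
    rw [show (fun x : G => 1 * x * 1⁻¹) = id by ext; simp]
    exact hasMFDerivAt_id 1
  exact congrArg (fun (T : EuclideanSpace ℝ (Fin n) →L[ℝ] EuclideanSpace ℝ (Fin n)) => T Y)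
    (hasMFDerivAt_unique h3 h2)

/-- The bracket as a continuous endomorphism of the model space. -/
def adCLM (X : GroupLieAlgebra (𝓡 n) G) :
    EuclideanSpace ℝ (Fin n) →L[ℝ] EuclideanSpace ℝ (Fin n) :=
  LinearMap.toContinuousLinearMap (E := EuclideanSpace ℝ (Fin n)) (F' := EuclideanSpace ℝ (Fin n))
    (LieAlgebra.ad ℝ (GroupLieAlgebra (𝓡 n) G) X)

/-- The homomorphism property `Ad (exp sX) = Ad (exp (s - t)X) Ad (exp tX)` moves the derivative at
`t` to the derivative at `0`. -/
lemma hasDerivAt_adjointAction_oneParameter (X Y : GroupLieAlgebra (𝓡 n) G) (t : ℝ) :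
    HasDerivAt (F := EuclideanSpace ℝ (Fin n)) (fun s => adjointAction (oneParameter X s) Y)
      (adCLM X (adjointAction (oneParameter X t) Y)) t := by
  have hγ := isMIntegralCurve_oneParameter X 0
  rw [oneParameter_zero, mulInvariantVectorField_one] at hγ
  have h := hasDerivAt_adjointAction (oneParameter_zero X) hγ (adjointAction (oneParameter X t) Y)
  have h' : HasDerivAt (F := EuclideanSpace ℝ (Fin n))
    (fun s => adjointAction (oneParameter X s) (adjointAction (oneParameter X t) Y))
    (adCLM X (adjointAction (oneParameter X t) Y)) (t - t) := by
    rw [sub_self]; exact h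
  have h2 := HasDerivAt.scomp t (h := fun s : ℝ => s - t) h' ((hasDerivAt_id t).sub_const t)
  rw [one_smul] at h2
  refine h2.congr_of_eventuallyEq (Eventually.of_forall fun s => ?_)
  have e : adjointAction (oneParameter X s) Y =
      adjointAction (oneParameter X (s - t)) (adjointAction (oneParameter X t) Y) := by
    rw [← adjointAction_mul, ← oneParameter_add, sub_add_cancel]
  exact e

lemma adjointAction_oneParameter (X Y : GroupLieAlgebra (𝓡 n) G) (t : ℝ) :
    adjointAction (oneParameter X t) Y = NormedSpace.exp (t • adCLM X) Y := by
  let u : ℝ → EuclideanSpace ℝ (Fin n) := fun s => adjointAction (oneParameter X s) Y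
  have hu : ∀ s, HasDerivAt u (adCLM X (u s)) s := hasDerivAt_adjointAction_oneParameter X Y
  have hu0 : u 0 = Y := by simp only [u, oneParameter_zero]; exact adjointAction_one Y
  have h := eq_exp_smul_of_hasDerivAt hu t
  rw [hu0] at h
  exact h

/-- Gives `Ad (exp X)` by the same series that defines `expAd`, so that the two can be compared by
uniqueness of sums. -/
lemma hasSum_adjointAction_oneParameter (X Y : GroupLieAlgebra (𝓡 n) G) :
    HasSum (fun k : ℕ => ((k ! : ℝ)⁻¹) • ((LieAlgebra.ad ℝ (GroupLieAlgebra (𝓡 n) G) X) ^ k) Y)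
      (adjointAction (oneParameter X 1) Y) := by
  rw [adjointAction_oneParameter, one_smul]
  have h1 := hasSum_exp_apply (adCLM X) Y
  have hk : ∀ k : ℕ, (adCLM X ^ k) Y = ((LieAlgebra.ad ℝ (GroupLieAlgebra (𝓡 n) G) X) ^ k) Y := by
    intro k
    induction k with
    | zero => rfl
    | succ k ih =>
      rw [pow_succ', pow_succ']
      exact congrArg (adCLM X) ih
  simp_rw [hk] at h1
  exact h1

end OneParameter

/-! ### Products of curves and the Baker-Campbell-Hausdorff formula with central bracket. -/

section ProductOfCurves

variable {n : ℕ} {G : Type*} [TopologicalSpace G]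
  [ChartedSpace (EuclideanSpace ℝ (Fin n)) G] [Group G] [LieGroup (𝓡 n) ∞ G]

/-- From `g x h = (g h)(h⁻¹ x h)`: right translation by `h` acts on left-invariant fields by `Ad
h⁻¹`. -/
lemma mfderiv_mul_right_mulInvariantVectorField (g h : G) (X : GroupLieAlgebra (𝓡 n) G) :
    mfderiv (𝓡 n) (𝓡 n) (· * h) g (mulInvariantVectorField X g) =
      mulInvariantVectorField (adjointAction h⁻¹ X) (g * h) := by
  have h1 : HasMFDerivAt (𝓡 n) (𝓡 n) (· * h) (g * 1) (mfderiv (𝓡 n) (𝓡 n) (· * h) g) := by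
    rw [mul_one]
    exact ((contMDiff_mul_right (I := 𝓡 n) (n := ∞) (a := h)).mdifferentiableAt (by simp)).hasMFDerivAt
  have h2 := HasMFDerivAt.comp (1 : G) h1 (hasMFDerivAt_mul_left g)
  have h3 : HasMFDerivAt (𝓡 n) (𝓡 n) (g * h * ·) (h⁻¹ * 1 * h⁻¹⁻¹)
      (mfderiv (𝓡 n) (𝓡 n) (g * h * ·) 1) := by
    rw [show h⁻¹ * 1 * h⁻¹⁻¹ = (1 : G) by simp]
    exact hasMFDerivAt_mul_left (n := n) (g * h)
  have h4 := HasMFDerivAt.comp (1 : G) h3 (hasMFDerivAt_conj h⁻¹)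
  have h5 : (· * h) ∘ (g * ·) = (g * h * ·) ∘ (fun x => h⁻¹ * x * h⁻¹⁻¹) := by
    ext x; simp [mul_assoc]
  rw [h5] at h2
  exact congrArg (fun (T : EuclideanSpace ℝ (Fin n) →L[ℝ] EuclideanSpace ℝ (Fin n)) => T X)
    (hasMFDerivAt_unique h2 h4)

/-- The product rule for left logarithmic derivatives: that of `g h` is `Ad h⁻¹ A + B`. -/
lemma hasMFDerivAt_mul_curve {g h : ℝ → G} {t : ℝ} {A B : GroupLieAlgebra (𝓡 n) G}
    (hg : HasMFDerivAt 𝓘(ℝ, ℝ) (𝓡 n) g t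
      ((1 : ℝ →L[ℝ] ℝ).smulRight (mulInvariantVectorField A (g t))))
    (hh : HasMFDerivAt 𝓘(ℝ, ℝ) (𝓡 n) h t
      ((1 : ℝ →L[ℝ] ℝ).smulRight (mulInvariantVectorField B (h t)))) :
    HasMFDerivAt 𝓘(ℝ, ℝ) (𝓡 n) (fun s => g s * h s) t ((1 : ℝ →L[ℝ] ℝ).smulRight
      (mulInvariantVectorField (adjointAction (h t)⁻¹ A + B) (g t * h t))) := by
  have hmul : MDifferentiableAt ((𝓡 n).prod (𝓡 n)) (𝓡 n) (fun p : G × G => p.1 * p.2)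
      (g t, h t) :=
    (contMDiff_mul (𝓡 n) ∞).mdifferentiableAt (by simp)
  let v : TangentSpace ((𝓡 n).prod (𝓡 n)) (g t, h t) :=
    (mulInvariantVectorField A (g t), mulInvariantVectorField B (h t))
  have h0 : HasMFDerivAt 𝓘(ℝ, ℝ) ((𝓡 n).prod (𝓡 n)) (fun s => (g s, h s)) t
      ((1 : ℝ →L[ℝ] ℝ).smulRight v) := hg.prodMk hh
  have h1 := hmul.hasMFDerivAt.comp_curve (γ := fun s => (g s, h s)) (s := Set.univ)
    h0.hasMFDerivWithinAt
  have e : mfderiv ((𝓡 n).prod (𝓡 n)) (𝓡 n) (fun p : G × G => p.1 * p.2) (g t, h t) v =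
      mulInvariantVectorField (adjointAction (h t)⁻¹ A + B) (g t * h t) := by
    have e2 := mfderiv_mul_right_mulInvariantVectorField (g t) (h t) A
    have e3 := mfderiv_mul_left_mulInvariantVectorField (g t) (h t) B
    rw [mulInvariantVectorField_add, mfderiv_prod_eq_add_apply hmul, Pi.add_apply, ← e2, ← e3]
  rw [e] at h1
  exact hasMFDerivWithinAt_univ.1 h1

variable [T2Space G]

instance : T2Space (GroupLieAlgebra (𝓡 n) G) :=
  inferInstanceAs (T2Space (EuclideanSpace ℝ (Fin n)))

lemma adjointAction_oneParameter_of_step_two {X Y : GroupLieAlgebra (𝓡 n) G}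
    (h : ⁅X, ⁅X, Y⁆⁆ = 0) (t : ℝ) :
    adjointAction (oneParameter X t) Y = Y + t • ⁅X, Y⁆ := by
  rw [← one_mul t, ← oneParameter_smul]
  have h1 := hasSum_adjointAction_oneParameter (t • X) Y
  refine h1.unique ?_
  have h2 := hasSum_sum_of_ne_finset_zero (s := Finset.range 2)
    (f := fun k : ℕ => ((k ! : ℝ)⁻¹) •
      ((LieAlgebra.ad ℝ (GroupLieAlgebra (𝓡 n) G) (t • X)) ^ k) Y) (L := SummationFilter.unconditional ℕ) ?_
  · convert h2 using 1
    simp [Finset.sum_range_succ]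
  · intro k hk
    obtain ⟨j, rfl⟩ : ∃ j, k = j + 2 := ⟨k - 2, by simp at hk; omega⟩
    rw [pow_add]
    simp [pow_two, h]

lemma adjointAction_oneParameter_of_commute {X Y : GroupLieAlgebra (𝓡 n) G}
    (h : ⁅X, Y⁆ = 0) (t : ℝ) : adjointAction (oneParameter X t) Y = Y := by
  rw [adjointAction_oneParameter_of_step_two (by rw [h, lie_zero]), h, smul_zero, add_zero]

/-- The Baker-Campbell-Hausdorff formula when the bracket is central. -/
lemma oneParameter_add_of_central {X Y : GroupLieAlgebra (𝓡 n) G}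
    (hZ : ∀ W : GroupLieAlgebra (𝓡 n) G, ⁅(⁅X, Y⁆ : GroupLieAlgebra (𝓡 n) G), W⁆ = 0) (t : ℝ) :
    oneParameter (X + Y) t =
      oneParameter X t * oneParameter Y t * oneParameter ⁅X, Y⁆ (-(t ^ 2 / 2)) := by
  refine (congrFun (eq_oneParameter (γ := fun t =>
    oneParameter X t * oneParameter Y t * oneParameter ⁅X, Y⁆ (-(t ^ 2 / 2))) (by simp) ?_) t).symm
  intro t
  have h1 := hasMFDerivAt_mul_curve (isMIntegralCurve_oneParameter X t)
    (isMIntegralCurve_oneParameter Y t)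
  have h2 : HasMFDerivAt 𝓘(ℝ, ℝ) (𝓡 n) (fun s => oneParameter (⁅X, Y⁆) (-(s ^ 2 / 2))) t
      ((1 : ℝ →L[ℝ] ℝ).smulRight (mulInvariantVectorField ((-t) • ⁅X, Y⁆)
        (oneParameter ⁅X, Y⁆ (-(t ^ 2 / 2))))) := by
    have hd : HasDerivAt (fun s : ℝ => -(s ^ 2 / 2)) (-t) t := by
      have := ((hasDerivAt_pow 2 t).div_const 2).neg
      rwa [show -((2 : ℕ) * t ^ (2 - 1) / 2) = -t by simp] at this
    have h3 := (isMIntegralCurve_oneParameter ⁅X, Y⁆ (-(t ^ 2 / 2))).comp_curve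
      (γ := fun s : ℝ => -(s ^ 2 / 2)) (s := Set.univ) (v := -t)
      (hasMFDerivWithinAt_univ.2 hd.hasFDerivAt.hasMFDerivAt)
    rw [mulInvariantVectorField_smul]
    exact hasMFDerivWithinAt_univ.1 h3
  have h3 := hasMFDerivAt_mul_curve h1 h2
  -- The left logarithmic derivative of the triple product is `Ad (exp tY)⁻¹ X + Y - t[X,Y]`, since
  -- the central factor acts trivially. As `Ad (exp tY)⁻¹ X = X + t[X,Y]`, it is constantly `X + Y`.
  have ad0 : adjointAction (oneParameter ⁅X, Y⁆ (-(t ^ 2 / 2)))⁻¹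
      (adjointAction (oneParameter Y t)⁻¹ X + Y) =
      adjointAction (oneParameter Y t)⁻¹ X + Y := by
    rw [← oneParameter_neg]
    exact adjointAction_oneParameter_of_commute (hZ _) _
  have ad1 : adjointAction (oneParameter Y t)⁻¹ X = X + t • ⁅X, Y⁆ := by
    have hs : ⁅Y, X⁆ = -⁅X, Y⁆ := (lie_skew Y X).symm
    rw [← oneParameter_neg, adjointAction_oneParameter_of_step_two, hs, neg_smul_neg]
    rw [hs, lie_neg, ← lie_skew, hZ, neg_zero, neg_zero]
  rw [ad0, ad1] at h3
  rwa [show X + t • ⁅X, Y⁆ + Y + -t • ⁅X, Y⁆ = X + Y by rw [neg_smul]; abel] at h3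

end ProductOfCurves

/-! ### Homogeneous quasimorphisms and the inclusion valid for all Lie algebras. -/

section HomogeneousQuasimorphism

lemma eq_zero_of_forall_nat_mul_abs_le {x C : ℝ} (h : ∀ k : ℕ, k * |x| ≤ C) : x = 0 := by
  by_contra hx
  obtain ⟨k, hk⟩ := exists_nat_gt (C / |x|)
  rw [div_lt_iff₀ (abs_pos.2 hx)] at hk
  exact absurd (h k) (not_le.2 hk)

namespace IsHomogeneousQuasimorphism

variable {G : Type*} [Group G] [TopologicalSpace G] {f : G → ℝ}

lemma map_pow (hf : IsHomogeneousQuasimorphism f) (g : G) (k : ℕ) : f (g ^ k) = k * f g := by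
  simpa using hf.map_zpow g k

/-- `f (g h^k g⁻¹)` and `f (h^k)` differ by a bound independent of `k`, whereas homogeneity
multiplies the difference by `k`. -/
lemma map_conj (hf : IsHomogeneousQuasimorphism f) (g h : G) : f (g * h * g⁻¹) = f h := by
  obtain ⟨D, hD⟩ := hf.bounded_defect
  rw [← sub_eq_zero]
  refine eq_zero_of_forall_nat_mul_abs_le (C := 2 * D + |f g + f g⁻¹|) fun k => ?_
  have h1 := hD (g * h ^ k) g⁻¹
  have h2 := hD g (h ^ k)
  rw [← conj_pow, hf.map_pow] at h1
  rw [hf.map_pow] at h2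
  rw [← Nat.abs_cast k, ← abs_mul]
  have := le_abs_self (f g + f g⁻¹)
  have := neg_abs_le (f g + f g⁻¹)
  rw [abs_le] at h1 h2 ⊢
  constructor <;> nlinarith

/-- For commuting elements `(g h)^k = g^k h^k`, so `k` times the defect at `(g, h)` stays bounded by
`D`. -/
lemma map_mul_of_commute (hf : IsHomogeneousQuasimorphism f) {g h : G} (hc : Commute g h) :
    f (g * h) = f g + f h := by
  obtain ⟨D, hD⟩ := hf.bounded_defect
  rw [← sub_eq_zero]
  refine eq_zero_of_forall_nat_mul_abs_le (C := D) fun k => ?_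
  have h1 := hD (g ^ k) (h ^ k)
  rw [← hc.mul_pow, hf.map_pow, hf.map_pow, hf.map_pow] at h1
  rw [← Nat.abs_cast k, ← abs_mul]
  rwa [show (k : ℝ) * (f (g * h) - (f g + f h)) = k * f (g * h) - k * f g - k * f h by ring]

lemma const_mul (hf : IsHomogeneousQuasimorphism f) (c : ℝ) :
    IsHomogeneousQuasimorphism fun g => c * f g := by
  obtain ⟨D, hD⟩ := hf.bounded_defect
  refine ⟨continuous_const.mul hf.continuous, ⟨|c| * D, fun g h => ?_⟩, fun g n => ?_⟩
  · rw [show c * f (g * h) - c * f g - c * f h = c * (f (g * h) - f g - f h) by ring, abs_mul]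
    exact mul_le_mul_of_nonneg_left (hD g h) (abs_nonneg c)
  · rw [hf.map_zpow]; ring

end IsHomogeneousQuasimorphism

variable {n : ℕ} {G : Type*} [TopologicalSpace G]
  [ChartedSpace (EuclideanSpace ℝ (Fin n)) G] [Group G] [LieGroup (𝓡 n) ∞ G] [T2Space G]

/-- Along a one-parameter subgroup `f` is additive by commutativity, and continuous additive maps `ℝ
→ ℝ` are linear. -/
lemma IsHomogeneousQuasimorphism.map_oneParameter {f : G → ℝ} (hf : IsHomogeneousQuasimorphism f)
    (X : GroupLieAlgebra (𝓡 n) G) (t : ℝ) :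
    f (oneParameter X t) = t * f (oneParameter X 1) := by
  let F : ℝ →+ ℝ := AddMonoidHom.mk' (fun t => f (oneParameter X t)) (by
    intro s t
    rw [oneParameter_add]
    refine hf.map_mul_of_commute ?_
    rw [Commute, SemiconjBy, ← oneParameter_add, ← oneParameter_add, add_comm])
  have h := (F.toRealLinearMap (hf.continuous.comp (continuous_oneParameter X))).map_smul t 1
  rw [smul_eq_mul, mul_one, smul_eq_mul] at h
  exact h

variable {𝔤 : Type*} [LieRing 𝔤] [LieAlgebra ℝ 𝔤] [FiniteDimensional ℝ 𝔤]
    [TopologicalSpace 𝔤] [IsTopologicalAddGroup 𝔤] [ContinuousSMul ℝ 𝔤] [T2Space 𝔤]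

instance : IsTopologicalAddGroup (GroupLieAlgebra (𝓡 n) G) :=
  inferInstanceAs (IsTopologicalAddGroup (EuclideanSpace ℝ (Fin n)))

instance : ContinuousSMul ℝ (GroupLieAlgebra (𝓡 n) G) :=
  inferInstanceAs (ContinuousSMul ℝ (EuclideanSpace ℝ (Fin n)))

lemma map_expAd (ι : 𝔤 ≃ₗ⁅ℝ⁆ GroupLieAlgebra (𝓡 n) G) (X Y : 𝔤) :
    ι (expAd X Y) = adjointAction (oneParameter (ι X) 1) (ι Y) := by
  have hc : Continuous ι := LinearMap.continuous_of_finiteDimensional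
    ((ι : 𝔤 →ₗ⁅ℝ⁆ GroupLieAlgebra (𝓡 n) G) : 𝔤 →ₗ[ℝ] GroupLieAlgebra (𝓡 n) G)
  have h1 := (hasSum_expAd X Y).map ι hc
  refine h1.unique ?_
  have h2 := hasSum_adjointAction_oneParameter (ι X) (ι Y)
  convert h2 using 1
  ext k
  have hk : ∀ k : ℕ, ι (((LieAlgebra.ad ℝ 𝔤 X) ^ k) Y) =
      ((LieAlgebra.ad ℝ (GroupLieAlgebra (𝓡 n) G) (ι X)) ^ k) (ι Y) := by
    intro k
    induction k with
    | zero => rfl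
    | succ k ih =>
      rw [pow_succ', pow_succ', Module.End.mul_apply, Module.End.mul_apply, ← ih]
      exact LieEquiv.map_lie ι X _
  simp [hk]

lemma isAdInvariant_of_quasimorphism {f : G → ℝ} (hf : IsHomogeneousQuasimorphism f)
    (ι : 𝔤 ≃ₗ⁅ℝ⁆ GroupLieAlgebra (𝓡 n) G) :
    IsAdInvariant (fun X : 𝔤 => f (oneParameter (ι X) 1)) := by
  intro X Y
  simp only [map_expAd]
  rw [← conj_oneParameter, hf.map_conj]

omit [FiniteDimensional ℝ 𝔤] [TopologicalSpace 𝔤] [IsTopologicalAddGroup 𝔤]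
  [ContinuousSMul ℝ 𝔤] [T2Space 𝔤] in
lemma smul_of_quasimorphism {f : G → ℝ} (hf : IsHomogeneousQuasimorphism f)
    (ι : 𝔤 ≃ₗ⁅ℝ⁆ GroupLieAlgebra (𝓡 n) G) (c : ℝ) (X : 𝔤) :
    f (oneParameter (ι (c • X)) 1) = c * f (oneParameter (ι X) 1) := by
  rw [map_smul, oneParameter_smul, one_mul, hf.map_oneParameter]

theorem quasimorphismQuasiStates_subset :
    continuousQuasimorphismQuasiStates 𝔤 ⊆ continuousAdInvariantQuasiStates 𝔤 := by
  rintro ζ ⟨h1, h2, n, G, _, _, _, _, _, _, ι, e, f, he, hf, hζ⟩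
  refine ⟨h1, h2, ?_⟩
  have : ζ = fun X => f (oneParameter (ι X) 1) := by
    ext X; rw [hζ, he.eq_oneParameter]
  rw [this]
  exact isAdInvariant_of_quasimorphism hf ι

/-- On a central extension, quasi-states coming from quasimorphisms are additive. -/
theorem map_add_of_quasimorphism {ζ : 𝔤 → ℝ} (hζ : IsDerivOfHomogeneousQuasimorphism ζ) {X Y : 𝔤}
    (hZ : ∀ W : 𝔤, ⁅⁅X, Y⁆, W⁆ = 0) (h0 : ζ ⁅X, Y⁆ = 0) : ζ (X + Y) = ζ X + ζ Y := by
  obtain ⟨n, G, _, _, _, _, _, _, ι, e, f, he, hf, hζ⟩ := hζ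
  simp only [hζ, he.eq_oneParameter] at h0 ⊢
  have hZ' : ∀ W : GroupLieAlgebra (𝓡 n) G, ⁅(⁅ι X, ι Y⁆ : GroupLieAlgebra (𝓡 n) G), W⁆ = 0 := by
    intro W
    obtain ⟨W, rfl⟩ : ∃ V, ι V = W := ⟨ι.symm W, ι.apply_symm_apply W⟩
    rw [← LieEquiv.map_lie, ← LieEquiv.map_lie, hZ, map_zero]
  obtain ⟨D, hD⟩ := hf.bounded_defect
  rw [← sub_eq_zero]
  refine eq_zero_of_forall_nat_mul_abs_le (C := 2 * D) fun k => ?_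
  -- At integer time `k`, `exp k(X+Y)` is `exp kX exp kY` times an element of the one-parameter
  -- group of `[X,Y]`, on which `f` vanishes by `h0`. Two uses of the defect bound `k` times the
  -- failure of additivity by `2D`.
  have h1 := oneParameter_add_of_central hZ' k
  have h2 := hD (oneParameter (ι X) k * oneParameter (ι Y) k)
    (oneParameter ⁅ι X, ι Y⁆ (-((k : ℝ) ^ 2 / 2)))
  have h3 := hD (oneParameter (ι X) k) (oneParameter (ι Y) k)
  rw [← h1, hf.map_oneParameter (ι X + ι Y), hf.map_oneParameter ⁅ι X, ι Y⁆] at h2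
  rw [hf.map_oneParameter (ι X), hf.map_oneParameter (ι Y)] at h3
  rw [LieEquiv.map_lie] at h0
  rw [h0] at h2
  rw [map_add, ← Nat.abs_cast k, ← abs_mul]
  rw [abs_le] at h2 h3 ⊢
  constructor <;> linarith

end HomogeneousQuasimorphism

/-! ### Lie groups given by a global smooth group law on a vector space. -/

/-- A smooth group law on a normed space. -/
structure SmoothGroupLaw (F : Type*) [NormedAddCommGroup F] [NormedSpace ℝ F] where
  /-- the multiplication -/
  mul : F → F → F
  /-- the unit -/
  one : F
  /-- the inverse -/
  inv : F → F
  mul_assoc : ∀ a b c, mul (mul a b) c = mul a (mul b c)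
  one_mul : ∀ a, mul one a = a
  inv_mul : ∀ a, mul (inv a) a = one
  contDiff_mul : ContDiff ℝ ∞ fun p : F × F => mul p.1 p.2
  contDiff_inv : ContDiff ℝ ∞ inv

namespace SmoothGroupLaw

variable {F : Type*} [NormedAddCommGroup F] [NormedSpace ℝ F] (S : SmoothGroupLaw F)
  {n : ℕ} (e : F ≃L[ℝ] EuclideanSpace ℝ (Fin n))

/-- The Lie group defined by a smooth group law, transported to a Euclidean space. -/
def Carrier (_ : SmoothGroupLaw F) {n : ℕ} (_ : F ≃L[ℝ] EuclideanSpace ℝ (Fin n)) : Type :=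
  EuclideanSpace ℝ (Fin n)

instance : TopologicalSpace (S.Carrier e) :=
  inferInstanceAs (TopologicalSpace (EuclideanSpace ℝ (Fin n)))

instance : T2Space (S.Carrier e) := inferInstanceAs (T2Space (EuclideanSpace ℝ (Fin n)))

instance : SecondCountableTopology (S.Carrier e) :=
  inferInstanceAs (SecondCountableTopology (EuclideanSpace ℝ (Fin n)))

instance : ChartedSpace (EuclideanSpace ℝ (Fin n)) (S.Carrier e) :=
  inferInstanceAs (ChartedSpace (EuclideanSpace ℝ (Fin n)) (EuclideanSpace ℝ (Fin n)))

instance : IsManifold (𝓡 n) ∞ (S.Carrier e) :=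
  inferInstanceAs (IsManifold (𝓡 n) ∞ (EuclideanSpace ℝ (Fin n)))

instance : Mul (S.Carrier e) := ⟨fun x y => e (S.mul (e.symm x) (e.symm y))⟩
instance : One (S.Carrier e) := ⟨e S.one⟩
instance : Inv (S.Carrier e) := ⟨fun x => e (S.inv (e.symm x))⟩

/-- The element of the Lie group with given coordinates. -/
def ofCoord (x : F) : S.Carrier e := e x

/-- The coordinates of an element of the Lie group. -/
def coord (x : S.Carrier e) : F := e.symm x

@[simp] lemma coord_mul (x y : S.Carrier e) :
    S.coord e (x * y) = S.mul (S.coord e x) (S.coord e y) := e.symm_apply_apply _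

@[simp] lemma coord_one : S.coord e 1 = S.one := e.symm_apply_apply _

@[simp] lemma coord_inv (x : S.Carrier e) : S.coord e x⁻¹ = S.inv (S.coord e x) :=
  e.symm_apply_apply _

@[simp] lemma coord_ofCoord (x : F) : S.coord e (S.ofCoord e x) = x := e.symm_apply_apply _

lemma coord_injective : Function.Injective (S.coord e) := e.symm.injective

lemma continuous_coord : Continuous (S.coord e) := e.symm.continuous

instance : Group (S.Carrier e) :=
  Group.ofLeftAxioms
    (fun a b c => S.coord_injective e (by simp [S.mul_assoc]))
    (fun a => S.coord_injective e (by simp [S.one_mul]))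
    (fun a => S.coord_injective e (by simp [S.inv_mul]))

instance : LieGroup (𝓡 n) ∞ (S.Carrier e) where
  contMDiff_mul := by
    have h : ContDiff ℝ ∞ fun p : EuclideanSpace ℝ (Fin n) × EuclideanSpace ℝ (Fin n) =>
        e (S.mul (e.symm p.1) (e.symm p.2)) :=
      e.contDiff.comp (S.contDiff_mul.comp
        ((e.symm.contDiff.comp contDiff_fst).prodMk (e.symm.contDiff.comp contDiff_snd)))
    have h2 := h.contMDiff
    rw [modelWithCornersSelf_prod, ← chartedSpaceSelf_prod] at h2
    exact h2
  contMDiff_inv := (e.contDiff.comp (S.contDiff_inv.comp e.symm.contDiff)).contMDiff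

lemma unitChart_apply (x : S.Carrier e) : unitChart n (S.Carrier e) x = x := by
  have := extChartAt_model_space_eq_id (𝕜 := ℝ) (e S.one)
  exact congrArg (fun f : PartialEquiv (EuclideanSpace ℝ (Fin n)) (EuclideanSpace ℝ (Fin n)) => f x) this

lemma unitChart_symm_apply (x : EuclideanSpace ℝ (Fin n)) :
    (unitChart n (S.Carrier e)).symm x = x := by
  have := extChartAt_model_space_eq_id (𝕜 := ℝ) (e S.one)
  exact congrArg (fun f : PartialEquiv (EuclideanSpace ℝ (Fin n)) (EuclideanSpace ℝ (Fin n)) => f.symm x) this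

/-- The tangent vector at the unit with given coordinates. -/
def tangent (X : F) : GroupLieAlgebra (𝓡 n) (S.Carrier e) := e X

variable {S} in
/-- The bracket of the Lie algebra is the antisymmetrisation of the mixed second derivative of the
multiplication. -/
lemma bracket_eq {L : F → F →L[ℝ] F} {B : F → F →L[ℝ] F}
    (hL : ∀ x, HasFDerivAt (S.mul x) (L x) S.one)
    (hB : ∀ y, HasFDerivAt (fun x => L x y) (B y) S.one) (X Y : F) :
    ⁅S.tangent e X, S.tangent e Y⁆ = S.tangent e (B Y X - B X Y) := by
  have hm : chartMul n (S.Carrier e) = fun p => e (S.mul (e.symm p.1) (e.symm p.2)) := by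
    ext1 p
    rw [chartMul, unitChart_apply, unitChart_symm_apply, unitChart_symm_apply]
    rfl
  have h1 : unitChart n (S.Carrier e) 1 = e S.one := unitChart_apply S e 1
  have hd1 : ∀ x Z : EuclideanSpace ℝ (Fin n),
      fderiv ℝ (fun y => e (S.mul (e.symm x) (e.symm y))) (e S.one) Z =
        e (L (e.symm x) (e.symm Z)) := by
    intro x Z
    have h : HasFDerivAt (S.mul (e.symm x)) (L (e.symm x)) (e.symm (e S.one)) := by
      rw [e.symm_apply_apply]; exact hL _
    have := e.hasFDerivAt.comp (e S.one) (h.comp (e S.one) e.symm.hasFDerivAt)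
    have h' : HasFDerivAt (fun y => e (S.mul (e.symm x) (e.symm y))) _ (e S.one) := this
    rw [h'.fderiv]
    rfl
  have hd2 : ∀ y Z : F, fderiv ℝ (fun x : EuclideanSpace ℝ (Fin n) => e (L (e.symm x) y))
      (e S.one) (e Z) = e (B y Z) := by
    intro y Z
    have h : HasFDerivAt (fun x => L x y) (B y) (e.symm (e S.one)) := by
      rw [e.symm_apply_apply]; exact hB _
    have := e.hasFDerivAt.comp (e S.one) (h.comp (e S.one) e.symm.hasFDerivAt)
    have h' : HasFDerivAt (fun x => e (L (e.symm x) y)) _ (e S.one) := this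
    rw [h'.fderiv]
    simp
  have key : ∀ X Y : F, fderiv ℝ (fun x : EuclideanSpace ℝ (Fin n) =>
      fderiv ℝ (fun y => e (S.mul (e.symm x) (e.symm y))) (e S.one) (e Y)) (e S.one) (e X) =
      e (B Y X) := by
    intro X Y
    simp only [hd1, e.symm_apply_apply, hd2]
  rw [bracket_eq_chartMul, hm, h1]
  exact (congrArg₂ (fun a b : EuclideanSpace ℝ (Fin n) => a - b) (key X Y) (key Y X)).trans
    (map_sub e _ _).symm

/-- A linear isomorphism compatible with the brackets identifies the Lie algebras. -/
def lieEquiv {𝔤 : Type*} [LieRing 𝔤] [LieAlgebra ℝ 𝔤] (u : 𝔤 ≃ₗ[ℝ] F)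
    (h : ∀ X Y : 𝔤, ⁅S.tangent e (u X), S.tangent e (u Y)⁆ = S.tangent e (u ⁅X, Y⁆)) :
    𝔤 ≃ₗ⁅ℝ⁆ GroupLieAlgebra (𝓡 n) (S.Carrier e) :=
  { (u.trans e.toLinearEquiv : 𝔤 ≃ₗ[ℝ] EuclideanSpace ℝ (Fin n)) with
    map_lie' := by
      intro X Y
      exact (h X Y).symm }

/-- Lets a quasimorphism given in coordinates be evaluated on `exp X` by differentiating at `0`,
with no formula for `exp`. -/
lemma hasDerivAt_coord_oneParameter (X : F) :
    HasDerivAt (fun t => S.coord e (oneParameter (S.tangent e X) t)) X 0 := by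
  have h := isMIntegralCurve_oneParameter (S.tangent e X) 0
  rw [oneParameter_zero, mulInvariantVectorField_one] at h
  let X' : EuclideanSpace ℝ (Fin n) := e X
  let γ : ℝ → EuclideanSpace ℝ (Fin n) := fun t =>
    (oneParameter (S.tangent e X) t : S.Carrier e)
  have h' : HasMFDerivAt 𝓘(ℝ, ℝ) (𝓡 n) γ 0 ((1 : ℝ →L[ℝ] ℝ).smulRight X') := h
  have h' : HasFDerivAt γ ((1 : ℝ →L[ℝ] ℝ).smulRight X') 0 := h'.hasFDerivAt
  have h2 := h'.hasDerivAt
  rw [ContinuousLinearMap.smulRight_apply, one_apply_eq_self, one_smul] at h2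
  have h3 := e.symm.hasFDerivAt.comp_hasDerivAt 0 h2
  rwa [ContinuousLinearEquiv.coe_coe, e.symm_apply_apply] at h3

end SmoothGroupLaw

/-! ### The group law `x + exp (τ(x) A) y`. -/

section SemidirectProduct

variable {F : Type*} [NormedAddCommGroup F] [NormedSpace ℝ F] [CompleteSpace F]

/-- Every term of the exponential series beyond the zeroth lies in the range of `A`. Applied to `τ`
it makes the group law associative; applied to a character it yields a homomorphism. -/
lemma apply_exp_smul_of_comp_eq_zero {A : F →L[ℝ] F} {τ : F →L[ℝ] ℝ} (h : ∀ x, τ (A x) = 0)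
    (s : ℝ) (x : F) : τ (NormedSpace.exp (s • A) x) = τ x := by
  have h1 := (hasSum_exp_apply (s • A) x).mapL τ
  refine h1.unique ?_
  have h2 := hasSum_single (f := fun k : ℕ => τ (((k ! : ℝ)⁻¹) • ((s • A) ^ k) x)) 0 ?_
  · simpa using h2
  · intro k hk
    obtain ⟨j, rfl⟩ := Nat.exists_eq_succ_of_ne_zero hk
    rw [Nat.succ_eq_add_one, pow_succ']
    simp [h]

lemma exp_add_smul_apply (A : F →L[ℝ] F) (s t : ℝ) (x : F) :
    NormedSpace.exp ((s + t) • A) x = NormedSpace.exp (s • A) (NormedSpace.exp (t • A) x) := by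
  have hb : ∀ B : F →L[ℝ] F, B ∈ Metric.eball (0 : F →L[ℝ] F)
      (NormedSpace.expSeries ℝ (F →L[ℝ] F)).radius := fun B =>
    (NormedSpace.expSeries_radius_eq_top ℝ (F →L[ℝ] F)).symm ▸ edist_lt_top _ _
  rw [add_smul, NormedSpace.exp_add_of_commute_of_mem_ball (𝕂 := ℝ)
    (((Commute.refl A).smul_left _).smul_right _) (hb _) (hb _)]
  rfl

lemma contDiff_normedSpace_exp : ContDiff ℝ ∞ (NormedSpace.exp : (F →L[ℝ] F) → F →L[ℝ] F) :=
  contDiff_iff_contDiffAt.2 fun x => (NormedSpace.exp_analytic (𝕂 := ℝ) x).contDiffAt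

/-- The group law of the semidirect product of `ker τ` and `ℝ` acting through `exp (s A)`. -/
def semidirectGroupLaw (τ : F →L[ℝ] ℝ) (A : F →L[ℝ] F) (h : ∀ x, τ (A x) = 0) :
    SmoothGroupLaw F where
  mul x y := x + NormedSpace.exp (τ x • A) y
  one := 0
  inv x := -NormedSpace.exp ((-τ x) • A) x
  mul_assoc a b c := by
    simp only [map_add, apply_exp_smul_of_comp_eq_zero h, exp_add_smul_apply, add_assoc]
  one_mul a := by simp [NormedSpace.exp_zero]
  inv_mul a := by rw [map_neg, apply_exp_smul_of_comp_eq_zero h, neg_add_cancel]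
  contDiff_mul := contDiff_fst.add ((contDiff_normedSpace_exp.comp
    ((τ.contDiff.comp contDiff_fst).smul contDiff_const)).clm_apply contDiff_snd)
  contDiff_inv := ((contDiff_normedSpace_exp.comp
    (τ.contDiff.neg.smul contDiff_const)).clm_apply contDiff_id).neg

/-- Left translation by `x` has derivative `exp (τ(x) A)`, whose derivative at `0` in direction `X`
is `τ(X) A`. -/
lemma semidirectGroupLaw_bracket (τ : F →L[ℝ] ℝ) (A : F →L[ℝ] F) (h : ∀ x, τ (A x) = 0)
    {n : ℕ} (e : F ≃L[ℝ] EuclideanSpace ℝ (Fin n)) (X Y : F) :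
    ⁅(semidirectGroupLaw τ A h).tangent e X, (semidirectGroupLaw τ A h).tangent e Y⁆ =
      (semidirectGroupLaw τ A h).tangent e (τ X • A Y - τ Y • A X) := by
  refine SmoothGroupLaw.bracket_eq e (L := fun x => NormedSpace.exp (τ x • A))
    (B := fun y => τ.smulRight (A y)) (fun x => ?_) (fun y => ?_) X Y
  · exact (NormedSpace.exp (τ x • A)).hasFDerivAt.const_add x
  · have h1 := hasDerivAt_exp_smul_const (𝕂 := ℝ) A (0 : ℝ)
    rw [zero_smul, NormedSpace.exp_zero, one_mul] at h1
    have h2 : HasDerivAt (fun s : ℝ => NormedSpace.exp (s • A) y) (A y) (τ 0) := by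
      have := h1.clm_apply (hasDerivAt_const (0 : ℝ) y)
      rw [map_zero]
      simpa using this
    refine HasFDerivAt.congr_fderiv (h2.hasFDerivAt.comp (0 : F) τ.hasFDerivAt) ?_
    ext
    simp

end SemidirectProduct

/-! ### Characters integrate to homomorphisms. -/

section Solvable

variable {𝔤 : Type*} [LieRing 𝔤] [LieAlgebra ℝ 𝔤] [FiniteDimensional ℝ 𝔤]

/-- The bracket is that of the semidirect group law. Since `ζ` kills the range of `A`, it is, read
in the global coordinates of the group, a homomorphism to `ℝ`, so a quasimorphism of defect zero. -/
theorem isDerivOfHomogeneousQuasimorphism_of_linear {τ ζ : 𝔤 →ₗ[ℝ] ℝ} {A : 𝔤 →ₗ[ℝ] 𝔤}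
    (hτ : ∀ x, τ (A x) = 0) (hζ : ∀ x, ζ (A x) = 0)
    (hbr : ∀ X Y : 𝔤, ⁅X, Y⁆ = τ X • A Y - τ Y • A X) :
    IsDerivOfHomogeneousQuasimorphism (ζ : 𝔤 → ℝ) := by
  let n := Module.finrank ℝ 𝔤
  let u : 𝔤 ≃ₗ[ℝ] EuclideanSpace ℝ (Fin n) := LinearEquiv.ofFinrankEq 𝔤 _ (by simp [n])
  let τ' : EuclideanSpace ℝ (Fin n) →L[ℝ] ℝ := LinearMap.toContinuousLinearMap (τ ∘ₗ u.symm)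
  let ζ' : EuclideanSpace ℝ (Fin n) →L[ℝ] ℝ := LinearMap.toContinuousLinearMap (ζ ∘ₗ u.symm)
  let A' : EuclideanSpace ℝ (Fin n) →L[ℝ] EuclideanSpace ℝ (Fin n) :=
    LinearMap.toContinuousLinearMap (u.conj A)
  have hτ' : ∀ x, τ' (A' x) = 0 := by intro x; simp [τ', A', LinearEquiv.conj_apply, hτ]
  have hζ' : ∀ x, ζ' (A' x) = 0 := by intro x; simp [ζ', A', LinearEquiv.conj_apply, hζ]
  let S := semidirectGroupLaw τ' A' hτ'
  let e := ContinuousLinearEquiv.refl ℝ (EuclideanSpace ℝ (Fin n))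
  let ι := S.lieEquiv e u (by
    intro X Y
    refine (semidirectGroupLaw_bracket τ' A' hτ' e _ _).trans ?_
    congr 1
    simp [τ', A', LinearEquiv.conj_apply, hbr])
  have hf : IsHomogeneousQuasimorphism fun x : S.Carrier e => ζ' (S.coord e x) := by
    have hadd : ∀ x y : S.Carrier e, ζ' (S.coord e (x * y)) =
        ζ' (S.coord e x) + ζ' (S.coord e y) := by
      intro x y
      rw [S.coord_mul]
      refine (map_add ζ' _ _).trans ?_
      rw [apply_exp_smul_of_comp_eq_zero hζ']
    refine ⟨ζ'.continuous.comp (S.continuous_coord e), ⟨0, fun x y => by rw [hadd]; simp⟩, ?_⟩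
    intro x k
    let F : S.Carrier e →* Multiplicative ℝ :=
      MonoidHom.mk' (fun x => Multiplicative.ofAdd (ζ' (S.coord e x)))
        (fun x y => by rw [hadd]; rfl)
    have := congrArg Multiplicative.toAdd (map_zpow F x k)
    simpa [F] using this
  refine ⟨n, S.Carrier e, inferInstance, inferInstance, inferInstance, inferInstance, inferInstance,
    inferInstance, ι, fun X => oneParameter X 1, fun x => ζ' (S.coord e x),
    isExponentialMap_oneParameter, hf, fun X => ?_⟩
  have h1 : HasDerivAt (fun t => ζ' (S.coord e (oneParameter (ι X) t))) (ζ' (u X)) 0 :=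
    ζ'.hasFDerivAt.comp_hasDerivAt 0 (S.hasDerivAt_coord_oneParameter e (u X))
  -- `f` is linear along one-parameter subgroups, so its derivative at `0` equals its value at time
  -- `1`.
  have h2 : HasDerivAt (fun t => ζ' (S.coord e (oneParameter (ι X) t)))
      (ζ' (S.coord e (oneParameter (ι X) 1))) 0 := by
    have h3 := (hasDerivAt_id (0 : ℝ)).mul_const (ζ' (S.coord e (oneParameter (ι X) 1)))
    rw [one_mul] at h3
    exact h3.congr_of_eventuallyEq (Eventually.of_forall fun t => hf.map_oneParameter (ι X) t)
  refine Eq.trans ?_ (h1.unique h2)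
  simp [ζ']

end Solvable

/-! ### Adapted bases in dimension three. -/

section BasisOfThree

variable {V : Type*} [AddCommGroup V] [Module ℝ V] [FiniteDimensional ℝ V]

/-- Three independent vectors turn the bound `≤ 3` into an equality, so the dimension hypothesis
never needs to be split into cases. -/
lemma exists_basis_of_three (hdim : Module.finrank ℝ V ≤ 3) {x y z : V}
    (h : ∀ a b c : ℝ, a • x + b • y + c • z = 0 → a = 0 ∧ b = 0 ∧ c = 0) :
    ∃ b : Module.Basis (Fin 3) ℝ V, b 0 = x ∧ b 1 = y ∧ b 2 = z := by
  have hli : LinearIndependent ℝ ![x, y, z] := by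
    rw [Fintype.linearIndependent_iff]
    intro g hg
    rw [Fin.sum_univ_three] at hg
    obtain ⟨h0, h1, h2⟩ := h (g 0) (g 1) (g 2) hg
    intro i
    fin_cases i
    exacts [h0, h1, h2]
  have hcard : Fintype.card (Fin 3) = Module.finrank ℝ V := by
    have := hli.fintype_card_le_finrank
    simp only [Fintype.card_fin] at this ⊢
    omega
  refine ⟨basisOfLinearIndependentOfCardEqFinrank hli hcard, ?_, ?_, ?_⟩ <;> simp

omit [FiniteDimensional ℝ V] in
lemma Module.Basis.eq_add_three (b : Module.Basis (Fin 3) ℝ V) (x : V) :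
    x = b.repr x 0 • b 0 + b.repr x 1 • b 1 + b.repr x 2 • b 2 := by
  conv_lhs => rw [← b.sum_repr x, Fin.sum_univ_three]

end BasisOfThree

/-! ### Ad-invariant quasi-states on extensions of `ℝ` by an abelian ideal. -/

section AdInvariant

variable {𝔤 : Type*} [LieRing 𝔤] [LieAlgebra ℝ 𝔤] [FiniteDimensional ℝ 𝔤]
    [TopologicalSpace 𝔤] [IsTopologicalAddGroup 𝔤] [ContinuousSMul ℝ 𝔤] [T2Space 𝔤]

lemma IsLieQuasiState.map_smul' {𝔤 : Type*} [LieRing 𝔤] [LieAlgebra ℝ 𝔤] {ζ : 𝔤 → ℝ}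
    (h : IsLieQuasiState ζ) (c : ℝ) (X : 𝔤) : ζ (c • X) = c * ζ X := by
  simpa using h X X (lie_self X) c 0

lemma IsLieQuasiState.map_add_of_lie_eq_zero {𝔤 : Type*} [LieRing 𝔤] [LieAlgebra ℝ 𝔤] {ζ : 𝔤 → ℝ}
    (h : IsLieQuasiState ζ) {X Y : 𝔤} (hXY : ⁅X, Y⁆ = 0) : ζ (X + Y) = ζ X + ζ Y := by
  simpa using h X Y hXY 1 1

lemma expAd_of_step_two {X Y : 𝔤} (h : ⁅X, ⁅X, Y⁆⁆ = 0) : expAd X Y = Y + ⁅X, Y⁆ := by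
  refine (hasSum_expAd X Y).unique ?_
  have h2 := hasSum_sum_of_ne_finset_zero (s := Finset.range 2)
    (f := fun k : ℕ => ((k ! : ℝ)⁻¹) • ((LieAlgebra.ad ℝ 𝔤 X) ^ k) Y)
    (L := SummationFilter.unconditional ℕ) ?_
  · convert h2 using 1
    simp [Finset.sum_range_succ]
  · intro k hk
    obtain ⟨j, rfl⟩ : ∃ j, k = j + 2 := ⟨k - 2, by simp at hk; omega⟩
    rw [pow_add]
    simp [pow_two, h]

/-- On an extension of `ℝ` by an abelian ideal on which the action has no nilpotent part, continuous
`Ad`-invariant quasi-states are characters. -/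
theorem exists_character_of_adInvariant {τ : 𝔤 →ₗ[ℝ] ℝ} {T : 𝔤} (hT : τ T = 1)
    (hτ : ∀ x, τ ⁅T, x⁆ = 0) (hbr : ∀ X Y : 𝔤, ⁅X, Y⁆ = τ X • ⁅T, Y⁆ - τ Y • ⁅T, X⁆)
    (hA : ∀ w : 𝔤, ⁅T, ⁅T, w⁆⁆ = 0 → ⁅T, w⁆ = 0) {ζ : 𝔤 → ℝ}
    (hζ : ζ ∈ continuousAdInvariantQuasiStates 𝔤) :
    ∃ χ : 𝔤 →ₗ[ℝ] ℝ, (∀ x, χ ⁅T, x⁆ = 0) ∧ ζ = χ := by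
  obtain ⟨hq, hc, hinv⟩ := hζ
  have inv1 : ∀ x w : 𝔤, τ x ≠ 0 → ζ (x + ⁅T, w⁆) = ζ x := by
    intro x w hx
    -- Removing the `T`-component of `w` puts `v` in the abelian ideal `ker τ`, where `[v, x] =
    -- -τ(x)[T, v]`; the scalar makes this `[T, w]`. Then `[v, [v, x]] = 0`, so `exp (ad v) x = x +
    -- [T, w]`.
    set v := (-(τ x)⁻¹) • (w - τ w • T) with hv
    have hτv : τ v = 0 := by simp [hv, hT]
    have hTv : ⁅T, v⁆ = (-(τ x)⁻¹) • ⁅T, w⁆ := by simp [hv]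
    have hvx : ⁅v, x⁆ = ⁅T, w⁆ := by
      rw [hbr, hτv, hTv, zero_smul, zero_sub, smul_smul, mul_neg, mul_inv_cancel₀ hx, neg_smul,
        one_smul, neg_neg]
    have h2 : ⁅v, ⁅v, x⁆⁆ = 0 := by
      rw [hvx, hbr, hτv, hτ]; simp
    rw [← hvx, ← expAd_of_step_two h2, hinv]
  have inv : ∀ x w : 𝔤, ζ (x + ⁅T, w⁆) = ζ x := by
    intro x w
    by_cases hx : τ x = 0
    -- When `τ x = 0`, perturb `x` to `x + s T` with `s ≠ 0` and let `s → 0`; this is where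
    -- continuity is used.
    · have t1 : Tendsto (fun s : ℝ => ζ (x + s • T + ⁅T, w⁆)) (𝓝[≠] 0) (𝓝 (ζ (x + ⁅T, w⁆))) := by
        have : Continuous fun s : ℝ => ζ (x + s • T + ⁅T, w⁆) := by fun_prop
        simpa using (this.tendsto 0).mono_left nhdsWithin_le_nhds
      have t2 : Tendsto (fun s : ℝ => ζ (x + s • T)) (𝓝[≠] 0) (𝓝 (ζ x)) := by
        have : Continuous fun s : ℝ => ζ (x + s • T) := by fun_prop
        simpa using (this.tendsto 0).mono_left nhdsWithin_le_nhds
      refine tendsto_nhds_unique t1 (t2.congr' ?_)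
      filter_upwards [self_mem_nhdsWithin] with s hs
      exact (inv1 _ _ (by simpa [hx, hT] using hs)).symm
    · exact inv1 x w hx
  let A : 𝔤 →ₗ[ℝ] 𝔤 := (LieAlgebra.ad ℝ 𝔤 T : 𝔤 →ₗ[ℝ] 𝔤)
  have hker : LinearMap.ker (A ∘ₗ A) = LinearMap.ker A := by
    ext w
    exact ⟨fun h => hA w h, fun h => by
      have h' : ⁅T, w⁆ = 0 := h
      change ⁅T, ⁅T, w⁆⁆ = 0
      rw [h', lie_zero]⟩
  have hrange : LinearMap.range (A ∘ₗ A) = LinearMap.range A := by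
    refine Submodule.eq_of_le_of_finrank_eq (LinearMap.range_comp_le_range _ _) ?_
    have h1 := LinearMap.finrank_range_add_finrank_ker (A ∘ₗ A)
    have h2 := LinearMap.finrank_range_add_finrank_ker A
    rw [hker] at h1
    omega
  -- Since `ad T` and its square have the same kernel, they have the same range, whence `𝔤 = ker (ad
  -- T) + range (ad T)`.
  have hdec : ∀ x : 𝔤, ∃ k w : 𝔤, ⁅T, k⁆ = 0 ∧ x = k + ⁅T, w⁆ := by
    intro x
    have hx : A x ∈ LinearMap.range (A ∘ₗ A) := by rw [hrange]; exact ⟨x, rfl⟩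
    obtain ⟨w, hw⟩ := hx
    have hw' : ⁅T, ⁅T, w⁆⁆ = ⁅T, x⁆ := hw
    exact ⟨x - ⁅T, w⁆, w, by rw [lie_sub, hw', sub_self], by abel⟩
  -- By `inv` only the components in `ker (ad T)` matter, and any two elements of that kernel
  -- commute by `hbr`.
  have hadd : ∀ x y, ζ (x + y) = ζ x + ζ y := by
    intro x y
    obtain ⟨k, w, hk, rfl⟩ := hdec x
    obtain ⟨k', w', hk', rfl⟩ := hdec y
    rw [show k + ⁅T, w⁆ + (k' + ⁅T, w'⁆) = k + k' + ⁅T, w + w'⁆ by rw [lie_add]; abel,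
      inv, inv, inv, hq.map_add_of_lie_eq_zero]
    rw [hbr, hk, hk']; simp
  refine ⟨{ toFun := ζ, map_add' := hadd, map_smul' := fun c x => hq.map_smul' c x }, fun x => ?_,
    rfl⟩
  have h0 := inv 0 x
  rw [zero_add] at h0
  have h1 := hq.map_smul' 0 (0 : 𝔤)
  rw [zero_smul, zero_mul] at h1
  exact h0.trans h1

end AdInvariant

/-! ### The Heisenberg algebra: recognition and failure of rigidity. -/

section Heisenberg

attribute [local instance] LieRing.ofAssociativeRing

lemma heisenberg_bracket (A B : heisenbergAlgebra) :
    (⁅A, B⁆ : heisenbergAlgebra).1 =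
      !![0, 0, A.1 0 1 * B.1 1 2 - B.1 0 1 * A.1 1 2; 0, 0, 0; 0, 0, 0] := by
  have hA := A.2
  have hB := B.2
  rw [LieSubalgebra.coe_bracket, Ring.lie_def]
  ext i j
  fin_cases i <;> fin_cases j <;>
    simp [Matrix.mul_apply, Fin.sum_univ_three, hA 0 0 le_rfl, hA 1 1 le_rfl, hA 2 2 le_rfl,
      hA 1 0 (by decide), hA 2 0 (by decide), hA 2 1 (by decide), hB 0 0 le_rfl, hB 1 1 le_rfl,
      hB 2 2 le_rfl, hB 1 0 (by decide), hB 2 0 (by decide), hB 2 1 (by decide)]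

/-- The element of the Heisenberg algebra with given entries. -/
def heisenbergMk (a b c : ℝ) : heisenbergAlgebra :=
  ⟨!![0, a, c; 0, 0, b; 0, 0, 0], by
    intro i j hij
    fin_cases i <;> fin_cases j <;> first | rfl | (exact absurd hij (by decide))⟩

lemma heisenbergMk_entries (A : heisenbergAlgebra) :
    heisenbergMk (A.1 0 1) (A.1 1 2) (A.1 0 2) = A := by
  have hA := A.2
  refine Subtype.ext ?_
  ext i j
  fin_cases i <;> fin_cases j <;>
    simp [heisenbergMk, hA 0 0 le_rfl, hA 1 1 le_rfl, hA 2 2 le_rfl,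
      hA 1 0 (by decide), hA 2 0 (by decide), hA 2 1 (by decide)]

variable {𝔤 : Type*} [LieRing 𝔤] [LieAlgebra ℝ 𝔤] [FiniteDimensional ℝ 𝔤]

/-- A Lie algebra of dimension at most three with a nilpotent Jordan block is the Heisenberg
algebra. -/
theorem nonempty_lieEquiv_heisenberg (hdim : Module.finrank ℝ 𝔤 ≤ 3) {T w v : 𝔤}
    (h1 : ⁅T, w⁆ = v) (h2 : ⁅T, v⁆ = 0) (h3 : ⁅w, v⁆ = 0) (hv : v ≠ 0) :
    Nonempty (𝔤 ≃ₗ⁅ℝ⁆ heisenbergAlgebra) := by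
  have h1' : ⁅w, T⁆ = -v := by rw [← lie_skew, h1]
  have h2' : ⁅v, T⁆ = 0 := by rw [← lie_skew, h2, neg_zero]
  have h3' : ⁅v, w⁆ = 0 := by rw [← lie_skew, h3, neg_zero]
  obtain ⟨B, rfl, rfl, rfl⟩ := exists_basis_of_three hdim (x := T) (y := w) (z := v) (by
    intro a b c h
    -- On the combination `a T + b w + c v`, bracketing with `T` leaves `b v` and bracketing with
    -- `w` leaves `-a v`.
    have e1 := congrArg (fun x => ⁅T, x⁆) h
    have e2 := congrArg (fun x => ⁅w, x⁆) h
    simp only [lie_add, lie_smul, lie_self, h1, h2, h3, h1', lie_zero, smul_zero, zero_add,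
      add_zero, smul_neg, neg_eq_zero, smul_eq_zero, hv, or_false] at e1 e2
    subst e1 e2
    simpa [hv] using h)
  have hlie : ∀ x y : 𝔤, ⁅x, y⁆ =
      (B.repr x 0 * B.repr y 1 - B.repr y 0 * B.repr x 1) • B 2 := by
    intro x y
    conv_lhs => rw [B.eq_add_three x, B.eq_add_three y]
    simp only [lie_add, add_lie, lie_smul, smul_lie, lie_self, h1, h2, h3, h1', h2', h3',
      smul_zero, add_zero, zero_add, smul_neg, smul_smul]
    rw [← neg_smul, ← add_smul]
    congr 1
    ring
  refine ⟨{ toFun := fun x => heisenbergMk (B.repr x 0) (B.repr x 1) (B.repr x 2)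
            map_add' := ?_, map_smul' := ?_, map_lie' := ?_
            invFun := fun A => A.1 0 1 • B 0 + A.1 1 2 • B 1 + A.1 0 2 • B 2
            left_inv := ?_, right_inv := ?_ }⟩
  · intro x y
    refine Subtype.ext ?_
    ext i j
    fin_cases i <;> fin_cases j <;> simp [heisenbergMk]
  · intro c x
    refine Subtype.ext ?_
    ext i j
    fin_cases i <;> fin_cases j <;> simp [heisenbergMk]
  · intro x y
    refine Subtype.ext ?_
    rw [heisenberg_bracket]
    ext i j
    fin_cases i <;> fin_cases j <;> simp [heisenbergMk, hlie]
  · intro x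
    exact (B.eq_add_three x).symm
  · intro A
    conv_rhs => rw [← heisenbergMk_entries A]
    simp [heisenbergMk]

variable [TopologicalSpace 𝔤] [IsTopologicalAddGroup 𝔤] [ContinuousSMul ℝ 𝔤] [T2Space 𝔤]

/-- A continuous, odd, homogeneous and non-additive function of two real variables. -/
def oddClamp (p q : ℝ) : ℝ := abs (q + abs p) - abs (q - abs p)

/-- For negative `c` the two absolute values change places, which turns the factor `|c|` into `c`.
-/
lemma oddClamp_mul (c p q : ℝ) : oddClamp (c * p) (c * q) = c * oddClamp p q := by
  simp only [oddClamp, abs_mul]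
  rcases le_total 0 c with h | h
  · rw [abs_of_nonneg h, ← mul_add, ← mul_sub, abs_mul, abs_mul, abs_of_nonneg h]; ring
  · rw [abs_of_nonpos h, show c * q + -c * |p| = c * (q - |p|) by ring,
      show c * q - -c * |p| = c * (q + |p|) by ring, abs_mul, abs_mul, abs_of_nonpos h]; ring

/-- The Heisenberg algebra is not rigid. -/
theorem not_isQuasiStateRigid_of_heisenberg (ι : 𝔤 ≃ₗ⁅ℝ⁆ heisenbergAlgebra) :
    ¬ IsQuasiStateRigid 𝔤 := by
  let p : 𝔤 →ₗ[ℝ] ℝ :=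
    { toFun := fun X => (ι X).1 0 1, map_add' := by simp, map_smul' := by simp }
  let q : 𝔤 →ₗ[ℝ] ℝ :=
    { toFun := fun X => (ι X).1 1 2, map_add' := by simp, map_smul' := by simp }
  have hp : ∀ X Y : 𝔤, p ⁅X, Y⁆ = 0 := by
    intro X Y
    change (ι ⁅X, Y⁆).1 0 1 = 0
    rw [LieEquiv.map_lie, heisenberg_bracket]; rfl
  have hq : ∀ X Y : 𝔤, q ⁅X, Y⁆ = 0 := by
    intro X Y
    change (ι ⁅X, Y⁆).1 1 2 = 0
    rw [LieEquiv.map_lie, heisenberg_bracket]; rfl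
  have hcomm : ∀ X Y : 𝔤, ⁅X, Y⁆ = 0 ↔ p X * q Y - p Y * q X = 0 := by
    intro X Y
    rw [← map_eq_zero_iff ι ι.injective, LieEquiv.map_lie, ← Subtype.coe_inj, heisenberg_bracket]
    constructor
    · intro h
      exact congrFun (congrFun h 0) 2
    · intro h
      ext i j
      fin_cases i <;> fin_cases j <;> first | rfl | exact h
  have hstep : ∀ X Y Z : 𝔤, ⁅Z, ⁅X, Y⁆⁆ = 0 := by
    intro X Y Z
    rw [hcomm, hp, hq]; ring
  intro hrig
  -- `oddClamp p q` is twice `q` clamped to `[-|p|, |p|]`. Commuting elements have proportional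
  -- coordinates `(p, q)`, so homogeneity alone makes this a quasi-state.
  let ζ : 𝔤 → ℝ := fun X => oddClamp (p X) (q X)
  have hpc : Continuous p := LinearMap.continuous_of_finiteDimensional p
  have hqc : Continuous q := LinearMap.continuous_of_finiteDimensional q
  have hmem : ζ ∈ continuousAdInvariantQuasiStates 𝔤 := by
    refine ⟨fun X Y hXY a b => ?_, ?_, fun X Y => ?_⟩
    · rw [hcomm] at hXY
      simp only [ζ, map_add, map_smul, smul_eq_mul]
      by_cases h0 : p X = 0 ∧ q X = 0
      · rw [h0.1, h0.2, mul_zero, zero_add, zero_add, oddClamp_mul]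
        simp [oddClamp]
      · obtain ⟨c, hc1, hc2⟩ : ∃ c, p Y = c * p X ∧ q Y = c * q X := by
          by_cases hpX : p X = 0
          · have hqX : q X ≠ 0 := fun h => h0 ⟨hpX, h⟩
            refine ⟨q Y / q X, ?_, by field_simp⟩
            rw [hpX] at hXY ⊢
            have : p Y * q X = 0 := by linarith
            rcases mul_eq_zero.1 this with h | h
            · rw [h, mul_zero]
            · exact absurd h hqX
          · refine ⟨p Y / p X, by field_simp, ?_⟩
            field_simp
            linarith
        rw [hc1, hc2, show a * p X + b * (c * p X) = (a + b * c) * p X by ring,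
          show a * q X + b * (c * q X) = (a + b * c) * q X by ring, oddClamp_mul, oddClamp_mul]
        ring
    · simp only [ζ, oddClamp]
      fun_prop
    · simp only [ζ]
      rw [expAd_of_step_two (hstep _ _ _), map_add, map_add, hp, hq, add_zero, add_zero]
  rw [← hrig] at hmem
  let X₀ := ι.symm (heisenbergMk 1 0 0)
  let Y₀ := ι.symm (heisenbergMk 0 1 0)
  have hX : p X₀ = 1 ∧ q X₀ = 0 := by
    simp only [p, q, X₀, LinearMap.coe_mk, AddHom.coe_mk, LieEquiv.apply_symm_apply]
    exact ⟨rfl, rfl⟩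
  have hY : p Y₀ = 0 ∧ q Y₀ = 1 := by
    simp only [p, q, Y₀, LinearMap.coe_mk, AddHom.coe_mk, LieEquiv.apply_symm_apply]
    exact ⟨rfl, rfl⟩
  -- Additivity would give `oddClamp 1 1 = oddClamp 1 0 + oddClamp 0 1`, that is, `2 = 0`.
  have h := map_add_of_quasimorphism hmem.2.2 (X := X₀) (Y := Y₀)
    (fun W => by rw [← lie_skew, hstep, neg_zero])
    (by simp only [ζ]; rw [hp, hq]; simp [oddClamp])
  simp only [ζ, map_add, hX, hY] at h
  norm_num [oddClamp] at h

end Heisenberg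

/-! ### Invariant homogeneous functions on `𝔰𝔲(2)` and `𝔰𝔩(2, ℝ)`. -/

section SimpleOfDimensionThree

variable {𝔤 : Type*} [LieRing 𝔤] [LieAlgebra ℝ 𝔤] [FiniteDimensional ℝ 𝔤]
    [TopologicalSpace 𝔤] [IsTopologicalAddGroup 𝔤] [ContinuousSMul ℝ 𝔤] [T2Space 𝔤]

lemma ad_pow_succ_apply {𝔤 : Type*} [LieRing 𝔤] [LieAlgebra ℝ 𝔤] (T P : 𝔤) (k : ℕ) :
    ((LieAlgebra.ad ℝ 𝔤 T) ^ (k + 1)) P = ⁅T, ((LieAlgebra.ad ℝ 𝔤 T) ^ k) P⁆ := by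
  rw [pow_succ']; rfl

lemma expAd_add (T P Q : 𝔤) : expAd T (P + Q) = expAd T P + expAd T Q := by
  refine (hasSum_expAd T (P + Q)).unique ?_
  simpa [smul_add] using (hasSum_expAd T P).add (hasSum_expAd T Q)

lemma expAd_smul (T : 𝔤) (c : ℝ) (P : 𝔤) : expAd T (c • P) = c • expAd T P := by
  refine (hasSum_expAd T (c • P)).unique ?_
  refine ((hasSum_expAd T P).const_smul c).congr_fun ?_
  intro k
  rw [map_smul, smul_comm]

lemma expAd_of_eigenvector {T P : 𝔤} {μ : ℝ} (h : ⁅T, P⁆ = μ • P) :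
    expAd T P = Real.exp μ • P := by
  refine (hasSum_expAd T P).unique ?_
  have h1 := (NormedSpace.expSeries_div_hasSum_exp μ).smul_const P
  rw [← Real.exp_eq_exp_ℝ] at h1
  refine h1.congr_fun ?_
  intro k
  have hk : ((LieAlgebra.ad ℝ 𝔤 T) ^ k) P = μ ^ k • P := by
    induction k with
    | zero => simp
    | succ k ih => rw [ad_pow_succ_apply, ih, lie_smul, h, smul_smul, pow_succ]
  rw [hk, smul_smul, div_eq_inv_mul]

lemma expAd_of_lie_eq_zero {T P : 𝔤} (h : ⁅T, P⁆ = 0) : expAd T P = P := by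
  simpa using expAd_of_eigenvector (T := T) (P := P) (μ := 0) (by simpa using h)

/-- On the plane of `P` and `Q` the square of `ad T` is `-1`, so the even terms sum to the cosine
and the odd ones to the sine. -/
lemma expAd_rotation {T P Q : 𝔤} (hP : ⁅T, P⁆ = Q) (hQ : ⁅T, Q⁆ = -P) (θ : ℝ) :
    expAd (θ • T) P = Real.cos θ • P + Real.sin θ • Q := by
  refine (hasSum_expAd (θ • T) P).unique ?_
  have hk : ∀ k, ((LieAlgebra.ad ℝ 𝔤 (θ • T)) ^ (2 * k)) P = ((-1) ^ k * θ ^ (2 * k)) • P := by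
    intro k
    induction k with
    | zero => simp
    | succ k ih =>
      rw [show 2 * (k + 1) = 2 * k + 1 + 1 by ring, ad_pow_succ_apply, ad_pow_succ_apply, ih]
      simp only [smul_lie, hP, hQ, lie_smul, smul_neg, ← neg_smul, smul_smul]
      congr 1; ring
  refine HasSum.even_add_odd ?_ ?_
  · refine ((Real.hasSum_cos θ).smul_const P).congr_fun ?_
    intro k
    rw [hk, smul_smul, div_eq_inv_mul]
  · refine ((Real.hasSum_sin θ).smul_const Q).congr_fun ?_
    intro k
    rw [ad_pow_succ_apply, hk, lie_smul, smul_lie, hP, smul_smul, smul_smul]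
    congr 1; ring

variable {ζ : 𝔤 → ℝ} {J X Y : 𝔤}

/-- An invariant function is determined by its values on the plane spanned by the generator of
rotations and one further vector. -/
lemma IsAdInvariant.exists_polar (hζ : IsAdInvariant ζ) (hJX : ⁅J, X⁆ = Y) (hJY : ⁅J, Y⁆ = -X)
    (a b c : ℝ) : ∃ r : ℝ, ζ (a • J + b • X + c • Y) = ζ (a • J + r • X) := by
  refine ⟨‖(⟨b, c⟩ : ℂ)‖, ?_⟩
  rw [← hζ (Complex.arg ⟨b, c⟩ • J) (a • J + ‖(⟨b, c⟩ : ℂ)‖ • X), expAd_add, expAd_smul, expAd_smul,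
    expAd_rotation hJX hJY, expAd_of_lie_eq_zero (by simp), smul_add, smul_smul, smul_smul,
    Complex.norm_mul_cos_arg, Complex.norm_mul_sin_arg, add_assoc]

/-- On `𝔰𝔲(2)` invariant homogeneous functions vanish. -/
theorem eq_zero_of_adInvariant_compact (hζ : IsAdInvariant ζ) (hs : ∀ (c : ℝ) Z, ζ (c • Z) = c * ζ Z)
    (hJX : ⁅J, X⁆ = Y) (hJY : ⁅J, Y⁆ = -X) (hXY : ⁅X, Y⁆ = J) (a b c : ℝ) :
    ζ (a • J + b • X + c • Y) = 0 := by
  obtain ⟨r, hr⟩ := hζ.exists_polar hJX hJY a b c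
  have hYJ : ⁅Y, J⁆ = X := by rw [← lie_skew, hJY, neg_neg]
  have hYX : ⁅Y, X⁆ = -J := by rw [← lie_skew, hXY]
  have hXJ : ⁅X, J⁆ = -Y := by rw [← lie_skew, hJX]
  -- Rotation by `π` about `X` sends `J` to `-J`.
  have hJ : ζ J = 0 := by
    have h := hζ (Real.pi • X) J
    rw [expAd_rotation hXJ (by rw [lie_neg, hXY]), Real.cos_pi, Real.sin_pi, zero_smul, add_zero,
      hs] at h
    linarith
  -- A rotation about `Y` carries a multiple of `J` to `a J + r X`.
  have h := hζ (Complex.arg ⟨a, r⟩ • Y) (‖(⟨a, r⟩ : ℂ)‖ • J)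
  rw [expAd_smul, expAd_rotation hYJ hYX, smul_add, smul_smul, smul_smul,
    Complex.norm_mul_cos_arg, Complex.norm_mul_sin_arg, hs, hJ, mul_zero] at h
  rw [hr, h]

/-- On `𝔰𝔩(2, ℝ)` invariant homogeneous functions are determined by their value on a generator of
rotations. -/
theorem eq_zero_of_adInvariant_split (hζ : IsAdInvariant ζ) (hs : ∀ (c : ℝ) Z, ζ (c • Z) = c * ζ Z)
    (hJX : ⁅J, X⁆ = Y) (hJY : ⁅J, Y⁆ = -X) (hXY : ⁅X, Y⁆ = -J) (hJ : ζ J = 0) (a b c : ℝ) :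
    ζ (a • J + b • X + c • Y) = 0 := by
  obtain ⟨r, hr⟩ := hζ.exists_polar hJX hJY a b c
  have hYJ : ⁅Y, J⁆ = X := by rw [← lie_skew, hJY, neg_neg]
  have hYX : ⁅Y, X⁆ = J := by rw [← lie_skew, hXY, neg_neg]
  have hX : ζ X = 0 := by
    have h := hζ (Real.pi • J) X
    rw [expAd_rotation hJX hJY, Real.cos_pi, Real.sin_pi, zero_smul, add_zero, hs] at h
    linarith
  -- `J ± X` are the nilpotent directions: eigenvectors of `ad Y` for `±1`. Invariance with
  -- homogeneity makes `ζ` vanish on anything rescaled by a factor other than `1`.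
  have hP : ∀ t : ℝ, expAd (t • Y) (J + X) = Real.exp t • (J + X) := fun t =>
    expAd_of_eigenvector (by rw [smul_lie, lie_add, hYJ, hYX, add_comm])
  have hM : ∀ t : ℝ, expAd (t • Y) (J - X) = Real.exp (-t) • (J - X) := fun t =>
    expAd_of_eigenvector (by rw [smul_lie, lie_sub, hYJ, hYX, neg_smul, ← smul_neg, neg_sub])
  have hexp : 1 < Real.exp 1 := Real.one_lt_exp_iff.2 one_pos
  have hP0 : ζ (J + X) = 0 := by
    have h := hζ ((1 : ℝ) • Y) (J + X)
    rw [hP, hs] at h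
    exact (mul_eq_zero.1 (show (Real.exp 1 - 1) * ζ (J + X) = 0 by linarith)).resolve_left
      (by linarith)
  have hM0 : ζ (J - X) = 0 := by
    have h := hζ ((-1 : ℝ) • Y) (J - X)
    rw [hM, hs, neg_neg] at h
    exact (mul_eq_zero.1 (show (Real.exp 1 - 1) * ζ (J - X) = 0 by linarith)).resolve_left
      (by linarith)
  have key : ∀ p m : ℝ, ζ (p • (J + X) + m • (J - X)) = 0 := by
    intro p m
    by_cases hp : p = 0
    · rw [hp, zero_smul, zero_add, hs, hM0, mul_zero]
    by_cases hm : m = 0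
    · rw [hm, zero_smul, add_zero, hs, hP0, mul_zero]
    have hpos : 0 < |m / p| := abs_pos.2 (div_ne_zero hm hp)
    -- This `t` equalises `|p| e^t` and `|m| e^{-t}`, so the boost moves the vector to a multiple of
    -- `J` or of `X`, according to the sign of `m / p`.
    set t := Real.log |m / p| / 2 with ht
    have h2 : Real.exp t = |m / p| * Real.exp (-t) := by
      conv_rhs => rw [← Real.exp_log hpos, ← Real.exp_add]
      congr 1; rw [ht]; ring
    rw [← hζ (t • Y), expAd_add, expAd_smul, expAd_smul, hP, hM, h2]
    rcases abs_choice (m / p) with h | h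
    · rw [h, show p • (m / p * Real.exp (-t)) • (J + X) + m • Real.exp (-t) • (J - X) =
        (2 * m * Real.exp (-t)) • J by
          rw [smul_smul, show p * (m / p * Real.exp (-t)) = m * Real.exp (-t) by field_simp]
          module, hs, hJ, mul_zero]
    · rw [h, show p • (-(m / p) * Real.exp (-t)) • (J + X) + m • Real.exp (-t) • (J - X) =
        (-2 * m * Real.exp (-t)) • X by
          rw [smul_smul, show p * (-(m / p) * Real.exp (-t)) = -m * Real.exp (-t) by field_simp]
          module, hs, hX, mul_zero]
  rw [hr, show a • J + r • X = ((a + r) / 2) • (J + X) + ((a - r) / 2) • (J - X) by module, key]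

end SimpleOfDimensionThree

/-! ### Structure of non-perfect Lie algebras of dimension at most three. -/

section NonPerfect

variable {𝔤 : Type*} [LieRing 𝔤] [LieAlgebra ℝ 𝔤] [FiniteDimensional ℝ 𝔤]

lemma exists_basis_of_lie_ne_zero (hdim : Module.finrank ℝ 𝔤 ≤ 3) {τ : 𝔤 →ₗ[ℝ] ℝ} {T x y : 𝔤}
    (hT : τ T = 1) (hx : τ x = 0) (hy : τ y = 0) (hxy : ⁅x, y⁆ ≠ 0) :
    ∃ b : Module.Basis (Fin 3) ℝ 𝔤, b 0 = T ∧ b 1 = x ∧ b 2 = y := by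
  have hyx : ⁅y, x⁆ ≠ 0 := by rwa [← lie_skew, neg_ne_zero]
  refine exists_basis_of_three hdim fun a b c h => ?_
  have ha : a = 0 := by simpa [hT, hx, hy] using congrArg τ h
  subst ha
  rw [zero_smul, zero_add] at h
  exact ⟨rfl, by simpa [hyx] using congrArg (fun v => ⁅y, v⁆) h,
    by simpa [hxy] using congrArg (fun v => ⁅x, v⁆) h⟩

/-- A Lie algebra of dimension at most three which is not perfect is an extension of `ℝ` by an
abelian ideal. -/
theorem exists_abelian_of_not_perfect (hdim : Module.finrank ℝ 𝔤 ≤ 3) {τ : 𝔤 →ₗ[ℝ] ℝ}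
    (hτ0 : τ ≠ 0) (hτ : ∀ x y : 𝔤, τ ⁅x, y⁆ = 0) :
    ∃ (T : 𝔤) (σ : 𝔤 →ₗ[ℝ] ℝ), σ T = 1 ∧ (∀ x, σ ⁅T, x⁆ = 0) ∧
      ∀ X Y : 𝔤, ⁅X, Y⁆ = σ X • ⁅T, Y⁆ - σ Y • ⁅T, X⁆ := by
  obtain ⟨T, hT⟩ : ∃ T, τ T = 1 := by
    obtain ⟨v, hv⟩ := DFunLike.ne_iff.1 hτ0
    exact ⟨(τ v)⁻¹ • v, by simpa using inv_mul_cancel₀ hv⟩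
  by_cases hab : ∀ x y : 𝔤, τ x = 0 → τ y = 0 → ⁅x, y⁆ = 0
  · refine ⟨T, τ, hT, fun x => hτ T x, fun X Y => ?_⟩
    -- If `ker τ` is abelian, the bracket formula says that the projections of `X` and `Y` to `ker
    -- τ` along `T` commute.
    have h := hab (X - τ X • T) (Y - τ Y • T) (by simp [hT]) (by simp [hT])
    simp only [lie_sub, sub_lie, lie_smul, smul_lie, lie_self, smul_zero, sub_zero] at h
    rw [← lie_skew X T] at h
    rw [← sub_eq_zero, ← h]
    module
  push Not at hab
  obtain ⟨x, y, hx, hy, hz0⟩ := hab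
  -- Otherwise `ker τ` is the nonabelian plane. Writing `[x,y] = p x + q y`, the vector `[x,y]` is
  -- an eigenvector of `ad x` for `q` and of `ad y` for `-p`, and one of these is nonzero.
  obtain ⟨h, z, hh, hz, hhz, hz0⟩ : ∃ h z : 𝔤, τ h = 0 ∧ τ z = 0 ∧ ⁅h, z⁆ = z ∧ z ≠ 0 := by
    obtain ⟨B, hB0, hB1, hB2⟩ := exists_basis_of_lie_ne_zero hdim hT hx hy hz0
    have e := B.eq_add_three ⁅x, y⁆
    rw [hB0, hB1, hB2] at e
    set p := B.repr ⁅x, y⁆ 1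
    set q := B.repr ⁅x, y⁆ 2
    have h0 : B.repr ⁅x, y⁆ 0 = 0 := by simpa [hT, hx, hy, hτ] using (congrArg τ e).symm
    rw [h0, zero_smul, zero_add] at e
    have e1 : ⁅x, ⁅x, y⁆⁆ = q • ⁅x, y⁆ := by
      conv_lhs => rw [e]
      simp
    have e2 : ⁅y, ⁅x, y⁆⁆ = (-p) • ⁅x, y⁆ := by
      conv_lhs => rw [e]
      rw [lie_add, lie_smul, lie_smul, lie_self, ← lie_skew x y]
      module
    by_cases hq : q = 0
    · have hp : p ≠ 0 := fun hp => hz0 (by rw [e, hp, hq]; simp)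
      refine ⟨(-p)⁻¹ • y, ⁅x, y⁆, by simp [hy], hτ _ _, ?_, hz0⟩
      rw [smul_lie, e2, smul_smul, inv_mul_cancel₀ (neg_ne_zero.2 hp), one_smul]
    · refine ⟨q⁻¹ • x, ⁅x, y⁆, by simp [hx], hτ _ _, ?_, hz0⟩
      rw [smul_lie, e1, smul_smul, inv_mul_cancel₀ hq, one_smul]
  have hzh : ⁅z, h⁆ = -z := by rw [← lie_skew, hhz]
  obtain ⟨B, hB0, hB1, hB2⟩ := exists_basis_of_lie_ne_zero hdim hT hh hz (by rwa [hhz])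
  obtain ⟨α, β, hα⟩ : ∃ α β : ℝ, ⁅T, h⁆ = α • h + β • z := by
    have e := B.eq_add_three ⁅T, h⁆
    rw [hB0, hB1, hB2] at e
    have h0 : B.repr ⁅T, h⁆ 0 = 0 := by simpa [hT, hh, hz, hτ] using (congrArg τ e).symm
    rw [h0, zero_smul, zero_add] at e
    exact ⟨_, _, e⟩
  obtain ⟨γ, δ, hγ⟩ : ∃ γ δ : ℝ, ⁅T, z⁆ = γ • h + δ • z := by
    have e := B.eq_add_three ⁅T, z⁆
    rw [hB0, hB1, hB2] at e
    have h0 : B.repr ⁅T, z⁆ 0 = 0 := by simpa [hT, hh, hz, hτ] using (congrArg τ e).symm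
    rw [h0, zero_smul, zero_add] at e
    exact ⟨_, _, e⟩
  -- The Leibniz rule for `[T, [h, z]] = [T, z]` forces `γ = α = 0`.
  have hJ : γ • h + δ • z = (α + δ) • z := by
    have := leibniz_lie T h z
    rw [hhz, hα, hγ] at this
    simp only [add_lie, lie_add, smul_lie, lie_smul, lie_self, hhz] at this
    rw [this]; module
  have hγ0 : γ = 0 := by
    have := congrArg (fun v => ⁅z, v⁆) hJ
    simpa [hzh, hz0] using this
  have hα0 : α = 0 := by
    rw [hγ0, zero_smul, zero_add, add_smul, right_eq_add, smul_eq_zero] at hJ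
    exact hJ.resolve_right hz0
  subst hγ0 hα0
  rw [zero_smul, zero_add] at hα hγ
  -- All derivations of the nonabelian plane are inner, so `T` can be corrected to `T'` centralising
  -- it. The abelian ideal is then spanned by `T'` and `z`, and `h` acts on it; the new form is the
  -- `h`-coordinate.
  set T' := T + β • z - δ • h with hT'
  have h1 : ⁅T', h⁆ = 0 := by
    rw [hT', sub_lie, add_lie, smul_lie, smul_lie, lie_self, hα, hzh]; module
  have h2 : ⁅T', z⁆ = 0 := by
    rw [hT', sub_lie, add_lie, smul_lie, smul_lie, lie_self, hγ, hhz]; module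
  have h1' : ⁅h, T'⁆ = 0 := by rw [← lie_skew, h1, neg_zero]
  have h2' : ⁅z, T'⁆ = 0 := by rw [← lie_skew, h2, neg_zero]
  obtain ⟨C, hC0, hC1, hC2⟩ := exists_basis_of_lie_ne_zero hdim (T := T') (τ := τ)
    (by simp [hT', hT, hz, hh]) hh hz (by rwa [hhz])
  have hlie : ∀ x, ⁅h, x⁆ = C.repr x 2 • z := by
    intro x
    conv_lhs => rw [C.eq_add_three x]
    simp [hC0, hC1, hC2, hhz, h1']
  refine ⟨h, C.coord 1, by simp [← hC1], fun x => ?_, fun x y => ?_⟩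
  · rw [hlie, ← hC2]; simp
  · rw [hlie, hlie]
    conv_lhs => rw [C.eq_add_three x, C.eq_add_three y]
    simp only [hC0, hC1, hC2, lie_add, add_lie, lie_smul, smul_lie, lie_self, hhz, hzh, h1, h2, h1',
      h2', Module.Basis.coord_apply]
    module

end NonPerfect

/-! ### Classification of nonabelian perfect Lie algebras of dimension at most three. -/

section Perfect

variable {𝔤 : Type*} [LieRing 𝔤] [LieAlgebra ℝ 𝔤]

lemma eq_zero_of_rotation {V : Type*} [AddCommGroup V] [Module ℝ V] {X Y : V} (hX : X ≠ 0)
    {b c : ℝ} (h1 : b • Y = c • X) (h2 : b • X = -(c • Y)) : b = 0 ∧ c = 0 := by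
  have h : (b ^ 2 + c ^ 2) • X = 0 := by
    calc (b ^ 2 + c ^ 2) • X = b • (b • X) + c • (c • X) := by module
      _ = 0 := by rw [h2, ← h1]; module
  have h0 := (smul_eq_zero.1 h).resolve_right hX
  exact ⟨by nlinarith, by nlinarith⟩

/-- Within the span of `J`, `X`, `Y`, the centraliser of `J` is its own line. This serves both for
independence and for locating `[X, Y]`. -/
lemma coeff_eq_zero_of_rotation {J X Y : 𝔤} (hJX : ⁅J, X⁆ = Y) (hJY : ⁅J, Y⁆ = -X) (hX : X ≠ 0)
    {a b c : ℝ} (h : ⁅J, a • J + b • X + c • Y⁆ = 0) : b = 0 ∧ c = 0 := by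
  simp only [lie_add, lie_smul, lie_self, hJX, hJY, smul_zero, zero_add] at h
  refine eq_zero_of_rotation hX (X := X) (Y := Y) ?_ ?_
  · rw [← sub_eq_zero, ← h]; module
  · have h' := congrArg (fun v => ⁅J, v⁆) h
    simp only [lie_add, lie_smul, hJX, hJY, lie_neg, lie_zero] at h'
    rw [← sub_eq_zero, ← neg_eq_zero, ← h']; module

/-- A Lie algebra is perfect if no nonzero linear form vanishes on all brackets. -/
def IsPerfectLie (𝔤 : Type*) [LieRing 𝔤] [LieAlgebra ℝ 𝔤] : Prop :=
  ∀ τ : 𝔤 →ₗ[ℝ] ℝ, (∀ x y : 𝔤, τ ⁅x, y⁆ = 0) → τ = 0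

variable [FiniteDimensional ℝ 𝔤]

/-- If `x` and `y` spanned, all brackets would be multiples of `[x,y]`; perfectness would make `𝔤` a
line, contradicting `[x,y] ≠ 0`. A third vector therefore exists. -/
lemma IsPerfectLie.finrank_eq_three (hp : IsPerfectLie 𝔤) (hdim : Module.finrank ℝ 𝔤 ≤ 3)
    {x y : 𝔤} (hxy : ⁅x, y⁆ ≠ 0) : Module.finrank ℝ 𝔤 = 3 := by
  have hyx : ⁅y, x⁆ ≠ 0 := by rwa [← lie_skew, neg_ne_zero]
  have hspan : Submodule.span ℝ {x, y} ≠ ⊤ := by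
    intro htop
    have hz : Submodule.span ℝ {⁅x, y⁆} = ⊤ := by
      by_contra hne
      obtain ⟨f, hf0, hf⟩ := Submodule.exists_le_ker_of_lt_top _ (lt_top_iff_ne_top.2 hne)
      refine hf0 (hp f fun u v => ?_)
      have hfz : f ⁅x, y⁆ = 0 := hf (Submodule.mem_span_singleton_self _)
      have hfz' : f ⁅y, x⁆ = 0 := by rw [← lie_skew, map_neg, hfz, neg_zero]
      obtain ⟨a, b, rfl⟩ := Submodule.mem_span_pair.1 (htop ▸ Submodule.mem_top : u ∈ _)
      obtain ⟨c, d, rfl⟩ := Submodule.mem_span_pair.1 (htop ▸ Submodule.mem_top : v ∈ _)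
      simp [hfz, hfz']
    obtain ⟨a, ha⟩ := Submodule.mem_span_singleton.1 (hz ▸ Submodule.mem_top : x ∈ _)
    obtain ⟨b, hb⟩ := Submodule.mem_span_singleton.1 (hz ▸ Submodule.mem_top : y ∈ _)
    generalize ⁅x, y⁆ = z at ha hb
    refine hxy ?_
    rw [← ha, ← hb]
    simp
  obtain ⟨w, -, hw⟩ := SetLike.exists_of_lt (lt_top_iff_ne_top.2 hspan)
  obtain ⟨B, -⟩ := exists_basis_of_three hdim (x := x) (y := y) (z := w) (by
    intro a b c h
    have hc : c = 0 := by
      by_contra hc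
      refine hw (Submodule.mem_span_pair.2 ⟨-(c⁻¹ * a), -(c⁻¹ * b), ?_⟩)
      have := congrArg (fun v => c⁻¹ • v) h
      simp only [smul_add, smul_smul, inv_mul_cancel₀ hc, one_smul, smul_zero] at this
      rw [← sub_eq_zero, ← neg_eq_zero, ← this]; module
    subst hc
    rw [zero_smul, add_zero] at h
    exact ⟨by simpa [hyx] using congrArg (fun v => ⁅y, v⁆) h,
      by simpa [hxy] using congrArg (fun v => ⁅x, v⁆) h, rfl⟩)
  simpa using Module.finrank_eq_card_basis B

/-- A perfect nonzero algebra is not nilpotent, so by Engel some `ad H` is not nilpotent. Its trace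
vanishes because `trace ∘ ad` kills brackets, and its determinant because `[H,H] = 0`. If also `c =
0`, Cayley-Hamilton would make `ad H` nilpotent. -/
lemma IsPerfectLie.exists_ad_cube (hp : IsPerfectLie 𝔤) (hdim : Module.finrank ℝ 𝔤 ≤ 3)
    {x y : 𝔤} (hxy : ⁅x, y⁆ ≠ 0) :
    ∃ (H : 𝔤) (c : ℝ), H ≠ 0 ∧ c ≠ 0 ∧
      (LieAlgebra.ad ℝ 𝔤 H).charpoly = Polynomial.X ^ 3 + Polynomial.C c * Polynomial.X := by
  have h3 := hp.finrank_eq_three hdim hxy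
  have hnt : Nontrivial 𝔤 := ⟨⟨_, _, hxy⟩⟩
  have hnil : ¬ LieRing.IsNilpotent 𝔤 := by
    intro hnil
    have hlt := LieAlgebra.derivedSeries_lt_top_of_solvable (R := ℝ) (L := 𝔤)
    have hlt' : (LieAlgebra.derivedSeries ℝ 𝔤 1).toSubmodule < ⊤ := by
      rw [lt_top_iff_ne_top] at hlt ⊢
      exact fun h => hlt ((LieSubmodule.toSubmodule_eq_top _).1 h)
    obtain ⟨f, hf0, hf⟩ := Submodule.exists_le_ker_of_lt_top _ hlt'
    refine hf0 (hp f fun u v => ?_)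
    refine hf ?_
    change ⁅u, v⁆ ∈ LieAlgebra.derivedSeries ℝ 𝔤 1
    rw [LieAlgebra.derivedSeries_def, LieAlgebra.derivedSeriesOfIdeal_succ,
      LieAlgebra.derivedSeriesOfIdeal_zero]
    exact LieSubmodule.lie_mem_lie trivial trivial
  rw [LieAlgebra.isNilpotent_iff_forall (R := ℝ)] at hnil
  push Not at hnil
  obtain ⟨H, hH⟩ := hnil
  set N : 𝔤 →ₗ[ℝ] 𝔤 := LieAlgebra.ad ℝ 𝔤 H with hN
  have hH0 : H ≠ 0 := by
    rintro rfl
    exact hH (by rw [hN, map_zero]; exact IsNilpotent.zero)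
  have htr : LinearMap.trace ℝ 𝔤 N = 0 := by
    have := hp ((LinearMap.trace ℝ 𝔤) ∘ₗ (LieAlgebra.ad ℝ 𝔤 : 𝔤 →ₗ[ℝ] Module.End ℝ 𝔤)) (by
      intro u v
      change LinearMap.trace ℝ 𝔤 (LieAlgebra.ad ℝ 𝔤 ⁅u, v⁆) = 0
      have had : LieAlgebra.ad ℝ 𝔤 ⁅u, v⁆ = LieAlgebra.ad ℝ 𝔤 u * LieAlgebra.ad ℝ 𝔤 v -
          LieAlgebra.ad ℝ 𝔤 v * LieAlgebra.ad ℝ 𝔤 u := LinearMap.ext fun w => lie_lie u v w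
      rw [had, map_sub, LinearMap.trace_mul_comm, sub_self])
    exact congrArg (fun f : 𝔤 →ₗ[ℝ] ℝ => f H) this
  have hdeg : N.charpoly.natDegree = 3 := by rw [LinearMap.charpoly_natDegree, h3]
  have hc3 : N.charpoly.coeff 3 = 1 := by
    have := N.charpoly_monic
    rwa [Polynomial.Monic, Polynomial.leadingCoeff, hdeg] at this
  have hc2 : N.charpoly.coeff 2 = 0 := by
    let b := Module.finBasis ℝ 𝔤
    have : Nonempty (Fin (Module.finrank ℝ 𝔤)) := ⟨⟨0, by omega⟩⟩
    have h := Matrix.trace_eq_neg_charpoly_coeff (LinearMap.toMatrix b b N)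
    rw [← LinearMap.trace_eq_matrix_trace, htr, LinearMap.charpoly_toMatrix, Fintype.card_fin, h3]
      at h
    simpa using h.symm
  have hc0 : N.charpoly.coeff 0 = 0 := by
    have hdet : LinearMap.det N = 0 := by
      rw [LinearMap.det_eq_zero_iff_ker_ne_bot]
      intro hbot
      exact hH0 ((Submodule.mem_bot ℝ).1 (hbot ▸ (LinearMap.mem_ker.2 (lie_self H))))
    rw [LinearMap.det_eq_sign_charpoly_coeff] at hdet
    simpa using hdet
  have hchar : N.charpoly =
      Polynomial.X ^ 3 + Polynomial.C (N.charpoly.coeff 1) * Polynomial.X := by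
    conv_lhs => rw [N.charpoly.as_sum_range_C_mul_X_pow, hdeg]
    simp [Finset.sum_range_succ, hc0, hc2, hc3]
    ring
  refine ⟨H, N.charpoly.coeff 1, hH0, fun h1 => hH ?_, hchar⟩
  have hCH := LinearMap.aeval_self_charpoly N
  rw [hchar, h1] at hCH
  exact ⟨3, by simpa using hCH⟩

-- With `κ = 0` no bracket would have a `B 0`-component, and the coordinate form of `B 0` would
-- contradict perfectness.
omit [FiniteDimensional ℝ 𝔤] in
lemma IsPerfectLie.coeff_ne_zero (hp : IsPerfectLie 𝔤) (B : Module.Basis (Fin 3) ℝ 𝔤)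
    {a b c d κ : ℝ} (h1 : ⁅B 0, B 1⁆ = a • B 1 + b • B 2) (h2 : ⁅B 0, B 2⁆ = c • B 1 + d • B 2)
    (h3 : ⁅B 1, B 2⁆ = κ • B 0) : κ ≠ 0 := by
  rintro rfl
  have h := hp (B.coord 0) (by
    intro x y
    rw [B.eq_add_three x, B.eq_add_three y]
    simp [← lie_skew (B 1) (B 0), ← lie_skew (B 2) (B 0), ← lie_skew (B 2) (B 1), h1, h2, h3])
  have := congrArg (fun f : 𝔤 →ₗ[ℝ] ℝ => f (B 0)) h
  simp at this

/-- A nonabelian perfect Lie algebra of dimension at most three is `𝔰𝔲(2)` or `𝔰𝔩(2, ℝ)`. -/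
theorem IsPerfectLie.exists_basis (hp : IsPerfectLie 𝔤) (hdim : Module.finrank ℝ 𝔤 ≤ 3)
    {x y : 𝔤} (hxy : ⁅x, y⁆ ≠ 0) :
    ∃ (B : Module.Basis (Fin 3) ℝ 𝔤) (ε : ℝ), (ε = 1 ∨ ε = -1) ∧ ⁅B 0, B 1⁆ = B 2 ∧
      ⁅B 0, B 2⁆ = -B 1 ∧ ⁅B 1, B 2⁆ = ε • B 0 := by
  obtain ⟨J, X, Y, ε, hε, hX, hJ, hJX, hJY, hXY⟩ : ∃ (J X Y : 𝔤) (ε : ℝ), (ε = 1 ∨ ε = -1) ∧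
      X ≠ 0 ∧ J ≠ 0 ∧ ⁅J, X⁆ = Y ∧ ⁅J, Y⁆ = -X ∧ ⁅X, Y⁆ = ε • J := by
    obtain ⟨H', c, hH', hc, hchar⟩ := hp.exists_ad_cube hdim hxy
    have hcube : ∀ v : 𝔤, ⁅H', ⁅H', ⁅H', v⁆⁆⁆ + c • ⁅H', v⁆ = 0 := by
      have hCH := LinearMap.aeval_self_charpoly (LieAlgebra.ad ℝ 𝔤 H')
      rw [hchar] at hCH
      intro v
      simpa [pow_succ] using congrArg (fun f : 𝔤 →ₗ[ℝ] 𝔤 => f v) hCH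
    have hsq : Real.sqrt |c| ≠ 0 := (Real.sqrt_pos.2 (abs_pos.2 hc)).ne'
    have hss : Real.sqrt |c| * Real.sqrt |c| = |c| := Real.mul_self_sqrt (abs_nonneg c)
    set s := Real.sqrt |c| with hs
    have hH0 : s⁻¹ • H' ≠ 0 := smul_ne_zero (inv_ne_zero hsq) hH'
    have hHH : H' = s • s⁻¹ • H' := by rw [smul_smul, mul_inv_cancel₀ hsq, one_smul]
    rcases lt_or_gt_of_ne hc with hneg | hpos
    -- For `c < 0` the nonzero roots of `t³ + c t` are real, namely `±s`; after rescaling, `ad H`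
    -- has eigenvectors `E` and `F` for `1` and `-1`.
    · have hroot : ∀ t : ℝ, t * t = -c → ∃ v : 𝔤, v ≠ 0 ∧ ⁅H', v⁆ = t • v := by
        intro t ht
        have hr : (LieAlgebra.ad ℝ 𝔤 H').charpoly.IsRoot t := by
          rw [hchar]
          simp only [Polynomial.IsRoot, Polynomial.eval_add, Polynomial.eval_pow, Polynomial.eval_X,
            Polynomial.eval_mul, Polynomial.eval_C]
          linear_combination t * ht
        obtain ⟨v, hv⟩ :=
          ((Module.End.hasEigenvalue_iff_isRoot_charpoly _ _).2 hr).exists_hasEigenvector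
        exact ⟨v, hv.2, hv.apply_eq_smul⟩
      rw [abs_of_neg hneg] at hss
      obtain ⟨E, hE0, hE⟩ := hroot s hss
      obtain ⟨F, hF0, hF⟩ := hroot (-s) (by linarith)
      set H := s⁻¹ • H' with hH
      replace hE : ⁅H, E⁆ = E := by
        rw [hH, smul_lie, hE, smul_smul, inv_mul_cancel₀ hsq, one_smul]
      replace hF : ⁅H, F⁆ = -F := by
        rw [hH, smul_lie, hF, smul_smul, mul_neg, inv_mul_cancel₀ hsq, neg_smul, one_smul]
      have hcoef : ∀ a b c : ℝ, ⁅H, a • H + b • E + c • F⁆ = 0 → b = 0 ∧ c = 0 := by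
        intro a b c h
        simp only [lie_add, lie_smul, lie_self, hE, hF, smul_zero, zero_add] at h
        have h' := congrArg (fun v => ⁅H, v⁆) h
        simp only [lie_add, lie_smul, hE, hF, lie_neg, lie_zero] at h'
        have e1 : (2 * b) • E = 0 := by
          calc (2 * b) • E = (b • E + c • -F) + (b • E + c • - -F) := by module
            _ = 0 := by rw [h, h', add_zero]
        have e2 : (2 * c) • F = 0 := by
          calc (2 * c) • F = (b • E + c • - -F) - (b • E + c • -F) := by module
            _ = 0 := by rw [h, h', sub_zero]
        constructor
        · simpa [hE0] using e1
        · simpa [hF0] using e2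
      obtain ⟨B, hB0, hB1, hB2⟩ := exists_basis_of_three hdim (x := H) (y := E) (z := F) (by
        intro a b c h
        obtain ⟨rfl, rfl⟩ := hcoef a b c (by rw [h, lie_zero])
        simpa [hH0] using h)
      -- The eigenvalues of `E` and `F` add to zero, so `[E,F]` commutes with `H` and is therefore a
      -- multiple `κ H`.
      have hEF0 : ⁅H, ⁅E, F⁆⁆ = 0 := by rw [leibniz_lie, hE, hF, lie_neg, add_neg_cancel]
      have hEF := B.eq_add_three ⁅E, F⁆
      obtain ⟨h1, h2⟩ := hcoef (B.repr ⁅E, F⁆ 0) (B.repr ⁅E, F⁆ 1)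
        (B.repr ⁅E, F⁆ 2) (by rw [← hB0, ← hB1, ← hB2, ← B.eq_add_three, hB0, hB1, hB2,
        hEF0])
      rw [h1, h2, zero_smul, zero_smul, add_zero, add_zero, hB0] at hEF
      set κ := B.repr ⁅E, F⁆ 0
      have hκ : κ ≠ 0 := hp.coeff_ne_zero B (a := 1) (b := 0) (c := 0) (d := -1)
        (by rw [hB0, hB1, hE]; module) (by rw [hB0, hB2, hF]; module) (by rw [hB0, hB1, hB2, hEF])
      have hFE : ⁅F, E⁆ = -(κ • H) := by rw [← lie_skew, hEF]
      have hEH : ⁅E, H⁆ = -E := by rw [← lie_skew, hE]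
      have hFH : ⁅F, H⁆ = F := by rw [← lie_skew, hF, neg_neg]
      -- For `J = E + m F` and `Y = [J, H] = -E + m F` one has `[J, Y] = 2 m κ H`, so `m = -(2κ)⁻¹`
      -- makes `J` a rotation generator with `X = H`; then `[H, Y] = -J`.
      refine ⟨E + (-(2 * κ)⁻¹) • F, H, -E + (-(2 * κ)⁻¹) • F, -1, Or.inr rfl, hH0, ?_, ?_, ?_, ?_⟩
      · intro h0
        have := hcoef 0 1 (-(2 * κ)⁻¹) (by rw [zero_smul, zero_add, one_smul, h0, lie_zero])
        exact one_ne_zero this.1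
      · rw [add_lie, smul_lie, hEH, hFH]
      · simp only [lie_add, add_lie, lie_smul, smul_lie, lie_neg, lie_self, hEF, hFE]
        have : (2 * κ)⁻¹ * κ = 1 / 2 := by field_simp
        calc _ = (-(2 * ((2 * κ)⁻¹ * κ))) • H := by module
          _ = -H := by rw [this]; norm_num
      · rw [lie_add, lie_neg, lie_smul, hE, hF]; module
    · rw [abs_of_pos hpos] at hss
      set H := s⁻¹ • H' with hH
      obtain ⟨u, hu⟩ : ∃ u : 𝔤, ⁅H, u⁆ ≠ 0 := by
        by_contra hall
        push Not at hall
        have h1 := hchar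
        have h0 : (LieAlgebra.ad ℝ 𝔤 H') = 0 := by
          ext v
          rw [hHH]
          simp [hall]
        rw [h0, LinearMap.charpoly_zero] at h1
        have := congrArg (fun p : Polynomial ℝ => p.coeff 1) h1
        simp [Polynomial.coeff_X_pow, hp.finrank_eq_three hdim hxy] at this
        exact hc this.symm
      have hH3 : ∀ v : 𝔤, ⁅H, ⁅H, ⁅H, v⁆⁆⁆ = -⁅H, v⁆ := by
        intro v
        have h := hcube v
        rw [hHH, ← hss] at h
        simp only [smul_lie, lie_smul, smul_smul] at h
        have h' : (s * s * s) • (⁅H, ⁅H, ⁅H, v⁆⁆⁆ + ⁅H, v⁆) = 0 := by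
          rw [← h]; module
        rw [smul_eq_zero] at h'
        exact eq_neg_of_add_eq_zero_left (h'.resolve_left (by positivity))
      -- For `c > 0` the rescaled `H` satisfies `(ad H)³ = -ad H`, so `(ad H)²` is `-1` on the range
      -- of `ad H`, which contains `X`.
      set X := ⁅H, ⁅H, u⁆⁆ with hX
      have hX0 : X ≠ 0 := fun h0 => hu (by
        have := hH3 u
        rw [← hX, h0, lie_zero] at this
        exact neg_eq_zero.1 this.symm)
      have hHX : ⁅H, X⁆ = -⁅H, u⁆ := hH3 u
      have hHY : ⁅H, ⁅H, X⁆⁆ = -X := by rw [hHX, lie_neg]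
      set Y := ⁅H, X⁆ with hY
      obtain ⟨B, hB0, hB1, hB2⟩ := exists_basis_of_three hdim (x := H) (y := X) (z := Y) (by
        intro a b c h
        obtain ⟨rfl, rfl⟩ := coeff_eq_zero_of_rotation hY.symm hHY hX0 (by rw [h, lie_zero])
        simpa [hH0] using h)
      have hXY0 : ⁅H, ⁅X, Y⁆⁆ = 0 := by
        rw [leibniz_lie, hHY, ← hY, lie_neg, lie_self, lie_self, neg_zero, add_zero]
      have hXY := B.eq_add_three ⁅X, Y⁆
      obtain ⟨h1, h2⟩ := coeff_eq_zero_of_rotation hY.symm hHY hX0 (a := B.repr ⁅X, Y⁆ 0)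
        (b := B.repr ⁅X, Y⁆ 1) (c := B.repr ⁅X, Y⁆ 2)
        (by rw [← hB0, ← hB1, ← hB2, ← B.eq_add_three, hB0, hB1, hB2, hXY0])
      rw [h1, h2, zero_smul, zero_smul, add_zero, add_zero, hB0] at hXY
      set κ := B.repr ⁅X, Y⁆ 0
      have hκ : κ ≠ 0 := hp.coeff_ne_zero B (a := 0) (b := 1) (c := -1) (d := 0)
        (by rw [hB0, hB1, ← hY, hB2]; module) (by rw [hB0, hB2, hHY, hB1]; module)
        (by rw [hB0, hB1, hB2, hXY])
      have hr0 : Real.sqrt |κ| ≠ 0 := (Real.sqrt_pos.2 (abs_pos.2 hκ)).ne'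
      have hrr : Real.sqrt |κ| * Real.sqrt |κ| = |κ| := Real.mul_self_sqrt (abs_nonneg κ)
      set r := Real.sqrt |κ|
      -- `[X, Y] = κ H` scales quadratically, so dividing both vectors by `√|κ|` leaves only the
      -- sign of `κ`.
      refine ⟨H, r⁻¹ • X, r⁻¹ • Y, κ / |κ|, ?_, smul_ne_zero (inv_ne_zero hr0) hX0, hH0, ?_, ?_, ?_⟩
      · rcases abs_choice κ with h | h
        · exact Or.inl (by rw [h, div_self hκ])
        · exact Or.inr (by rw [h, div_neg, div_self hκ])
      · rw [lie_smul]
      · rw [lie_smul, hHY, smul_neg]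
      · rw [lie_smul, smul_lie, hXY, smul_smul, smul_smul, ← hrr]
        congr 1
        field_simp
  obtain ⟨B, hB0, hB1, hB2⟩ := exists_basis_of_three hdim (x := J) (y := X) (z := Y) (by
    intro a b c h
    obtain ⟨rfl, rfl⟩ := coeff_eq_zero_of_rotation hJX hJY hX (by rw [h, lie_zero])
    simpa [hJ] using h)
  exact ⟨B, ε, hε, by rw [hB0, hB1, hB2, hJX], by rw [hB0, hB1, hB2, hJY],
    by rw [hB0, hB1, hB2, hXY]⟩

end Perfect

/-! ### Isomorphisms from equal structure constants. -/

section Recognition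

/-- The relations with `J, X ≠ 0` already imply that `J`, `X`, `Y` are a basis. The image of `B 0`
is recorded because quasimorphisms are evaluated there. -/
lemma exists_lieEquiv_of_rotation {𝔤 𝔥 : Type*} [LieRing 𝔤] [LieAlgebra ℝ 𝔤]
    [LieRing 𝔥] [LieAlgebra ℝ 𝔥] [FiniteDimensional ℝ 𝔥] (hdim : Module.finrank ℝ 𝔥 ≤ 3) {ε : ℝ}
    (B : Module.Basis (Fin 3) ℝ 𝔤) (h1 : ⁅B 0, B 1⁆ = B 2) (h2 : ⁅B 0, B 2⁆ = -B 1)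
    (h3 : ⁅B 1, B 2⁆ = ε • B 0) {J X Y : 𝔥} (hJ : J ≠ 0) (hX : X ≠ 0) (hJX : ⁅J, X⁆ = Y)
    (hJY : ⁅J, Y⁆ = -X) (hXY : ⁅X, Y⁆ = ε • J) : ∃ ι : 𝔤 ≃ₗ⁅ℝ⁆ 𝔥, ι (B 0) = J := by
  obtain ⟨C, rfl, rfl, rfl⟩ := exists_basis_of_three hdim (x := J) (y := X) (z := Y) (by
    intro a b c h
    obtain ⟨rfl, rfl⟩ := coeff_eq_zero_of_rotation hJX hJY hX (by rw [h, lie_zero])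
    simpa [hJ] using h)
  let e : 𝔤 ≃ₗ[ℝ] 𝔥 := B.equiv C (Equiv.refl _)
  have he : ∀ i, e (B i) = C i := fun i => by simp [e]
  refine ⟨{ e with map_lie' := ?_ }, he 0⟩
  intro x y
  change e ⁅x, y⁆ = ⁅e x, e y⁆
  rw [B.eq_add_three x, B.eq_add_three y]
  simp only [map_add, map_smul, he, lie_add, add_lie, lie_smul, smul_lie, lie_self,
    ← lie_skew (B 1) (B 0), ← lie_skew (B 2) (B 0), ← lie_skew (B 2) (B 1), h1, h2, h3,
    ← lie_skew (C 1) (C 0), ← lie_skew (C 2) (C 0), ← lie_skew (C 2) (C 1), hJX, hJY, hXY, map_neg,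
    map_zero]

end Recognition

/-! ### The group of unit quaternions and `𝔰𝔲(2)`. -/

section UnitQuaternions

open Metric

lemma finrank_quaternion_fact : Fact (Module.finrank ℝ (Quaternion ℝ) = 3 + 1) :=
  ⟨Quaternion.finrank_eq_four⟩

attribute [local instance] finrank_quaternion_fact

/-- The unit quaternions. -/
abbrev UnitQuaternion : Type := sphere (0 : Quaternion ℝ) 1

lemma UnitQuaternion.coe_inv_eq_star (g : UnitQuaternion) :
    ((g⁻¹ : UnitQuaternion) : Quaternion ℝ) = star (g : Quaternion ℝ) := by
  have h : Quaternion.normSq (g : Quaternion ℝ) = 1 := by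
    rw [Quaternion.normSq_eq_norm_mul_self, norm_eq_of_mem_sphere, one_mul]
  rw [unitSphere.coe_inv, Quaternion.inv_def, h, inv_one, one_smul]

/-- Quaternionic conjugation. -/
def quaternionStar : Quaternion ℝ →L[ℝ] Quaternion ℝ :=
  LinearMap.toContinuousLinearMap
    { toFun := star, map_add' := star_add, map_smul' := fun c x => by simp }

lemma quaternionStar_apply (x : Quaternion ℝ) : quaternionStar x = star x := rfl

instance : LieGroup (𝓡 3) ∞ UnitQuaternion where
  contMDiff_mul := by
    apply ContMDiff.codRestrict_sphere
    let c : UnitQuaternion → Quaternion ℝ := (↑)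
    have h₂ : ContMDiff (𝓘(ℝ, Quaternion ℝ).prod 𝓘(ℝ, Quaternion ℝ)) 𝓘(ℝ, Quaternion ℝ) ∞
        fun z : Quaternion ℝ × Quaternion ℝ => z.fst * z.snd := by
      rw [contMDiff_iff]
      exact ⟨continuous_mul, fun x y => contDiff_mul.contDiffOn⟩
    suffices h₁ : ContMDiff _ _ _ (Prod.map c c) from
      h₂.comp h₁
    apply ContMDiff.prodMap <;> exact contMDiff_coe_sphere
  contMDiff_inv := by
    apply ContMDiff.codRestrict_sphere
    simp only [← unitSphere.coe_inv, UnitQuaternion.coe_inv_eq_star]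
    exact quaternionStar.contDiff.contMDiff.comp contMDiff_coe_sphere

instance : SecondCountableTopology UnitQuaternion := by
  have : ProperSpace (Quaternion ℝ) := FiniteDimensional.proper_real _
  infer_instance

/-- The differential at the unit of the inclusion of the unit quaternions. -/
def quaternionDeriv : GroupLieAlgebra (𝓡 3) UnitQuaternion →L[ℝ] Quaternion ℝ :=
  mvfderiv (𝓡 3) ((↑) : UnitQuaternion → Quaternion ℝ) (1 : UnitQuaternion)

lemma hasDerivAt_coe_oneParameter (X : GroupLieAlgebra (𝓡 3) UnitQuaternion) :
    HasDerivAt (fun t => ((oneParameter X t : UnitQuaternion) : Quaternion ℝ)) (quaternionDeriv X) 0 := by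
  have h1 : ∀ g : UnitQuaternion, g = 1 → HasMFDerivAt (𝓡 3) 𝓘(ℝ, Quaternion ℝ)
      ((↑) : UnitQuaternion → Quaternion ℝ) g
      (quaternionDeriv : EuclideanSpace ℝ (Fin 3) →L[ℝ] Quaternion ℝ) := by
    rintro _ rfl
    exact ((contMDiff_coe_sphere (m := 1) (1 : UnitQuaternion)).mdifferentiableAt
      one_ne_zero).hasMFDerivAt
  have hγ := isMIntegralCurve_oneParameter X 0
  rw [oneParameter_zero, mulInvariantVectorField_one] at hγ
  have h2 := (h1 _ (oneParameter_zero X)).comp_curve hγ.hasMFDerivWithinAt (s := Set.univ)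
  have h3 : HasFDerivAt (fun t => ((oneParameter X t : UnitQuaternion) : Quaternion ℝ))
      ((1 : ℝ →L[ℝ] ℝ).smulRight (quaternionDeriv X)) 0 :=
    (hasMFDerivWithinAt_univ.1 h2).hasFDerivAt
  have h4 := h3.hasDerivAt
  rwa [ContinuousLinearMap.smulRight_apply, one_apply_eq_self, one_smul] at h4

/-- Differentiate `q * star q = 1` along a one-parameter subgroup. -/
lemma star_quaternionDeriv (X : GroupLieAlgebra (𝓡 3) UnitQuaternion) :
    star (quaternionDeriv X) = -quaternionDeriv X := by
  have h1 := hasDerivAt_coe_oneParameter X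
  have h2 := h1.mul (quaternionStar.hasFDerivAt.comp_hasDerivAt 0 h1)
  have h3 : HasDerivAt (fun _ : ℝ => (1 : Quaternion ℝ)) _ 0 :=
    h2.congr_of_eventuallyEq (Eventually.of_forall fun t => by
      simp only [Pi.mul_apply, Function.comp, quaternionStar_apply]
      rw [← UnitQuaternion.coe_inv_eq_star, ← unitSphere.coe_mul, mul_inv_cancel,
        unitSphere.coe_one])
  have h4 := h3.unique (hasDerivAt_const (0 : ℝ) (1 : Quaternion ℝ))
  simp only [Function.comp, quaternionStar_apply, oneParameter_zero, unitSphere.coe_one, star_one,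
    mul_one, one_mul] at h4
  exact eq_neg_of_add_eq_zero_right h4

lemma quaternionDeriv_adjointAction (g : UnitQuaternion)
    (Y : GroupLieAlgebra (𝓡 3) UnitQuaternion) :
    quaternionDeriv (adjointAction g Y) = g * quaternionDeriv Y * star (g : Quaternion ℝ) := by
  have h1 := hasDerivAt_coe_oneParameter (adjointAction g Y)
  have h2 := ((hasDerivAt_coe_oneParameter Y).const_mul (g : Quaternion ℝ)).mul_const
    (star (g : Quaternion ℝ))
  refine h1.unique (h2.congr_of_eventuallyEq (Eventually.of_forall fun t => ?_))
  change ((oneParameter (adjointAction g Y) t : UnitQuaternion) : Quaternion ℝ) =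
    g * (oneParameter Y t : UnitQuaternion) * star (g : Quaternion ℝ)
  rw [← conj_oneParameter, unitSphere.coe_mul, unitSphere.coe_mul, UnitQuaternion.coe_inv_eq_star]

/-- The derivative at `0` of `Ad (exp tX) Y = q Y (star q)` is the commutator, because `star`
negates the velocity of `q`. -/
lemma quaternionDeriv_lie (X Y : GroupLieAlgebra (𝓡 3) UnitQuaternion) :
    quaternionDeriv ⁅X, Y⁆ =
      quaternionDeriv X * quaternionDeriv Y - quaternionDeriv Y * quaternionDeriv X := by
  have hγ := isMIntegralCurve_oneParameter X 0
  rw [oneParameter_zero, mulInvariantVectorField_one] at hγ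
  have h1 := hasDerivAt_adjointAction (oneParameter_zero X) hγ Y
  let D : EuclideanSpace ℝ (Fin 3) →L[ℝ] Quaternion ℝ := quaternionDeriv
  have h2 : HasDerivAt (fun t => D (adjointAction (oneParameter X t) Y))
      (D (⁅X, Y⁆ : GroupLieAlgebra (𝓡 3) UnitQuaternion)) 0 :=
    D.hasFDerivAt.comp_hasDerivAt 0 h1
  have h3 := hasDerivAt_coe_oneParameter X
  have h4 := (h3.mul_const (quaternionDeriv Y)).mul
    (quaternionStar.hasFDerivAt.comp_hasDerivAt 0 h3)
  have h5 := h2.unique (h4.congr_of_eventuallyEq (Eventually.of_forall fun t =>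
    quaternionDeriv_adjointAction (oneParameter X t) Y))
  refine h5.trans ?_
  simp only [Function.comp, quaternionStar_apply, star_quaternionDeriv, oneParameter_zero,
    unitSphere.coe_one, star_one, mul_one, one_mul]
  rw [mul_neg, sub_eq_add_neg]

lemma quaternionDeriv_injective : Function.Injective quaternionDeriv :=
  injective_mvfderiv_subtypeVal_sphere (1 : UnitQuaternion)

lemma exists_quaternionDeriv_eq {q : Quaternion ℝ} (hq : q.re = 0) :
    ∃ X, quaternionDeriv X = q := by
  have h : q ∈ (Submodule.span ℝ {((1 : UnitQuaternion) : Quaternion ℝ)})ᗮ := by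
    rw [Submodule.mem_orthogonal_singleton_iff_inner_right, Quaternion.inner_def]
    simpa using hq
  rw [← range_mvfderiv_subtypeVal (n := 3)] at h
  exact h

/-- The imaginary quaternion with given coordinates. -/
def imaginaryQuaternion (a b c : ℝ) : Quaternion ℝ := ⟨0, a, b, c⟩

section

variable (a b c : ℝ)

@[simp] lemma imaginaryQuaternion_re : (imaginaryQuaternion a b c).re = 0 := rfl
@[simp] lemma imaginaryQuaternion_imI : (imaginaryQuaternion a b c).imI = a := rfl
@[simp] lemma imaginaryQuaternion_imJ : (imaginaryQuaternion a b c).imJ = b := rfl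
@[simp] lemma imaginaryQuaternion_imK : (imaginaryQuaternion a b c).imK = c := rfl

lemma imaginaryQuaternion_neg :
    -imaginaryQuaternion a b c = imaginaryQuaternion (-a) (-b) (-c) := by
  ext <;> simp

lemma imaginaryQuaternion_commutator (a' b' c' : ℝ) :
    imaginaryQuaternion a b c * imaginaryQuaternion a' b' c' -
      imaginaryQuaternion a' b' c' * imaginaryQuaternion a b c =
      imaginaryQuaternion (2 * (b * c' - c * b')) (2 * (c * a' - a * c'))
        (2 * (a * b' - b * a')) := by
  ext <;> simp <;> ring

end

/-- On `𝔰𝔲(2)` the zero function is the derivative of the zero quasimorphism of the group of unit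
quaternions. -/
theorem isDerivOfHomogeneousQuasimorphism_zero_of_compact {𝔤 : Type*} [LieRing 𝔤] [LieAlgebra ℝ 𝔤]
    (B : Module.Basis (Fin 3) ℝ 𝔤) (h1 : ⁅B 0, B 1⁆ = B 2) (h2 : ⁅B 0, B 2⁆ = -B 1)
    (h3 : ⁅B 1, B 2⁆ = (1 : ℝ) • B 0) :
    IsDerivOfHomogeneousQuasimorphism (fun _ : 𝔤 => (0 : ℝ)) := by
  -- The halves absorb the factor in `[i, j] = 2 k`.
  obtain ⟨J, hJ⟩ := exists_quaternionDeriv_eq (q := imaginaryQuaternion (1 / 2) 0 0) rfl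
  obtain ⟨X, hX⟩ := exists_quaternionDeriv_eq (q := imaginaryQuaternion 0 (1 / 2) 0) rfl
  obtain ⟨Y, hY⟩ := exists_quaternionDeriv_eq (q := imaginaryQuaternion 0 0 (1 / 2)) rfl
  have hfd : FiniteDimensional ℝ (GroupLieAlgebra (𝓡 3) UnitQuaternion) :=
    inferInstanceAs (FiniteDimensional ℝ (EuclideanSpace ℝ (Fin 3)))
  have hdim : Module.finrank ℝ (GroupLieAlgebra (𝓡 3) UnitQuaternion) ≤ 3 :=
    (finrank_euclideanSpace_fin (𝕜 := ℝ) (n := 3)).le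
  obtain ⟨ι, -⟩ := exists_lieEquiv_of_rotation hdim B h1 h2 h3 (J := J) (X := X) (Y := Y)
    (by
      rintro rfl
      have h : (0 : ℝ) = 1 / 2 := congrArg (fun q : Quaternion ℝ => q.imI)
        ((map_zero quaternionDeriv).symm.trans hJ)
      norm_num at h)
    (by
      rintro rfl
      have h : (0 : ℝ) = 1 / 2 := congrArg (fun q : Quaternion ℝ => q.imJ)
        ((map_zero quaternionDeriv).symm.trans hX)
      norm_num at h)
    (quaternionDeriv_injective (by
      rw [quaternionDeriv_lie, hJ, hX, hY, imaginaryQuaternion_commutator]; norm_num))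
    (quaternionDeriv_injective (by
      rw [quaternionDeriv_lie, map_neg, hJ, hX, hY, imaginaryQuaternion_commutator,
        imaginaryQuaternion_neg]
      norm_num))
    (quaternionDeriv_injective (by
      rw [quaternionDeriv_lie, one_smul, hJ, hX, hY, imaginaryQuaternion_commutator]; norm_num))
  exact ⟨3, UnitQuaternion, inferInstance, inferInstance, inferInstance, inferInstance,
    inferInstance, inferInstance, ι, fun X => oneParameter X 1, fun _ => 0,
    isExponentialMap_oneParameter, ⟨continuous_const, ⟨0, by simp⟩, by simp⟩, fun _ => rfl⟩

end UnitQuaternions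

/-! ### Homogenization of quasimorphisms. -/

section Homogenization

/-- Every continuous quasimorphism is at bounded distance from a homogeneous one. -/
theorem exists_homogenization {G : Type*} [Group G] [TopologicalSpace G] [ContinuousMul G]
    {w : G → ℝ} (hw : Continuous w) {D : ℝ} (hD : ∀ g h, |w (g * h) - w g - w h| ≤ D) :
    ∃ f : G → ℝ, IsHomogeneousQuasimorphism f ∧ ∀ g, |f g - w g| ≤ D := by
  -- Along powers of two, the defect at `(h, h)` alone gives a geometric Cauchy estimate, uniform in
  -- `g`.
  let u : ℕ → G → ℝ := fun k g => w (g ^ 2 ^ k) / 2 ^ k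
  have hu : ∀ g k, dist (u k g) (u (k + 1) g) ≤ D / 2 / 2 ^ k := by
    intro g k
    have h := hD (g ^ 2 ^ k) (g ^ 2 ^ k)
    rw [← pow_add, ← mul_two, ← pow_succ] at h
    have h2 : u k g - u (k + 1) g =
        -(w (g ^ 2 ^ (k + 1)) - w (g ^ 2 ^ k) - w (g ^ 2 ^ k)) / 2 / 2 ^ k := by
      simp only [u]; field_simp; ring
    rw [Real.dist_eq, h2, abs_div, abs_div, abs_neg, abs_two, abs_of_pos (by positivity : (0:ℝ) < 2 ^ k)]
    gcongr
  choose f hf using fun g => cauchySeq_tendsto_of_complete (cauchySeq_of_le_geometric_two (hu g))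
  have hdist : ∀ g k, dist (u k g) (f g) ≤ D / 2 ^ k := fun g k =>
    dist_le_of_le_geometric_two_of_tendsto (hu g) (hf g) k
  have hfw : ∀ g, |f g - w g| ≤ D := by
    intro g
    have := hdist g 0
    rwa [Real.dist_eq, abs_sub_comm, show u 0 g = w g by simp [u], pow_zero, div_one] at this
  have hdef : ∀ g h, |f (g * h) - f g - f h| ≤ 4 * D := by
    intro g h
    have h1 := abs_le.1 (hfw (g * h))
    have h2 := abs_le.1 (hfw g)
    have h3 := abs_le.1 (hfw h)
    have h4 := abs_le.1 (hD g h)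
    exact abs_le.2 ⟨by linarith, by linarith⟩
  have hdouble : ∀ g m, f (g ^ 2 ^ m) = 2 ^ m * f g := by
    intro g m
    refine tendsto_nhds_unique (hf (g ^ 2 ^ m)) ?_
    refine (((tendsto_add_atTop_iff_nat m).2 (hf g)).const_mul (2 ^ m)).congr fun k => ?_
    simp only [u]
    rw [← pow_mul, ← pow_add, add_comm m k, pow_add (2 : ℝ)]
    field_simp
  have hone : f 1 = 0 := by
    have := hdouble 1 1
    rw [one_pow] at this
    linarith
  have hnat : ∀ (k : ℕ) g, |f (g ^ k) - k * f g| ≤ k * (4 * D) := by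
    intro k g
    induction k with
    | zero => simp [hone]
    | succ k ih =>
      have h1 := abs_le.1 ih
      have h2 := abs_le.1 (hdef (g ^ k) g)
      rw [← pow_succ] at h2
      push_cast
      exact abs_le.2 ⟨by linarith, by linarith⟩
  have hlim : ∀ {x C : ℝ}, (∀ m : ℕ, 2 ^ m * |x| ≤ C) → x = 0 := by
    intro x C h
    refine eq_zero_of_forall_nat_mul_abs_le (C := C) fun k => (h k).trans' ?_
    gcongr
    exact_mod_cast Nat.lt_two_pow_self.le
  have hpow : ∀ (k : ℕ) g, f (g ^ k) = k * f g := by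
    intro k g
    rw [← sub_eq_zero]
    refine hlim (C := k * (4 * D)) fun m => ?_
    -- Replacing `g` by `g ^ 2 ^ m` multiplies `f (g ^ k) - k f g` by `2 ^ m`, while its bound does
    -- not depend on `g`.
    have h := hnat k (g ^ 2 ^ m)
    rw [← pow_mul, mul_comm (2 ^ m) k, pow_mul, hdouble, hdouble] at h
    have e : 2 ^ m * (f (g ^ k) - k * f g) = 2 ^ m * f (g ^ k) - k * (2 ^ m * f g) := by ring
    rwa [← e, abs_mul, abs_of_pos (by positivity : (0 : ℝ) < 2 ^ m)] at h
  have hinv : ∀ g, f g⁻¹ = -f g := by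
    intro g
    have h0 : f g⁻¹ + f g = 0 := by
      refine hlim (C := 4 * D) fun m => ?_
      have h := hdef (g ^ 2 ^ m)⁻¹ (g ^ 2 ^ m)
      rw [inv_mul_cancel, hone, ← inv_pow, hdouble, hdouble] at h
      have e : 0 - 2 ^ m * f g⁻¹ - 2 ^ m * f g = -(2 ^ m * (f g⁻¹ + f g)) := by ring
      rwa [e, abs_neg, abs_mul, abs_of_pos (by positivity : (0 : ℝ) < 2 ^ m)] at h
    linarith
  refine ⟨f, ⟨?_, ⟨4 * D, hdef⟩, ?_⟩, hfw⟩
  -- The estimate `D / 2 ^ k` is independent of `g`, so `f` is a uniform limit of continuous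
  -- functions.
  · have hunif : TendstoUniformly u f atTop := by
      rw [Metric.tendstoUniformly_iff]
      intro ε hε
      have hto : Tendsto (fun k : ℕ => D / 2 ^ k) atTop (𝓝 0) :=
        tendsto_const_nhds.div_atTop (tendsto_pow_atTop_atTop_of_one_lt one_lt_two)
      filter_upwards [hto.eventually_lt_const hε] with k hk g
      rw [dist_comm]
      exact (hdist g k).trans_lt hk
    exact hunif.continuous (Frequently.of_forall fun k =>
      (hw.comp (continuous_pow _)).div_const _)
  · intro g k
    obtain ⟨m, rfl | rfl⟩ := k.eq_nat_or_neg
    · rw [zpow_natCast, hpow]; simp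
    · rw [zpow_neg, zpow_natCast, hinv, hpow]; push_cast; ring

end Homogenization

/-! ### Recognition of one-parameter subgroups. -/

section OneParameterSubgroup

variable {n : ℕ} {G : Type*} [TopologicalSpace G]
  [ChartedSpace (EuclideanSpace ℝ (Fin n)) G] [Group G] [LieGroup (𝓡 n) ∞ G] [T2Space G]

/-- A one-parameter subgroup with velocity `X` at the unit is the one generated by `X`. -/
lemma eq_oneParameter_of_hom {γ : ℝ → G} {X : GroupLieAlgebra (𝓡 n) G}
    (hadd : ∀ s t, γ (s + t) = γ s * γ t)
    (hγ : HasMFDerivAt 𝓘(ℝ, ℝ) (𝓡 n) γ 0 ((1 : ℝ →L[ℝ] ℝ).smulRight X)) : γ = oneParameter X := by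
  have h0 : γ 0 = 1 := by
    have := hadd 0 0
    rwa [add_zero, left_eq_mul] at this
  refine eq_oneParameter h0 fun t => ?_
  have h1 : HasMFDerivAt (𝓡 n) (𝓡 n) (γ t * ·) (γ 0) (mfderiv (𝓡 n) (𝓡 n) (γ t * ·) 1) := by
    rw [h0]; exact hasMFDerivAt_mul_left (γ t)
  have h2 := h1.comp_curve hγ.hasMFDerivWithinAt (s := Set.univ)
  have h3 : HasMFDerivAt 𝓘(ℝ, ℝ) (𝓡 n) (fun s => γ t * γ s) (t - t)
      ((1 : ℝ →L[ℝ] ℝ).smulRight (mulInvariantVectorField X (γ t))) := by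
    rw [sub_self]; exact hasMFDerivWithinAt_univ.1 h2
  have h4 : HasMFDerivAt 𝓘(ℝ, ℝ) 𝓘(ℝ, ℝ) (fun s : ℝ => s - t) t (ContinuousLinearMap.id ℝ ℝ) :=
    ((hasFDerivAt_id t).sub_const t).hasMFDerivAt
  have h5 := HasMFDerivAt.comp (f := fun s : ℝ => s - t) t h3 h4
  have h6 : (fun s => γ t * γ s) ∘ (fun s : ℝ => s - t) = γ := by
    ext s
    simp only [Function.comp]
    rw [← hadd, add_sub_cancel]
  rw [h6] at h5
  exact h5

end OneParameterSubgroup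

/-! ### The universal cover of `SU(1, 1)` as a group law on `ℂ × ℝ`. -/

section SplitGroup

open ComplexConjugate

/-- The upper left entry of the element of `SU(1, 1)` with off-diagonal entry `x.1` and angle
`x.2`. -/
def diagEntry (x : ℂ × ℝ) : ℂ := (Real.sqrt (1 + ‖x.1‖ ^ 2) : ℝ) * Complex.exp (x.2 * Complex.I)

/-- The ratio of the upper left entry of a product and the product of the upper left entries. -/
def diagRatio (x y : ℂ × ℝ) : ℂ := 1 + x.1 * conj y.1 / (diagEntry x * diagEntry y)

/-- The multiplication of the universal covering group of `SU(1, 1)`. -/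
def coverMul (x y : ℂ × ℝ) : ℂ × ℝ :=
  (diagEntry x * y.1 + x.1 * conj (diagEntry y), x.2 + y.2 + (Complex.log (diagRatio x y)).im)

lemma one_add_norm_sq_pos (b : ℂ) : 0 < 1 + ‖b‖ ^ 2 := by positivity

lemma norm_diagEntry (x : ℂ × ℝ) : ‖diagEntry x‖ = Real.sqrt (1 + ‖x.1‖ ^ 2) := by
  rw [diagEntry, norm_mul, Complex.norm_exp_ofReal_mul_I, mul_one, Complex.norm_real,
    Real.norm_of_nonneg (Real.sqrt_nonneg _)]

lemma norm_diagEntry_sq (x : ℂ × ℝ) : ‖diagEntry x‖ ^ 2 = 1 + ‖x.1‖ ^ 2 := by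
  rw [norm_diagEntry, Real.sq_sqrt (one_add_norm_sq_pos _).le]

lemma diagEntry_ne_zero (x : ℂ × ℝ) : diagEntry x ≠ 0 := by
  rw [← norm_pos_iff, norm_diagEntry]
  exact Real.sqrt_pos.2 (one_add_norm_sq_pos _)

lemma diagEntry_mul_conj (x : ℂ × ℝ) : diagEntry x * conj (diagEntry x) = 1 + x.1 * conj x.1 := by
  rw [Complex.mul_conj', Complex.mul_conj']
  exact_mod_cast norm_diagEntry_sq x

lemma diagEntry_eq_norm_mul (x : ℂ × ℝ) :
    diagEntry x = (‖diagEntry x‖ : ℝ) * Complex.exp (x.2 * Complex.I) := by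
  rw [norm_diagEntry]; rfl

lemma norm_lt_norm_diagEntry (x : ℂ × ℝ) : ‖x.1‖ < ‖diagEntry x‖ := by
  rw [norm_diagEntry]
  exact Real.lt_sqrt_of_sq_lt (by linarith)

/-- Since `|β| < |α|` in `SU(1, 1)`, the ratio lies in the unit disc about `1`. Hence the principal
logarithm is smooth there and the angle correction is below `π / 2`; associativity and the
quasimorphism bound both rest on this. -/
lemma diagRatio_re_pos (x y : ℂ × ℝ) : 0 < (diagRatio x y).re := by
  have h : ‖x.1 * conj y.1 / (diagEntry x * diagEntry y)‖ < 1 := by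
    rw [norm_div, norm_mul, norm_mul, RCLike.norm_conj, div_lt_one
      (mul_pos (norm_pos_iff.2 (diagEntry_ne_zero x)) (norm_pos_iff.2 (diagEntry_ne_zero y)))]
    exact mul_lt_mul'' (norm_lt_norm_diagEntry x) (norm_lt_norm_diagEntry y) (norm_nonneg _)
      (norm_nonneg _)
  have h2 := (abs_lt.1 ((Complex.abs_re_le_norm _).trans_lt h)).1
  rw [diagRatio, Complex.add_re, Complex.one_re]
  linarith

lemma abs_log_diagRatio_im_lt (x y : ℂ × ℝ) : |(Complex.log (diagRatio x y)).im| < Real.pi / 2 := by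
  rw [Complex.log_im]
  exact Complex.abs_arg_lt_pi_div_two_iff.2 (Or.inl (diagRatio_re_pos x y))

lemma diagEntry_mul_diagRatio (x y : ℂ × ℝ) :
    diagEntry x * diagEntry y * diagRatio x y = diagEntry x * diagEntry y + x.1 * conj y.1 := by
  have := diagEntry_ne_zero x
  have := diagEntry_ne_zero y
  rw [diagRatio]
  field_simp

/-- `coverMul` lifts the matrix product: moduli agree by the determinant relation `|α|² = 1 + |β|²`,
and arguments by the choice of the logarithmic correction. -/
lemma diagEntry_coverMul (x y : ℂ × ℝ) :
    diagEntry (coverMul x y) = diagEntry x * diagEntry y + x.1 * conj y.1 := by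
  have h1 : ‖diagEntry (coverMul x y)‖ ^ 2 = ‖diagEntry x * diagEntry y + x.1 * conj y.1‖ ^ 2 := by
    rw [norm_diagEntry_sq]
    have hx := diagEntry_mul_conj x
    have hy := diagEntry_mul_conj y
    have : ((1 + ‖(coverMul x y).1‖ ^ 2 : ℝ) : ℂ) =
        ((‖diagEntry x * diagEntry y + x.1 * conj y.1‖ ^ 2 : ℝ) : ℂ) := by
      push_cast
      rw [← Complex.mul_conj', ← Complex.mul_conj']
      simp only [coverMul, map_add, map_mul, Complex.conj_conj]
      linear_combination (-(diagEntry y * conj (diagEntry y)) + y.1 * conj y.1) * hx - hy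
    exact_mod_cast this
  have h2 : ‖diagEntry (coverMul x y)‖ = ‖diagEntry x * diagEntry y + x.1 * conj y.1‖ :=
    (sq_eq_sq₀ (norm_nonneg _) (norm_nonneg _)).1 h1
  rw [diagEntry_eq_norm_mul, h2, ← diagEntry_mul_diagRatio, norm_mul, norm_mul]
  have e1 := diagEntry_eq_norm_mul x
  have e2 := diagEntry_eq_norm_mul y
  have e3 := Complex.norm_mul_exp_arg_mul_I (diagRatio x y)
  rw [show (coverMul x y).2 = x.2 + y.2 + (diagRatio x y).arg by rw [← Complex.log_im]; rfl]
  push_cast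
  rw [add_mul, add_mul, Complex.exp_add, Complex.exp_add]
  conv_rhs => rw [e1, e2, ← e3]
  ring

lemma eq_of_diagEntry_eq {x y : ℂ × ℝ} (h : diagEntry x = diagEntry y) (h1 : x.1 = y.1)
    (h2 : |x.2 - y.2| < 2 * Real.pi) : x = y := by
  refine Prod.ext h1 ?_
  rw [diagEntry, diagEntry, h1] at h
  have h3 := mul_left_cancel₀ (Complex.ofReal_ne_zero.2
    (Real.sqrt_pos.2 (one_add_norm_sq_pos y.1)).ne') h
  obtain ⟨k, hk⟩ := Complex.exp_eq_exp_iff_exists_int.1 h3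
  have hk' : x.2 = y.2 + k * (2 * Real.pi) := by
    have := congrArg Complex.im hk
    simpa using this
  have hk0 : k = 0 := by
    rw [hk', add_sub_cancel_left, abs_mul, abs_of_pos Real.two_pi_pos] at h2
    have h4 : |(k : ℝ)| < 1 := by
      by_contra hge
      push Not at hge
      nlinarith [Real.two_pi_pos]
    exact Int.abs_lt_one_iff.1 (by exact_mod_cast h4)
  rw [hk', hk0]; simp

/-- Both sides lie over the same matrix, so their angles differ by a multiple of `2π`. The
difference consists of four corrections, each below `π / 2`, hence is zero. -/
lemma coverMul_assoc (x y z : ℂ × ℝ) :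
    coverMul (coverMul x y) z = coverMul x (coverMul y z) := by
  refine eq_of_diagEntry_eq ?_ ?_ ?_
  · rw [diagEntry_coverMul, diagEntry_coverMul, diagEntry_coverMul, diagEntry_coverMul]
    simp only [coverMul, map_add, map_mul, Complex.conj_conj]
    ring
  · change diagEntry (coverMul x y) * z.1 + (coverMul x y).1 * conj (diagEntry z) =
      diagEntry x * (coverMul y z).1 + x.1 * conj (diagEntry (coverMul y z))
    rw [diagEntry_coverMul, diagEntry_coverMul]
    simp only [coverMul, map_add, map_mul, Complex.conj_conj]
    ring
  · have h1 := abs_lt.1 (abs_log_diagRatio_im_lt x y)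
    have h2 := abs_lt.1 (abs_log_diagRatio_im_lt (coverMul x y) z)
    have h3 := abs_lt.1 (abs_log_diagRatio_im_lt y z)
    have h4 := abs_lt.1 (abs_log_diagRatio_im_lt x (coverMul y z))
    change |x.2 + y.2 + (Complex.log (diagRatio x y)).im + z.2 +
      (Complex.log (diagRatio (coverMul x y) z)).im - (x.2 + (y.2 + z.2 +
      (Complex.log (diagRatio y z)).im) + (Complex.log (diagRatio x (coverMul y z))).im)| < _
    exact abs_lt.2 ⟨by linarith, by linarith⟩

lemma diagEntry_zero : diagEntry 0 = 1 := by simp [diagEntry]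

lemma contDiff_diagEntry : ContDiff ℝ ∞ diagEntry := by
  have h1 : ContDiff ℝ ∞ fun x : ℂ × ℝ => Real.sqrt (1 + ‖x.1‖ ^ 2) :=
    (contDiff_const.add (contDiff_fst.norm_sq ℝ)).sqrt fun x => (one_add_norm_sq_pos _).ne'
  have h2 : ContDiff ℝ ∞ fun x : ℂ × ℝ => Complex.exp (x.2 * Complex.I) :=
    ((Complex.ofRealCLM.contDiff.comp contDiff_snd).mul contDiff_const).cexp
  exact (Complex.ofRealCLM.contDiff.comp h1).mul h2

lemma contDiff_conj : ContDiff ℝ ∞ (fun z : ℂ => conj z) := Complex.conjCLE.contDiff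

lemma contDiff_log_diagRatio :
    ContDiff ℝ ∞ fun p : (ℂ × ℝ) × (ℂ × ℝ) => (Complex.log (diagRatio p.1 p.2)).im := by
  have h1 : ContDiff ℝ ∞ fun p : (ℂ × ℝ) × (ℂ × ℝ) => diagRatio p.1 p.2 := by
    simp only [diagRatio, div_eq_mul_inv]
    refine contDiff_const.add (ContDiff.mul ?_ (ContDiff.inv ?_ fun p =>
      mul_ne_zero (diagEntry_ne_zero _) (diagEntry_ne_zero _)))
    · exact (contDiff_fst.comp contDiff_fst).mul
        (contDiff_conj.comp (contDiff_fst.comp contDiff_snd))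
    · exact (contDiff_diagEntry.comp contDiff_fst).mul (contDiff_diagEntry.comp contDiff_snd)
  have h2 : ContDiff ℝ ∞ fun p : (ℂ × ℝ) × (ℂ × ℝ) => Complex.log (diagRatio p.1 p.2) :=
    contDiff_iff_contDiffAt.2 fun p => ContDiffAt.comp (g := Complex.log) p
      ((Complex.contDiffAt_log (Or.inl (diagRatio_re_pos p.1 p.2))).restrict_scalars ℝ)
      h1.contDiffAt
  exact Complex.imCLM.contDiff.comp h2

/-- The universal covering group of `SU(1, 1)`. -/
def coverGroupLaw : SmoothGroupLaw (ℂ × ℝ) where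
  mul := coverMul
  one := 0
  -- Inversion in `SU(1, 1)` conjugates the diagonal entry and negates the off-diagonal one; the
  -- ratio in `x⁻¹ x` is a nonnegative real, so no angle correction arises.
  inv x := -x
  mul_assoc := coverMul_assoc
  one_mul x := by simp [coverMul, diagEntry_zero, diagRatio]
  inv_mul x := by
    have h1 : diagEntry (-x) = conj (diagEntry x) := by
      simp [diagEntry, ← Complex.exp_conj]
    refine Prod.ext ?_ ?_
    · simp [coverMul, h1, mul_comm]
    · have h2 : diagRatio (-x) x = ((1 - ‖x.1‖ ^ 2 / ‖diagEntry x‖ ^ 2 : ℝ) : ℂ) := by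
        rw [diagRatio, h1, mul_comm (conj _), Complex.mul_conj', Prod.fst_neg, neg_mul,
          Complex.mul_conj']
        push_cast
        ring
      have h3 : 0 ≤ 1 - ‖x.1‖ ^ 2 / ‖diagEntry x‖ ^ 2 := by
        rw [norm_diagEntry_sq, sub_nonneg, div_le_one (one_add_norm_sq_pos _)]
        linarith
      simp only [coverMul]
      rw [h2, Complex.log_im, Complex.arg_ofReal_of_nonneg h3]
      simp
  contDiff_mul := by
    refine ContDiff.prodMk ?_ ?_
    · exact ((contDiff_diagEntry.comp contDiff_fst).mul (contDiff_fst.comp contDiff_snd)).add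
        ((contDiff_fst.comp contDiff_fst).mul
          (contDiff_conj.comp (contDiff_diagEntry.comp contDiff_snd)))
    · exact ((contDiff_snd.comp contDiff_fst).add (contDiff_snd.comp contDiff_snd)).add
        contDiff_log_diagRatio
  contDiff_inv := contDiff_neg

/-- The differential of a left translation of `coverGroupLaw` at the unit. -/
def coverLeftDeriv (x : ℂ × ℝ) : ℂ × ℝ →L[ℝ] ℂ × ℝ :=
  LinearMap.toContinuousLinearMap
    { toFun := fun y => (diagEntry x * y.1 - Complex.I * y.2 * x.1,
        y.2 + (x.1 * conj y.1 / diagEntry x).im)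
      map_add' := by
        intro y z
        refine Prod.ext ?_ ?_
        · simp; ring
        · simp [mul_add, add_div]; ring
      map_smul' := by
        intro c y
        refine Prod.ext ?_ ?_
        · simp; ring
        · simp only [Prod.smul_fst, Prod.smul_snd, Complex.real_smul, map_mul, Complex.conj_ofReal,
            smul_eq_mul, RingHom.id_apply, Prod.smul_mk]
          rw [show x.1 * (c * conj y.1) / diagEntry x = c * (x.1 * conj y.1 / diagEntry x) by ring,
            Complex.im_ofReal_mul]
          ring }

lemma hasFDerivAt_diagEntry_zero :
    HasFDerivAt diagEntry
      ((Complex.I • Complex.ofRealCLM).comp (ContinuousLinearMap.snd ℝ ℂ ℝ)) 0 := by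
  have h0 : HasFDerivAt (fun x : ℂ × ℝ => ‖x.1‖ ^ 2) (0 : ℂ × ℝ →L[ℝ] ℝ) 0 := by
    have := (hasStrictFDerivAt_norm_sq (0 : ℂ)).hasFDerivAt.comp (0 : ℂ × ℝ)
      (hasFDerivAt_fst (𝕜 := ℝ))
    simpa [Function.comp_def] using this
  have h1 : HasFDerivAt (fun x : ℂ × ℝ => Real.sqrt (1 + ‖x.1‖ ^ 2)) (0 : ℂ × ℝ →L[ℝ] ℝ) 0 := by
    have := (h0.const_add 1).sqrt (by simp)
    simpa using this
  have h2 : HasFDerivAt (fun x : ℂ × ℝ => (x.2 : ℂ) * Complex.I) _ 0 :=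
    (Complex.ofRealCLM.hasFDerivAt.comp (0 : ℂ × ℝ) (hasFDerivAt_snd (𝕜 := ℝ))).mul_const Complex.I
  have h3 := (Complex.ofRealCLM.hasFDerivAt.comp (0 : ℂ × ℝ) h1).mul h2.cexp
  refine HasFDerivAt.congr_fderiv h3 ?_
  ext x <;> simp

lemma hasFDerivAt_coverMul (x : ℂ × ℝ) :
    HasFDerivAt (coverGroupLaw.mul x) (coverLeftDeriv x) 0 := by
  have hα := hasFDerivAt_diagEntry_zero
  have hconj : HasFDerivAt (fun y : ℂ × ℝ => conj y.1) _ 0 :=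
    Complex.conjCLE.hasFDerivAt.comp (0 : ℂ × ℝ) (hasFDerivAt_fst (𝕜 := ℝ))
  have hαc : HasFDerivAt (fun y : ℂ × ℝ => conj (diagEntry y)) _ 0 :=
    Complex.conjCLE.hasFDerivAt.comp (0 : ℂ × ℝ) hα
  have h1 : HasFDerivAt (fun y : ℂ × ℝ => diagEntry x * y.1 + x.1 * conj (diagEntry y)) _ 0 :=
    ((hasFDerivAt_fst (𝕜 := ℝ)).const_mul (diagEntry x)).add (hαc.const_mul x.1)
  have hinv : DifferentiableAt ℝ (fun y : ℂ × ℝ => (diagEntry x * diagEntry y)⁻¹) 0 :=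
    (hα.differentiableAt.const_mul (diagEntry x)).fun_inv
      (mul_ne_zero (diagEntry_ne_zero x) (diagEntry_ne_zero 0))
  have h2 : HasFDerivAt (fun y : ℂ × ℝ => diagRatio x y) _ 0 :=
    ((hconj.const_mul x.1).mul hinv.hasFDerivAt).const_add 1
  have h3 : HasFDerivAt (fun y : ℂ × ℝ => Complex.log (diagRatio x y)) _ 0 :=
    HasFDerivAt.comp (g := Complex.log) (0 : ℂ × ℝ)
      ((Complex.hasStrictDerivAt_log (Or.inl (diagRatio_re_pos x 0))).hasDerivAt.hasFDerivAt.restrictScalars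
        ℝ) h2
  have h4 : HasFDerivAt (fun y : ℂ × ℝ => x.2 + y.2 + (Complex.log (diagRatio x y)).im) _ 0 :=
    ((hasFDerivAt_snd (𝕜 := ℝ)).const_add x.2).add (Complex.imCLM.hasFDerivAt.comp (0 : ℂ × ℝ) h3)
  refine HasFDerivAt.congr_fderiv (h1.prodMk h4) ?_
  ext y
  · simp [coverLeftDeriv, diagEntry_zero, diagRatio]
  · simp [coverLeftDeriv, diagEntry_zero, diagRatio, div_eq_mul_inv]; ring
  · simp [coverLeftDeriv, diagEntry_zero, diagRatio]; ring
  · simp [coverLeftDeriv, diagEntry_zero, diagRatio]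

/-- The mixed second derivative of `coverGroupLaw` at the unit. -/
def coverSecondDeriv (y : ℂ × ℝ) : ℂ × ℝ →L[ℝ] ℂ × ℝ :=
  LinearMap.toContinuousLinearMap
    { toFun := fun x => (Complex.I * x.2 * y.1 - Complex.I * y.2 * x.1, (x.1 * conj y.1).im)
      map_add' := by
        intro x z
        refine Prod.ext ?_ ?_
        · simp; ring
        · simp; ring
      map_smul' := by
        intro c x
        refine Prod.ext ?_ ?_
        · simp; ring
        · simp; ring }

lemma hasFDerivAt_coverLeftDeriv (y : ℂ × ℝ) :
    HasFDerivAt (fun x => coverLeftDeriv x y) (coverSecondDeriv y) 0 := by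
  have hα := hasFDerivAt_diagEntry_zero
  have hinv : DifferentiableAt ℝ (fun x : ℂ × ℝ => (diagEntry x)⁻¹) 0 :=
    hα.differentiableAt.fun_inv (diagEntry_ne_zero 0)
  have h1 : HasFDerivAt (fun x : ℂ × ℝ => diagEntry x * y.1 - Complex.I * y.2 * x.1) _ 0 :=
    (hα.mul_const y.1).sub ((hasFDerivAt_fst (𝕜 := ℝ)).const_mul (Complex.I * y.2))
  have h2 : HasFDerivAt (fun x : ℂ × ℝ => x.1 * conj y.1 * (diagEntry x)⁻¹) _ 0 :=
    ((hasFDerivAt_fst (𝕜 := ℝ)).mul_const (conj y.1)).mul hinv.hasFDerivAt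
  have h3 : HasFDerivAt (fun x : ℂ × ℝ => y.2 + (x.1 * conj y.1 / diagEntry x).im) _ 0 :=
    (Complex.imCLM.hasFDerivAt.comp (0 : ℂ × ℝ) h2).const_add y.2
  refine HasFDerivAt.congr_fderiv (h1.prodMk h3) ?_
  ext x <;> simp [coverSecondDeriv, diagEntry_zero] <;> ring

lemma coverGroupLaw_bracket {n : ℕ} (e : (ℂ × ℝ) ≃L[ℝ] EuclideanSpace ℝ (Fin n)) (X Y : ℂ × ℝ) :
    ⁅coverGroupLaw.tangent e X, coverGroupLaw.tangent e Y⁆ = coverGroupLaw.tangent e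
      (2 * Complex.I * (X.2 * Y.1 - Y.2 * X.1), 2 * (X.1 * conj Y.1).im) := by
  rw [SmoothGroupLaw.bracket_eq e hasFDerivAt_coverMul hasFDerivAt_coverLeftDeriv X Y]
  congr 1
  refine Prod.ext ?_ ?_
  · simp [coverSecondDeriv]; ring
  · simp [coverSecondDeriv]; ring

end SplitGroup

/-! ### The rotation quasimorphism and rigidity of `𝔰𝔩(2, ℝ)`. -/

section SplitRigidity

/-- For vanishing off-diagonal entries the correction is zero and angles simply add. The `1 / 2`
compensates the factor `2` in `coverGroupLaw_bracket`. -/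
lemma coverGroupLaw_rotation {n : ℕ} (e : (ℂ × ℝ) ≃L[ℝ] EuclideanSpace ℝ (Fin n)) (t : ℝ) :
    oneParameter (coverGroupLaw.tangent e (0, 1 / 2)) t = coverGroupLaw.ofCoord e (0, t / 2) := by
  refine (congrFun (eq_oneParameter_of_hom (γ := fun t => coverGroupLaw.ofCoord e (0, t / 2))
    (X := coverGroupLaw.tangent e (0, 1 / 2)) (fun s t => ?_) ?_) t).symm
  · refine coverGroupLaw.coord_injective e ?_
    rw [SmoothGroupLaw.coord_mul]
    simp only [SmoothGroupLaw.coord_ofCoord]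
    change _ = coverMul _ _
    simp [coverMul, diagRatio, add_div]
  · have h1 : HasDerivAt (fun t : ℝ => ((0 : ℂ), t / 2)) (0, 1 / 2) 0 :=
      (hasDerivAt_const (0 : ℝ) (0 : ℂ)).prodMk ((hasDerivAt_id (0 : ℝ)).div_const 2)
    have h2 : HasFDerivAt (fun t : ℝ => e ((0 : ℂ), t / 2))
        ((1 : ℝ →L[ℝ] ℝ).smulRight (e ((0 : ℂ), (1 / 2 : ℝ)))) 0 :=
      (e.hasFDerivAt.comp_hasDerivAt (0 : ℝ) h1).hasFDerivAt
    exact h2.hasMFDerivAt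

/-- The universal covering group of `SU(1, 1)` carries a homogeneous quasimorphism which does not
vanish on rotations. -/
theorem exists_quasimorphism_coverGroup {n : ℕ} (e : (ℂ × ℝ) ≃L[ℝ] EuclideanSpace ℝ (Fin n)) :
    ∃ f : coverGroupLaw.Carrier e → ℝ, IsHomogeneousQuasimorphism f ∧
      f (oneParameter (coverGroupLaw.tangent e (0, 1 / 2)) 1) = 1 / 2 := by
  have : ContinuousMul (coverGroupLaw.Carrier e) := continuousMul_of_contMDiffMul (𝓡 n) ∞
  -- The angle coordinate is a quasimorphism: its defect is the logarithmic correction, bounded by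
  -- `π / 2`.
  obtain ⟨f, hf, hfw⟩ := exists_homogenization (w := fun g => (coverGroupLaw.coord e g).2)
    (D := Real.pi / 2) (continuous_snd.comp (coverGroupLaw.continuous_coord e)) (by
      intro g h
      rw [SmoothGroupLaw.coord_mul]
      have h1 := abs_log_diagRatio_im_lt (coverGroupLaw.coord e g) (coverGroupLaw.coord e h)
      change |(coverGroupLaw.coord e g).2 + (coverGroupLaw.coord e h).2 + _ - _ - _| ≤ _
      rw [show ∀ a b c : ℝ, a + b + c - a - b = c by intros; ring]
      exact h1.le)
  refine ⟨f, hf, ?_⟩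
  rw [← sub_eq_zero]
  refine eq_zero_of_forall_nat_mul_abs_le (C := Real.pi / 2) fun k => ?_
  -- On rotations both `f` and the angle are linear in `k` and stay within `π / 2` of each other, so
  -- they agree.
  have h := hfw (oneParameter (coverGroupLaw.tangent e (0, 1 / 2)) k)
  rw [hf.map_oneParameter, coverGroupLaw_rotation e k, SmoothGroupLaw.coord_ofCoord] at h
  rw [← Nat.abs_cast k, ← abs_mul]
  refine le_of_eq_of_le ?_ h
  congr 1
  ring

variable {𝔤 : Type*} [LieRing 𝔤] [LieAlgebra ℝ 𝔤] [FiniteDimensional ℝ 𝔤]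
    [TopologicalSpace 𝔤] [IsTopologicalAddGroup 𝔤] [ContinuousSMul ℝ 𝔤] [T2Space 𝔤]

/-- On `𝔰𝔩(2, ℝ)` every continuous `Ad`-invariant quasi-state is the derivative of a homogeneous
quasimorphism. -/
theorem isDerivOfHomogeneousQuasimorphism_of_split (B : Module.Basis (Fin 3) ℝ 𝔤)
    (h1 : ⁅B 0, B 1⁆ = B 2) (h2 : ⁅B 0, B 2⁆ = -B 1) (h3 : ⁅B 1, B 2⁆ = (-1 : ℝ) • B 0)
    {ζ : 𝔤 → ℝ} (hζ : ζ ∈ continuousAdInvariantQuasiStates 𝔤) :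
    IsDerivOfHomogeneousQuasimorphism ζ := by
  let e : (ℂ × ℝ) ≃L[ℝ] EuclideanSpace ℝ (Fin 3) := ContinuousLinearEquiv.ofFinrankEq (by simp)
  have hfd : FiniteDimensional ℝ (GroupLieAlgebra (𝓡 3) (coverGroupLaw.Carrier e)) :=
    inferInstanceAs (FiniteDimensional ℝ (EuclideanSpace ℝ (Fin 3)))
  have hdim : Module.finrank ℝ (GroupLieAlgebra (𝓡 3) (coverGroupLaw.Carrier e)) ≤ 3 :=
    (finrank_euclideanSpace_fin (𝕜 := ℝ) (n := 3)).le
  have hne : ∀ x : ℂ × ℝ, x ≠ 0 → coverGroupLaw.tangent e x ≠ 0 := fun x hx h =>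
    hx ((map_eq_zero_iff e e.injective).1 h)
  have hsmul : ∀ (c : ℝ) (x : ℂ × ℝ), coverGroupLaw.tangent e (c • x) =
      c • coverGroupLaw.tangent e x := fun c x => map_smul e c x
  have hneg : ∀ x : ℂ × ℝ, coverGroupLaw.tangent e (-x) = -coverGroupLaw.tangent e x :=
    fun x => map_neg e x
  obtain ⟨ι, hι⟩ := exists_lieEquiv_of_rotation hdim B h1 h2 h3
    (J := coverGroupLaw.tangent e (0, 1 / 2)) (X := coverGroupLaw.tangent e (1 / 2, 0))
    (Y := coverGroupLaw.tangent e (Complex.I / 2, 0))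
    (hne _ (by simp)) (hne _ (by simp))
    (by rw [coverGroupLaw_bracket]; congr 1; refine Prod.ext ?_ ?_ <;> simp; ring)
    (by
      rw [coverGroupLaw_bracket, ← hneg]
      congr 1
      refine Prod.ext ?_ ?_
      · simp only [Prod.fst_neg]
        push_cast
        linear_combination (1 / 2 : ℂ) * Complex.I_sq
      · simp)
    (by
      rw [coverGroupLaw_bracket, ← hsmul]
      congr 1
      refine Prod.ext ?_ ?_
      · simp
      · simp [map_ofNat]; norm_num)
  obtain ⟨f, hf, hfJ⟩ := exists_quasimorphism_coverGroup e
  -- As `f (exp J) = 1 / 2`, the coefficient `2 ζ (B 0)` makes `η` vanish at `B 0`; an invariant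
  -- homogeneous function with that property is zero.
  let η : 𝔤 → ℝ := fun X => ζ X - ζ (B 0) * 2 * f (oneParameter (ι X) 1)
  have hη : ∀ X, η X = 0 := by
    have hinv : IsAdInvariant η := by
      intro X Y
      have h : f (oneParameter (ι (expAd X Y)) 1) = f (oneParameter (ι Y) 1) :=
        isAdInvariant_of_quasimorphism hf ι X Y
      simp only [η]
      rw [hζ.2.2 X Y, h]
    have hs : ∀ (c : ℝ) Z, η (c • Z) = c * η Z := by
      intro c Z
      have h := smul_of_quasimorphism hf ι c Z
      simp only [η]
      rw [hζ.1.map_smul', h]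
      ring
    have hJ : η (B 0) = 0 := by
      simp only [η]
      rw [hι, hfJ]
      ring
    intro X
    rw [B.eq_add_three X]
    exact eq_zero_of_adInvariant_split hinv hs h1 h2 (by rw [h3, neg_smul, one_smul]) hJ _ _ _
  exact ⟨3, coverGroupLaw.Carrier e, inferInstance, inferInstance, inferInstance, inferInstance,
    inferInstance, inferInstance, ι, fun X => oneParameter X 1, fun g => ζ (B 0) * 2 * f g,
    isExponentialMap_oneParameter, hf.const_mul _, fun X => sub_eq_zero.1 (hη X)⟩

end SplitRigidity

/-! ### Assembling the cases. -/

section Classification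

variable {𝔤 : Type*} [LieRing 𝔤] [LieAlgebra ℝ 𝔤] [FiniteDimensional ℝ 𝔤]
    [TopologicalSpace 𝔤] [IsTopologicalAddGroup 𝔤] [ContinuousSMul ℝ 𝔤] [T2Space 𝔤]

/-- A nonzero `[T, w]` killed by `ad T` would exhibit the Heisenberg algebra, so excluding it is
exactly the kernel condition needed to make `ζ` a character. -/
lemma isDerivOfHomogeneousQuasimorphism_of_abelian_ideal (hdim : Module.finrank ℝ 𝔤 ≤ 3)
    (hH : ¬ Nonempty (𝔤 ≃ₗ⁅ℝ⁆ heisenbergAlgebra)) {T : 𝔤} {τ : 𝔤 →ₗ[ℝ] ℝ} (hT : τ T = 1)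
    (hτ : ∀ x, τ ⁅T, x⁆ = 0) (hbr : ∀ X Y : 𝔤, ⁅X, Y⁆ = τ X • ⁅T, Y⁆ - τ Y • ⁅T, X⁆)
    {ζ : 𝔤 → ℝ} (hζ : ζ ∈ continuousAdInvariantQuasiStates 𝔤) :
    IsDerivOfHomogeneousQuasimorphism ζ := by
  obtain ⟨χ, hχ, rfl⟩ := exists_character_of_adInvariant hT hτ hbr (by
    intro w hw
    by_contra hne
    refine hH (nonempty_lieEquiv_heisenberg hdim (T := T) (w := w - τ w • T) (v := ⁅T, w⁆)
      (by simp) hw ?_ hne)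
    rw [hbr, hτ, zero_smul, sub_zero, map_sub, map_smul, hT, smul_eq_mul, mul_one, sub_self,
      zero_smul]) hζ
  exact isDerivOfHomogeneousQuasimorphism_of_linear (τ := τ)
    (A := (LieAlgebra.ad ℝ 𝔤 T : 𝔤 →ₗ[ℝ] 𝔤)) hτ hχ hbr

lemma isDerivOfHomogeneousQuasimorphism_of_abelian (hab : ∀ x y : 𝔤, ⁅x, y⁆ = 0)
    {ζ : 𝔤 → ℝ} (hζ : IsLieQuasiState ζ) : IsDerivOfHomogeneousQuasimorphism ζ :=
  isDerivOfHomogeneousQuasimorphism_of_linear (τ := 0) (A := 0)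
    (ζ := { toFun := ζ
            map_add' := fun x y => hζ.map_add_of_lie_eq_zero (hab x y)
            map_smul' := fun c x => hζ.map_smul' c x })
    (by simp) (fun _ => by simpa using hζ.map_smul' 0 0) (by simp [hab])

/-- In dimension at most three the Heisenberg algebra is the only obstruction. -/
theorem adInvariantQuasiStates_subset (hdim : Module.finrank ℝ 𝔤 ≤ 3)
    (hH : ¬ Nonempty (𝔤 ≃ₗ⁅ℝ⁆ heisenbergAlgebra)) :
    continuousAdInvariantQuasiStates 𝔤 ⊆ continuousQuasimorphismQuasiStates 𝔤 := by
  intro ζ hζ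
  refine ⟨hζ.1, hζ.2.1, ?_⟩
  by_cases hp : IsPerfectLie 𝔤
  -- Only the zero algebra is both perfect and abelian.
  · by_cases hab : ∀ x y : 𝔤, ⁅x, y⁆ = 0
    · exact isDerivOfHomogeneousQuasimorphism_of_abelian hab hζ.1
    push Not at hab
    obtain ⟨x, y, hxy⟩ := hab
    obtain ⟨B, ε, rfl | rfl, h1, h2, h3⟩ := hp.exists_basis hdim hxy
    · have h0 : ζ = fun _ => 0 := by
        ext X
        rw [B.eq_add_three X]
        exact eq_zero_of_adInvariant_compact hζ.2.2 hζ.1.map_smul' h1 h2 (by rw [h3, one_smul])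
          _ _ _
      rw [h0]
      exact isDerivOfHomogeneousQuasimorphism_zero_of_compact B h1 h2 h3
    · exact isDerivOfHomogeneousQuasimorphism_of_split B h1 h2 h3 hζ
  · unfold IsPerfectLie at hp
    push Not at hp
    obtain ⟨τ, hτ, hτ0⟩ := hp
    obtain ⟨T, σ, hT, hσ, hbr⟩ := exists_abelian_of_not_perfect hdim hτ0 hτ
    exact isDerivOfHomogeneousQuasimorphism_of_abelian_ideal hdim hH hT hσ hbr hζ

end Classification

theorem mainTheorem5 (𝔤 : Type*) [LieRing 𝔤] [LieAlgebra ℝ 𝔤] [FiniteDimensional ℝ 𝔤]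
    [TopologicalSpace 𝔤] [IsTopologicalAddGroup 𝔤] [ContinuousSMul ℝ 𝔤] [T2Space 𝔤]
    (hdim : Module.finrank ℝ 𝔤 ≤ 3) :
    IsQuasiStateRigid 𝔤 ↔ ¬ Nonempty (𝔤 ≃ₗ⁅ℝ⁆ heisenbergAlgebra) := by
  refine ⟨?_, fun hH => ?_⟩
  · rintro hrig ⟨ι⟩
    exact not_isQuasiStateRigid_of_heisenberg ι hrig
  · exact Set.Subset.antisymm quasimorphismQuasiStates_subset
      (adInvariantQuasiStates_subset hdim hH)

end
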